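/- **Setting.** Let $N$ be a complete Riemannian manifold without boundary (in the application, $N=\partial M$ is the boundary of a complete Riemannian manifold $M$), and let $Z_r=[0,r)\times N$ be the product collar, with coordinate $t\in[0,r)$ and $\tau=dt$. Let $E\to N$ be a Hermitian vector bundle with a Hermitian connection $\nabla$, a Clifford multiplication $c$ by $T^*N\oplus\mathbb R\tau$ on $E$ (skew-adjoint, $c(\xi)^2=-|\xi|^2$) that is parallel with respect to $\nabla$ and the Levi-Civita connection, and a self-adjoint bundle map $\Psi:E\to E$. Pulled back to $Z_r$, these data form a Dirac bundle with Dirac operator $D=c(\tau)\partial_t+\sum_i c(e_i)\nabla_{e_i}$ ($e_i$ a local orthonormal frame of $TN$) and the operator $\mathcal D=D+\Psi$. This is the restriction to a collar of the boundary of a self-adjoint operator $\mathcal D=D+\Psi$ on $M$ which is product near the boundary. Assume that $\mathcal D$ is of strongly Callias type, that is, $[D,\Psi]_+=D\Psi+\Psi D$ is a bundle map and for every $R>0$ one has $\Psi^2-\big|[D,\Psi]_+\big|\ge R$ outside a compact subset of $N$. Let $\mathcal A$ be the restriction of $\mathcal D$ to $N$, defined by $\mathcal D=c(\tau)(\partial_t+\mathcal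 A)$, i.e. $\mathcal A=-c(\tau)\big(\sum_i c(e_i)\nabla_{e_i}+\Psi\big)$. Regarded as an operator in $L^2(N,E)$ (the closure from $C_c^\infty(N,E)$), $\mathcal A$ is self-adjoint with discrete spectrum. Let $H^{1/2}_{\mathcal A}(N,E)$ be the completion of $C^\infty_{\mathcal A}=\{u:\|(\mathrm{id}+\mathcal A^2)^{s/2}u\|_{L^2}<\infty\ \forall s\in\mathbb R\}$ for the norm $\|(\mathrm{id}+\mathcal A^2)^{1/4}u\|_{L^2}$, and let $H^{1/2}_{[0,\infty)}(\mathcal A)\subset H^{1/2}_{\mathcal A}(N,E)$ be the image of the spectral projection onto the span of the eigenvectors of $\mathcal A$ with eigenvalues in $[0,\infty)$. Suppose given a smooth orthogonal decomposition $E=\tilde E^+\oplus\tilde E^-$ with respect to which $\mathcal A$ is odd, $\mathcal A=\begin{pmatrix}0&\mathcal A^-\\ \mathcal A^+&0\end{pmatrix}$. Write $u=(u^+,u^-)$ accordingly and set $$B^+=\{(u^+,0)\in H^{1/2}_{\mathcal A}(N,E)\},\qquad B^-=\{(0,u^-)\in H^{1/2}_{\mathcal A}(N,E)\}.$$ A pair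 $(X,Y)$ of closed subspaces of a Hilbert space $Z$ is a Fredholm pair if $\dim(X\cap Y)<\infty$, $X+Y$ is closed, and $\operatorname{codim}(X+Y)=\dim Z/(X+Y)<\infty$; its index is $\operatorname{ind}(X,Y)=\dim(X\cap Y)-\operatorname{codim}(X+Y)$. **Proposition.** $(H^{1/2}_{[0,\infty)}(\mathcal A),B^+)$ and $(H^{1/2}_{[0,\infty)}(\mathcal A),B^-)$ are Fredholm pairs in $H^{1/2}_{\mathcal A}(N,E)$, the $L^2$-kernels $\ker\mathcal A^\pm$ are finite-dimensional, and $$\operatorname{ind}\big(H^{1/2}_{[0,\infty)}(\mathcal A),B^+\big)=\dim\ker\mathcal A^+,\qquad \operatorname{ind}\big(H^{1/2}_{[0,\infty)}(\mathcal A),B^-\big)=\dim\ker\mathcal A^-.$$ -/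

import Mathlib

open Bundle MeasureTheory
open scoped Manifold ContDiff InnerProductSpace ENNReal

noncomputable section

namespace CalliasBoundary

/-! ### Fredholm pairs of closed subspaces of a Hilbert space -/

section FredholmPair

variable {Z : Type*} [NormedAddCommGroup Z] [InnerProductSpace ℂ Z]

/-- `(X, Y)` is a Fredholm pair of closed subspaces of `Z`. -/
structure IsFredholmPair (X Y : Submodule ℂ Z) : Prop where
  closed_left : IsClosed (X : Set Z)
  closed_right : IsClosed (Y : Set Z)
  finite_inf : FiniteDimensional ℂ ↥(X ⊓ Y)
  closed_sup : IsClosed ((X ⊔ Y : Submodule ℂ Z) : Set Z)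
  finite_codim : FiniteDimensional ℂ (Z ⧸ (X ⊔ Y))

/-- `ind (X, Y) = dim (X ∩ Y) - codim (X + Y)`. -/
def fredholmPairIndex (X Y : Submodule ℂ Z) : ℤ :=
  (Module.finrank ℂ ↥(X ⊓ Y) : ℤ) - (Module.finrank ℂ (Z ⧸ (X ⊔ Y)) : ℤ)

end FredholmPair

/-! ### Eigenspaces and Sobolev spaces of an operator in a Hilbert space

`T ⊆ H × H` is the graph of a densely defined operator which is essentially self-adjoint, and whose
closure `A` has discrete spectrum. -/

section Spectral

variable {H : Type*} [NormedAddCommGroup H] [InnerProductSpace ℂ H]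
  (T : Submodule ℂ (H × H))

/-- The eigenspace `ker (A - l)`, for real `l` (zero if `l` is not an eigenvalue), where `A` is the
operator whose graph is the closure of `T`: all `u` such that `(u, l u)` is in this graph. -/
def eigenspace (l : ℝ) : Submodule ℂ H :=
  T.topologicalClosure.comap ((LinearMap.id : H →ₗ[ℂ] H).prod ((l : ℂ) • LinearMap.id))

lemma isClosed_eigenspace (l : ℝ) : IsClosed (eigenspace T l : Set H) := by
  have hc : IsClosed (T.topologicalClosure : Set (H × H)) :=
    Submodule.isClosed_topologicalClosure _
  exact hc.preimage (continuous_id.prodMk (continuous_const_smul (l : ℂ)))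

variable [CompleteSpace H]

instance (l : ℝ) : CompleteSpace (eigenspace T l) :=
  (isClosed_eigenspace T l).completeSpace_coe

/-- The component of `(id + A²)^{s/2} u` in the `l`-eigenspace: the orthogonal projection of `u`
onto that eigenspace, multiplied by `(1 + l²)^{s/2}`. -/
def sobolevComponent (s l : ℝ) : H →ₗ[ℂ] eigenspace T l :=
  (((1 + l ^ 2) ^ (s / 2) : ℝ) : ℂ) •
    ((eigenspace T l).orthogonalProjectionOnto : H →ₗ[ℂ] eigenspace T l)

/-- The Hilbert sum of all the eigenspaces. The spectrum of `A` being discrete, `H` is identified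
with it, `u` corresponding to the family of its projections onto the eigenspaces. -/
abbrev SpectralSum : Type _ := lp (fun l : ℝ ↦ eigenspace T l) 2

/-- The space `C_A^∞` of all `u` such that `‖(id + A²)^{s/2} u‖ < ∞` for all real `s`. (For an
elliptic operator, such `u` are smooth.) -/
def smoothCore : Submodule ℂ H where
  carrier := {u | ∀ s : ℝ, Memℓp (fun l ↦ sobolevComponent T s l u) 2}
  zero_mem' s := by
    have h : (fun l ↦ sobolevComponent T s l 0) = 0 := by ext l; simp
    rw [h]; exact zero_memℓp
  add_mem' {u v} hu hv s := by
    have h : (fun l ↦ sobolevComponent T s l (u + v)) =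
        (fun l ↦ sobolevComponent T s l u) + (fun l ↦ sobolevComponent T s l v) := by
      funext l; exact map_add _ _ _
    rw [h]; exact (hu s).add (hv s)
  smul_mem' a u hu s := by
    have h : (fun l ↦ sobolevComponent T s l (a • u)) =
        a • (fun l ↦ sobolevComponent T s l u) := by
      funext l; exact map_smul _ _ _
    rw [h]; exact (hu s).const_smul a

/-- The map `u ↦ (id + A²)^{s/2} u` on `C_A^∞`, with values in the Hilbert sum of the eigenspaces.
The Sobolev norm of order `s` of `u` is the norm of its image. -/
def sobolevMap (s : ℝ) : smoothCore T →ₗ[ℂ] SpectralSum T where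
  toFun u := ⟨fun l ↦ sobolevComponent T s l u.1, u.2 s⟩
  map_add' _ _ := Subtype.ext (funext fun _ ↦ map_add _ _ _)
  map_smul' _ _ := Subtype.ext (funext fun _ ↦ map_smul _ _ _)

/-- The Sobolev space `H^s_A`: the completion of `C_A^∞` for the norm `‖(id + A²)^{s/2} u‖`. It is
realized as the closure of the image of `C_A^∞` under the linear map that induces this norm. Thus
an element of `H^s_A` is written as the family of its components in the eigenspaces, the one in
the `l`-eigenspace being multiplied by `(1 + l²)^{s/2}`. -/
def Sobolev (s : ℝ) : Type _ := (LinearMap.range (sobolevMap T s)).topologicalClosure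

instance (s : ℝ) : NormedAddCommGroup (Sobolev T s) :=
  inferInstanceAs (NormedAddCommGroup (LinearMap.range (sobolevMap T s)).topologicalClosure)

instance (s : ℝ) : InnerProductSpace ℂ (Sobolev T s) :=
  inferInstanceAs (InnerProductSpace ℂ (LinearMap.range (sobolevMap T s)).topologicalClosure)

instance (s : ℝ) : CompleteSpace (Sobolev T s) :=
  inferInstanceAs (CompleteSpace (LinearMap.range (sobolevMap T s)).topologicalClosure)

/-- `H^s_I(A) = P_I (H^s_A)`, where `P_I` is the projection onto the span of the eigenvectors with
eigenvalue in `I`: the elements of `H^s_A` whose components for the eigenvalues outside `I`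
vanish. -/
def sobolevInterval (s : ℝ) (I : Set ℝ) : Submodule ℂ (Sobolev T s) where
  carrier := {z | ∀ l ∉ I, z.1 l = 0}
  zero_mem' _ _ := rfl
  add_mem' {z w} hz hw l hl := by
    change z.1 l + w.1 l = 0
    rw [hz l hl, hw l hl, add_zero]
  smul_mem' a z hz l hl := by
    change a • z.1 l = 0
    rw [hz l hl, smul_zero]

/-- For `s ≥ 0`, where `H^s_A ⊆ H`, and a subspace `V` of `H`: the elements of `H^s_A` that lie
in `V`. -/
def sobolevSub (s : ℝ) (V : Submodule ℂ H) : Submodule ℂ (Sobolev T s) where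
  carrier := {z | ∃ u ∈ V, ∀ l, z.1 l = sobolevComponent T s l u}
  zero_mem' := ⟨0, zero_mem _, fun _ ↦ (map_zero _).symm⟩
  add_mem' := by
    rintro z w ⟨u, hu, hz⟩ ⟨v, hv, hw⟩
    refine ⟨u + v, add_mem hu hv, fun l ↦ ?_⟩
    change z.1 l + w.1 l = _
    rw [hz l, hw l, map_add]
  smul_mem' := by
    rintro a z ⟨u, hu, hz⟩
    refine ⟨a • u, Submodule.smul_mem _ a hu, fun l ↦ ?_⟩
    change a • z.1 l = _
    rw [hz l, map_smul]

/-- The kernel of the restriction of `A` to a subspace `V` of `H`. -/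
abbrev kerOn (V : Submodule ℂ H) : Submodule ℂ H := eigenspace T 0 ⊓ V

end Spectral

/-! ### Riemannian volume -/

section Volume

variable {n : ℕ} {N : Type*} [EMetricSpace N] [ChartedSpace (EuclideanSpace ℝ (Fin n)) N]
  [RiemannianBundle (fun y : N ↦ TangentSpace (𝓡 n) y)]

/-- The `i`-th coordinate vector field `∂ᵢ` of the chart at `x₀`, at the point of coordinates
`z`. -/
def coordVector (x₀ : N) (z : EuclideanSpace ℝ (Fin n)) (i : Fin n) :
    TangentSpace (𝓡 n) ((extChartAt (𝓡 n) x₀).symm z) :=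
  mfderiv 𝓘(ℝ, EuclideanSpace ℝ (Fin n)) (𝓡 n) (extChartAt (𝓡 n) x₀).symm z
    (EuclideanSpace.single i (1 : ℝ))

/-- `√ det (gᵢⱼ)` in the chart at `x₀`, at the point of coordinates `z`. -/
def volumeDensity (x₀ : N) (z : EuclideanSpace ℝ (Fin n)) : ℝ :=
  √ (Matrix.det (Matrix.of fun i j : Fin n ↦
    ⟪coordVector x₀ z i, coordVector x₀ z j⟫_ℝ))

/-- `μ` is the Riemannian volume measure: in every preferred chart it is
`√ det (gᵢⱼ) dz₁ ⋯ dzₙ`. -/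
def IsRiemannianVolume [MeasurableSpace N] (μ : Measure N) : Prop :=
  ∀ (x₀ : N) (s : Set N), MeasurableSet s → s ⊆ (extChartAt (𝓡 n) x₀).source →
    μ s = ∫⁻ z in (extChartAt (𝓡 n) x₀) '' s, ENNReal.ofReal (volumeDensity x₀ z)

end Volume

/-! ### Sections of a Hermitian vector bundle -/

section Sections

variable (n : ℕ) {N : Type*} [EMetricSpace N] [ChartedSpace (EuclideanSpace ℝ (Fin n)) N]
  (F : Type*) [NormedAddCommGroup F] [NormedSpace ℂ F]
  {E : N → Type*} [TopologicalSpace (TotalSpace F E)] [∀ y, NormedAddCommGroup (E y)]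
  [∀ y, InnerProductSpace ℂ (E y)] [FiberBundle F E]

/-- `u` is a `C^∞` section of `E`. -/
def IsSmoothSection (u : Π y, E y) : Prop :=
  ContMDiff (𝓡 n) ((𝓡 n).prod 𝓘(ℝ, F)) ∞ (fun y ↦ TotalSpace.mk' F y (u y))

/-- `u` vanishes outside a compact set. -/
def HasCompactSupp (u : Π y, E y) : Prop :=
  ∃ K : Set N, IsCompact K ∧ ∀ y ∉ K, u y = 0

/-- `X` is a `C^∞` vector field on `N`. -/
def IsSmoothField [IsManifold (𝓡 n) ∞ N] (X : Π y : N, TangentSpace (𝓡 n) y) : Prop :=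
  ContMDiff (𝓡 n) (𝓡 n).tangent ∞ (fun y ↦ (⟨y, X y⟩ : TangentBundle (𝓡 n) N))

variable (E) in
/-- The scalar products of the fibres depend smoothly on the base point: `E` is a Hermitian vector
bundle. -/
class IsHermitianBundle : Prop where
  smooth_inner : ∀ u v : Π y, E y, IsSmoothSection n F u → IsSmoothSection n F v →
    ContMDiff (𝓡 n) 𝓘(ℝ, ℂ) ∞ (fun y ↦ ⟪u y, v y⟫_ℂ)

variable {n F}

lemma IsSmoothSection.add [VectorBundle ℝ F E] {u v : Π y, E y}
    (hu : IsSmoothSection n F u) (hv : IsSmoothSection n F v) :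
    IsSmoothSection n F (u + v) :=
  ContMDiff.add_section hu hv

lemma IsSmoothSection.smul [VectorBundle ℂ F E] (a : ℂ) {u : Π y, E y}
    (hu : IsSmoothSection n F u) : IsSmoothSection n F (a • u) := by
  intro x₀
  have h := (contMDiffAt_section x₀).1 (hu x₀)
  refine (contMDiffAt_section x₀).2 ?_
  have h2 : ContMDiffAt (𝓡 n) 𝓘(ℝ, F) ∞
      (fun x ↦ a • (trivializationAt F E x₀ ⟨x, u x⟩).2) x₀ := by
    have hL : ContDiff ℝ ∞ (fun w : F ↦ a • w) := contDiff_id.const_smul a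
    exact hL.contMDiff.contMDiffAt.comp x₀ h
  refine h2.congr_of_eventuallyEq ?_
  filter_upwards [(trivializationAt F E x₀).open_baseSet.mem_nhds
    (FiberBundle.mem_baseSet_trivializationAt' x₀)] with x hx
  exact ((trivializationAt F E x₀).linear ℂ hx).map_smul a (u x)

end Sections

/-! ### `L²` sections -/

section L2

variable (n : ℕ) {N : Type*} [EMetricSpace N] [ChartedSpace (EuclideanSpace ℝ (Fin n)) N]
  (F : Type*) [NormedAddCommGroup F] [NormedSpace ℂ F]
  (E : N → Type*) [TopologicalSpace (TotalSpace F E)] [∀ y, NormedAddCommGroup (E y)]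
  [∀ y, InnerProductSpace ℂ (E y)] [FiberBundle F E] [VectorBundle ℂ F E] [VectorBundle ℝ F E]

/-- The space `C_c^∞(N, E)` of smooth compactly supported sections. -/
def testSections : Submodule ℂ (Π y, E y) where
  carrier := {u | IsSmoothSection n F u ∧ HasCompactSupp u}
  zero_mem' := ⟨contMDiff_zeroSection ℝ E, ∅, isCompact_empty, fun _ _ ↦ rfl⟩
  add_mem' := by
    rintro u v ⟨hu, K, hK, hKu⟩ ⟨hv, L, hL, hLv⟩
    refine ⟨hu.add hv, K ∪ L, hK.union hL, fun y hy ↦ ?_⟩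
    simp only [Set.mem_union, not_or] at hy
    simp [hKu y hy.1, hLv y hy.2]
  smul_mem' := by
    rintro a u ⟨hu, K, hK, hKu⟩
    exact ⟨hu.smul a, K, hK, fun y hy ↦ by simp [hKu y hy]⟩

variable [MeasurableSpace N] (μ : Measure N)

/-- `C_c^∞(N, E)`, to be endowed with the `L²` inner product of the measure `μ`. -/
@[nolint unusedArguments]
def TestSection (_μ : Measure N) : Type _ := testSections n F E

instance : AddCommGroup (TestSection n F E μ) :=
  inferInstanceAs (AddCommGroup (testSections n F E))

instance : Module ℂ (TestSection n F E μ) :=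
  inferInstanceAs (Module ℂ (testSections n F E))

variable {n F E μ} in
/-- The section underlying an element of `C_c^∞(N, E)`. -/
def TestSection.toFun (u : TestSection n F E μ) : Π y, E y :=
  (show testSections n F E from u).1

lemma integrable_inner_section [BorelSpace N] [IsLocallyFiniteMeasure μ]
    [IsHermitianBundle n F E] (u v : TestSection n F E μ) :
    Integrable (fun y ↦ ⟪u.toFun y, v.toFun y⟫_ℂ) μ := by
  obtain ⟨hu, K, hK, hKu⟩ := (show testSections n F E from u).2
  obtain ⟨hv, -⟩ := (show testSections n F E from v).2
  refine (IsHermitianBundle.smooth_inner _ _ hu hv).continuous.integrable_of_hasCompactSupport ?_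
  exact HasCompactSupport.intro hK fun y hy ↦ by rw [hKu y hy, inner_zero_left]

variable [BorelSpace N] [IsLocallyFiniteMeasure μ] [IsHermitianBundle n F E]

/-- The `L²` inner product `(u, v) = ∫ ⟨u(y), v(y)⟩ dμ(y)` on `C_c^∞(N, E)`. -/
@[reducible]
def TestSection.core : PreInnerProductSpace.Core ℂ (TestSection n F E μ) where
  inner u v := ∫ y, ⟪u.toFun y, v.toFun y⟫_ℂ ∂μ
  conj_inner_symm u v := by
    rw [← integral_conj]
    exact integral_congr_ae (.of_forall fun y ↦ inner_conj_symm _ _)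
  re_inner_nonneg u := by
    rw [← integral_re (integrable_inner_section n F E μ u u)]
    exact integral_nonneg fun y ↦ inner_self_nonneg
  add_left u v w := by
    rw [← integral_add (integrable_inner_section n F E μ u w)
      (integrable_inner_section n F E μ v w)]
    exact integral_congr_ae (.of_forall fun y ↦ inner_add_left _ _ _)
  smul_left u v a := by
    rw [← integral_const_mul]
    exact integral_congr_ae (.of_forall fun y ↦ inner_smul_left _ _ _)

instance : SeminormedAddCommGroup (TestSection n F E μ) :=
  letI := TestSection.core n F E μ
  InnerProductSpace.Core.toSeminormedAddCommGroup (𝕜 := ℂ)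

instance : InnerProductSpace ℂ (TestSection n F E μ) :=
  InnerProductSpace.ofCore (TestSection.core n F E μ)

/-- The Hilbert space `L²(N, E)`, as the completion of `C_c^∞(N, E)`. -/
abbrev L2 : Type _ := UniformSpace.Completion (TestSection n F E μ)

/-- `L²(N, E')` for a family of subspaces `E'_y ⊆ E_y`: the closure in `L²(N, E)` of the smooth
compactly supported sections with values in `E'`. -/
def L2Sub (E' : Π y, Submodule ℂ (E y)) : Submodule ℂ (L2 n F E μ) :=
  (Submodule.span ℂ {w : L2 n F E μ | ∃ φ : TestSection n F E μ,
    (∀ y, φ.toFun y ∈ E' y) ∧ w = (φ : L2 n F E μ)}).topologicalClosure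

/-- The graph in `L² × L²` of the operator `A` with domain `C_c^∞(N, E)`. -/
def testGraph (A : (Π y, E y) → (Π y, E y)) : Submodule ℂ (L2 n F E μ × L2 n F E μ) :=
  Submodule.span ℂ {p : L2 n F E μ × L2 n F E μ | ∃ φ ψ : TestSection n F E μ,
    (∀ y, ψ.toFun y = A φ.toFun y) ∧ p = ((φ : L2 n F E μ), (ψ : L2 n F E μ))}

end L2

/-! ### Strongly Callias-type operators that are product near the boundary -/

section Dirac

variable (n : ℕ) (N : Type*) [EMetricSpace N] [ChartedSpace (EuclideanSpace ℝ (Fin n)) N]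
  [IsManifold (𝓡 n) ∞ N]
  [RiemannianBundle (fun y : N ↦ TangentSpace (𝓡 n) y)]
  [IsContMDiffRiemannianBundle (𝓡 n) ∞ (EuclideanSpace ℝ (Fin n))
    (fun y : N ↦ TangentSpace (𝓡 n) y)]
  (F : Type*) [NormedAddCommGroup F] [NormedSpace ℂ F] [FiniteDimensional ℂ F]
  (E : N → Type*) [TopologicalSpace (TotalSpace F E)] [∀ y, NormedAddCommGroup (E y)]
  [∀ y, InnerProductSpace ℂ (E y)] [FiberBundle F E] [VectorBundle ℂ F E] [VectorBundle ℝ F E]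
  [ContMDiffVectorBundle ∞ F E (𝓡 n)] [IsHermitianBundle n F E]

instance : IsContMDiffRiemannianBundle (𝓡 n) 1 (EuclideanSpace ℝ (Fin n))
    (fun y : N ↦ TangentSpace (𝓡 n) y) :=
  IsContMDiffRiemannianBundle.of_le (n := ∞) (by simp)

/-- The data of a Dirac bundle with potential on a collar `[0, r) × N` of the boundary `N`, all of
whose structures are product, that is, pulled back from `N`: a Hermitian vector bundle `E` with a
Hermitian connection, a Clifford action of `TN ⊕ ℝ τ` (tangent and cotangent vectors being identified
by the metric; `τ = dt` is the inward unit normal), parallel for the Levi-Civita connection, and a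
self-adjoint potential. -/
structure CollarDiracBundle where
  /-- the Levi-Civita connection of `N` -/
  lc : CovariantDerivative (𝓡 n) (EuclideanSpace ℝ (Fin n)) (fun y : N ↦ TangentSpace (𝓡 n) y)
  lc_metric : lc.IsMetricCompatible
  lc_torsion : lc.torsion = 0
  /-- the connection of `E` -/
  conn : CovariantDerivative (𝓡 n) F E
  conn_smooth : CovariantDerivative.ContMDiffCovariantDerivative conn ∞
  conn_smul : ∀ (a : ℂ) (u : Π y, E y), IsSmoothSection n F u →
    ∀ y (w : TangentSpace (𝓡 n) y), conn (a • u) y w = a • conn u y w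
  conn_metric : ∀ u v : Π y, E y, IsSmoothSection n F u → IsSmoothSection n F v →
    ∀ y (w : TangentSpace (𝓡 n) y),
      (mfderiv (𝓡 n) 𝓘(ℝ, ℂ) (fun x ↦ ⟪u x, v x⟫_ℂ) y w : ℂ) =
        ⟪conn u y w, v y⟫_ℂ + ⟪u y, conn v y w⟫_ℂ
  /-- Clifford multiplication by vectors tangent to `N` -/
  c : Π y : N, TangentSpace (𝓡 n) y →ₗ[ℝ] (E y →L[ℂ] E y)
  c_smooth : ∀ (X : Π y : N, TangentSpace (𝓡 n) y) (u : Π y, E y), IsSmoothField n X →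
    IsSmoothSection n F u → IsSmoothSection n F (fun y ↦ c y (X y) (u y))
  c_sq : ∀ y (w : TangentSpace (𝓡 n) y) (e : E y), c y w (c y w e) = -((‖w‖ ^ 2 : ℝ) : ℂ) • e
  c_skew : ∀ y (w : TangentSpace (𝓡 n) y) (e f : E y), ⟪c y w e, f⟫_ℂ = -⟪e, c y w f⟫_ℂ
  c_parallel : ∀ (X : Π y : N, TangentSpace (𝓡 n) y) (u : Π y, E y), IsSmoothField n X →
    IsSmoothSection n F u → ∀ y (w : TangentSpace (𝓡 n) y),
      conn (fun x ↦ c x (X x) (u x)) y w = c y (lc X y w) (u y) + c y (X y) (conn u y w)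
  /-- Clifford multiplication `c(τ)` by the unit normal -/
  cτ : Π y : N, E y →L[ℂ] E y
  cτ_smooth : ∀ u : Π y, E y, IsSmoothSection n F u → IsSmoothSection n F (fun y ↦ cτ y (u y))
  cτ_sq : ∀ y (e : E y), cτ y (cτ y e) = -e
  cτ_skew : ∀ y (e f : E y), ⟪cτ y e, f⟫_ℂ = -⟪e, cτ y f⟫_ℂ
  cτ_c : ∀ y (w : TangentSpace (𝓡 n) y) (e : E y), cτ y (c y w e) = -c y w (cτ y e)
  cτ_parallel : ∀ u : Π y, E y, IsSmoothSection n F u → ∀ y (w : TangentSpace (𝓡 n) y),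
    conn (fun x ↦ cτ x (u x)) y w = cτ y (conn u y w)
  /-- the potential `Ψ` -/
  pot : Π y : N, E y →L[ℂ] E y
  pot_smooth : ∀ u : Π y, E y, IsSmoothSection n F u → IsSmoothSection n F (fun y ↦ pot y (u y))
  pot_symm : ∀ y (e f : E y), ⟪pot y e, f⟫_ℂ = ⟪e, pot y f⟫_ℂ

variable {n N F E}

instance (y : N) : FiniteDimensional ℝ (TangentSpace (𝓡 n) y) :=
  inferInstanceAs (FiniteDimensional ℝ (EuclideanSpace ℝ (Fin n)))

namespace CollarDiracBundle

variable (S : CollarDiracBundle n N F E)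

/-- The tangential part `∑ᵢ c(eᵢ) ∇_{eᵢ}` (`e₁, …, eₙ` an orthonormal basis of `T_y N`) of the Dirac
operator `D = c(τ) ∂_t + ∑ᵢ c(eᵢ) ∇_{eᵢ}` of the collar. -/
def tangentialDirac (u : Π y, E y) : Π y, E y := fun y ↦
  ∑ i, S.c y (stdOrthonormalBasis ℝ (TangentSpace (𝓡 n) y) i)
    (S.conn u y (stdOrthonormalBasis ℝ (TangentSpace (𝓡 n) y) i))

/-- The restriction `𝒜` of `𝒟 = D + Ψ` to the boundary, determined by `𝒟 = c(τ) (∂_t + 𝒜)` on the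
collar: as `c(τ)⁻¹ = -c(τ)`, one has `𝒜 = -c(τ) (∑ᵢ c(eᵢ) ∇_{eᵢ} + Ψ)`. -/
def boundaryOp (u : Π y, E y) : Π y, E y := fun y ↦
  -S.cτ y (S.tangentialDirac u y + S.pot y (u y))

/-- The restriction to the collar of the conditions for `𝒟 = D + Ψ` to be strongly Callias-type.
The anticommutator `[D, Ψ]₊` is `(c(τ) Ψ + Ψ c(τ)) ∂_t + [∑ᵢ c(eᵢ) ∇_{eᵢ}, Ψ]₊`; it has to be a
bundle map, and `Ψ² - |[D, Ψ]₊| ≥ R` has to hold outside a compact set, for every `R > 0`. -/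
structure IsStronglyCallias : Prop where
  cτ_pot : ∀ y (e : E y), S.cτ y (S.pot y e) + S.pot y (S.cτ y e) = 0
  callias : ∃ Θ : Π y : N, E y →L[ℂ] E y,
    (∀ u : Π y, E y, IsSmoothSection n F u → ∀ y,
      S.tangentialDirac (fun x ↦ S.pot x (u x)) y + S.pot y (S.tangentialDirac u y) =
        Θ y (u y)) ∧
    ∀ R : ℝ, 0 < R → ∃ K : Set N, IsCompact K ∧ ∀ y ∉ K, ∀ e : E y,
      R * ‖e‖ ^ 2 ≤ ‖S.pot y e‖ ^ 2 - ‖Θ y‖ * ‖e‖ ^ 2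

end CollarDiracBundle

variable (n F) in
/-- A smooth orthogonal decomposition `E = E⁺ ⊕ E⁻` with respect to which the operator `A` is odd,
that is, `A` maps sections of `E^±` to sections of `E^∓`. -/
structure OddGrading (A : (Π y, E y) → (Π y, E y)) where
  plus : Π y : N, Submodule ℂ (E y)
  minus : Π y : N, Submodule ℂ (E y)
  orthogonal : ∀ y, plus y ⟂ minus y
  sup_eq_top : ∀ y, plus y ⊔ minus y = ⊤
  smooth : ∀ u : Π y, E y, IsSmoothSection n F u → ∃ u₁ u₂ : Π y, E y,
    IsSmoothSection n F u₁ ∧ IsSmoothSection n F u₂ ∧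
      ∀ y, u₁ y ∈ plus y ∧ u₂ y ∈ minus y ∧ u y = u₁ y + u₂ y
  odd_plus : ∀ u : Π y, E y, IsSmoothSection n F u → (∀ y, u y ∈ plus y) →
    ∀ y, A u y ∈ minus y
  odd_minus : ∀ u : Π y, E y, IsSmoothSection n F u → (∀ y, u y ∈ minus y) →
    ∀ y, A u y ∈ plus y

end Dirac

end CalliasBoundary

end

open Bundle MeasureTheory
open scoped Manifold ContDiff InnerProductSpace ENNReal

set_option linter.unusedSectionVars false

noncomputable section

/-! Two facts carry the theorem: an algebraic one about odd symmetric operators, and an analytic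
one, the finite-dimensionality of the kernel of `𝒜`.

Algebra. Let `R` be the reflection in `L²(E⁺)`, that is `u⁺ + u⁻ ↦ u⁺ - u⁻`. Since `𝒜` is odd, `R`
anticommutes with it and exchanges the eigenspaces of `l` and `-l`. Since `𝒜` is symmetric, its
eigenspaces are mutually orthogonal, and an element of the Sobolev space is the same as an arbitrary
square-summable family `(z_l)` of eigenvectors (`IsSymmetricGraph.range_sobolevMap_dense`). In these
terms `B⁺` is the set of families with `R z_l = z_{-l}` (`mem_sobolevSub_iff`). Components with `l <
0` can be prescribed freely in `B⁺`, so `B⁺` and the nonnegative part together span everything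
(`sobolevInterval_sup_sobolevSub`). An element of the intersection vanishes for `l < 0`, hence for
`l > 0` by the symmetry, and is determined by `z_0`, a vector of the kernel fixed by `R`
(`exists_equiv_inf`). So the codimension is zero and the index is the dimension of the kernel of
`𝒜⁺`. The case of `B⁻` follows on exchanging the summands of the grading.

Symmetry of `𝒜`. The tangential Dirac operator is formally self-adjoint: `⟨Du, v⟩ - ⟨u, Dv⟩` is a
divergence, which integrates to zero in a chart because the logarithmic derivative of `√det g` is
the trace of the Christoffel symbols (`CoordPatch.mvfderiv_density`). As `c(τ)` is skew and
anticommutes with both `D` and `Ψ`, the operator `-c(τ)(D + Ψ)` is symmetric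
(`CollarDiracBundle.inner_boundaryTest`).

Finite-dimensionality. Expanding `‖(D + Ψ)φ‖²` and dropping `‖Dφ‖²` leaves `∫ |Ψφ|² + Re⟨φ, [D,
Ψ]₊φ⟩` as a lower bound (`CollarDiracBundle.integral_callias_le`). By the Callias condition its
integrand dominates `|φ|²` outside a compact set. On that set the missing mass is supplied by
finitely many cut-off norms, which are compact relative to the graph norm: freezing the coefficients
gives a local elliptic estimate (`CollarDiracBundle.exists_elliptic_estimate`), and a quantitative
Rellich theorem, proved with the Fourier transform, yields
`CollarDiracBundle.exists_isRelCompactForm`. On the kernel of the closure, the norm is then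
controlled by finitely many functionals (`finiteDimensional_eigenspace_zero`). -/

namespace CalliasBoundary
-- Odd symmetric operators in a Hilbert space and their Fredholm pairs.
section AbstractFredholm

variable {H : Type*} [NormedAddCommGroup H] [InnerProductSpace ℂ H] {T : Submodule ℂ (H × H)}

/-- The operator with graph `T` is symmetric. -/
def IsSymmetricGraph (T : Submodule ℂ (H × H)) : Prop :=
  ∀ p ∈ T, ∀ q ∈ T, ⟪p.2, q.1⟫_ℂ = ⟪p.1, q.2⟫_ℂ

lemma IsSymmetricGraph.topologicalClosure (hT : IsSymmetricGraph T) :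
    IsSymmetricGraph T.topologicalClosure := by
  have h1 : ∀ p ∈ T, ∀ q ∈ T.topologicalClosure, ⟪p.2, q.1⟫_ℂ = ⟪p.1, q.2⟫_ℂ := by
    intro p hp q hq
    have hc : IsClosed {q : H × H | ⟪p.2, q.1⟫_ℂ = ⟪p.1, q.2⟫_ℂ} :=
      isClosed_eq (by fun_prop) (by fun_prop)
    exact closure_minimal (fun q hq ↦ hT p hp q hq) hc hq
  intro p hp q hq
  have hc : IsClosed {p : H × H | ⟪p.2, q.1⟫_ℂ = ⟪p.1, q.2⟫_ℂ} :=
    isClosed_eq (by fun_prop) (by fun_prop)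
  exact closure_minimal (fun p hp ↦ h1 p hp q hq) hc hp

lemma mem_eigenspace {l : ℝ} {u : H} :
    u ∈ eigenspace T l ↔ (u, (l : ℂ) • u) ∈ T.topologicalClosure := Iff.rfl

lemma IsSymmetricGraph.inner_eq_zero (hT : IsSymmetricGraph T) {l m : ℝ} (hlm : l ≠ m) {u v : H}
    (hu : u ∈ eigenspace T l) (hv : v ∈ eigenspace T m) : ⟪u, v⟫_ℂ = 0 := by
  have h := hT.topologicalClosure _ (mem_eigenspace.1 hu) _ (mem_eigenspace.1 hv)
  simp only [inner_smul_left, inner_smul_right, Complex.conj_ofReal] at h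
  have h' : ((l : ℂ) - m) * ⟪u, v⟫_ℂ = 0 := by linear_combination h
  rcases mul_eq_zero.1 h' with h0 | h0
  · exact absurd (by exact_mod_cast sub_eq_zero.1 h0) hlm
  · exact h0

lemma IsSymmetricGraph.orthogonalFamily (hT : IsSymmetricGraph T) :
    OrthogonalFamily ℂ (fun l : ℝ ↦ eigenspace T l) (fun l ↦ (eigenspace T l).subtypeₗᵢ) := by
  intro l m hlm u v
  exact hT.inner_eq_zero hlm u.2 v.2

variable {K : Submodule ℂ H} [K.HasOrthogonalProjection]

/-- The operator with graph `T` anticommutes with the reflection in `K`. -/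
def IsOddGraph (T : Submodule ℂ (H × H)) (K : Submodule ℂ H) [K.HasOrthogonalProjection] : Prop :=
  ∀ p ∈ T, (K.reflection p.1, -K.reflection p.2) ∈ T

lemma IsOddGraph.topologicalClosure (hK : IsOddGraph T K) : IsOddGraph T.topologicalClosure K := by
  have hc : Continuous fun p : H × H ↦ (K.reflection p.1, -K.reflection p.2) := by fun_prop
  intro p hp
  exact map_mem_closure (f := fun p : H × H ↦ (K.reflection p.1, -K.reflection p.2)) hc hp hK

/-- If `Au = lu`, then `A(Ru) = -R(Au) = -l(Ru)`. -/
lemma IsOddGraph.reflection_mem (hK : IsOddGraph T K) {l : ℝ} {u : H} (hu : u ∈ eigenspace T l) :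
    K.reflection u ∈ eigenspace T (-l) := by
  have h := hK.topologicalClosure _ (mem_eigenspace.1 hu)
  rw [map_smul] at h
  rw [mem_eigenspace]
  simpa using h

variable [CompleteSpace H]

lemma IsSymmetricGraph.projection_of_ne (hT : IsSymmetricGraph T) {l m : ℝ} (hlm : l ≠ m) {u : H}
    (hu : u ∈ eigenspace T l) : (eigenspace T m).orthogonalProjectionOnto u = 0 := by
  rw [Submodule.orthogonalProjectionOnto_eq_zero_iff]
  intro v hv
  exact hT.inner_eq_zero hlm.symm hv hu

/-- The scalar factor `(1 + l²)^{s/2}`. -/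
def sobolevWeight (s l : ℝ) : ℝ := (1 + l ^ 2) ^ (s / 2)

lemma sobolevWeight_pos (s l : ℝ) : 0 < sobolevWeight s l :=
  Real.rpow_pos_of_pos (by positivity) _

lemma sobolevWeight_neg (s l : ℝ) : sobolevWeight s (-l) = sobolevWeight s l := by
  simp [sobolevWeight]

lemma one_le_sobolevWeight {s : ℝ} (hs : 0 ≤ s) (l : ℝ) : 1 ≤ sobolevWeight s l :=
  Real.one_le_rpow (by nlinarith [sq_nonneg l]) (by positivity)

lemma sobolevComponent_apply (s l : ℝ) (u : H) :
    sobolevComponent T s l u =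
      ((sobolevWeight s l : ℝ) : ℂ) • (eigenspace T l).orthogonalProjectionOnto u := rfl

open Classical in
lemma IsSymmetricGraph.sobolevComponent_eigenvector (hT : IsSymmetricGraph T) (s l m : ℝ)
    (v : eigenspace T l) : sobolevComponent T s m (v : H) =
      (lp.single 2 l (((sobolevWeight s l : ℝ) : ℂ) • v) : SpectralSum T) m := by
  rw [sobolevComponent_apply, lp.single_apply]
  by_cases h : m = l
  · subst h
    simp
  · rw [hT.projection_of_ne (Ne.symm h) v.2]
    simp [h]

-- By orthogonality an eigenvector has only one nonzero component, so it lies in the smooth core.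
-- Rescaled by the inverse weight it gives any prescribed `lp.single`, and finite sums of these are
-- dense. After this, every square-summable family is an element of the Sobolev space.
open Classical in
lemma IsSymmetricGraph.range_sobolevMap_dense (hT : IsSymmetricGraph T) (s : ℝ) :
    (LinearMap.range (sobolevMap T s)).topologicalClosure = ⊤ := by
  have hsingle : ∀ (l : ℝ) (v : eigenspace T l),
      (lp.single 2 l v : SpectralSum T) ∈ LinearMap.range (sobolevMap T s) := by
    intro l v
    have hcore : ∀ w : eigenspace T l, (w : H) ∈ smoothCore T := fun w t ↦ by
      have : (fun m ↦ sobolevComponent T t m (w : H)) =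
          (lp.single 2 l (((sobolevWeight t l : ℝ) : ℂ) • w) : SpectralSum T) :=
        funext fun m ↦ hT.sobolevComponent_eigenvector t l m w
      rw [this]
      exact lp.memℓp _
    refine ⟨⟨_, hcore (((sobolevWeight s l : ℝ) : ℂ)⁻¹ • v)⟩, ?_⟩
    ext1
    funext m
    refine (hT.sobolevComponent_eigenvector s l m (((sobolevWeight s l : ℝ) : ℂ)⁻¹ • v)).trans ?_
    rw [smul_smul, mul_inv_cancel₀ (by exact_mod_cast (sobolevWeight_pos s l).ne'), one_smul]
  rw [eq_top_iff]
  intro z _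
  have hz := lp.hasSum_single (p := 2) (by norm_num) z
  exact mem_closure_of_tendsto hz (.of_forall fun t ↦ Submodule.sum_mem _ fun l _ ↦ hsingle l _)

/-- An element of `H^s_A` from its family of components. -/
def IsSymmetricGraph.toSobolev (hT : IsSymmetricGraph T) (s : ℝ) (w : SpectralSum T) :
    Sobolev T s := ⟨w, by rw [hT.range_sobolevMap_dense s]; trivial⟩

lemma continuous_sobolev_apply (s l : ℝ) :
    Continuous (fun z : Sobolev T s ↦ ((z.1 l : eigenspace T l) : H)) := by
  have h1 : Continuous (fun z : Sobolev T s ↦ (z.1 : SpectralSum T)) := continuous_subtype_val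
  exact continuous_subtype_val.comp
    ((lp.lipschitzWith_one_eval (E := fun l : ℝ ↦ eigenspace T l) 2 l).continuous.comp h1)

lemma isClosed_sobolevInterval (s : ℝ) (I : Set ℝ) :
    IsClosed (sobolevInterval T s I : Set (Sobolev T s)) := by
  have : (sobolevInterval T s I : Set (Sobolev T s)) =
      ⋂ l ∈ Iᶜ, {z : Sobolev T s | ((z.1 l : eigenspace T l) : H) = 0} := by
    ext z
    simp only [Set.mem_iInter, Set.mem_ofPred_eq, Set.mem_compl_iff, ZeroMemClass.coe_eq_zero]
    rfl
  rw [this]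
  exact isClosed_biInter fun l _ ↦
    isClosed_eq (continuous_sobolev_apply s l) continuous_const

/-- The reflection is unitary and exchanges the two eigenspaces, so it intertwines the projections
onto them. -/
lemma IsOddGraph.projection_reflection (hK : IsOddGraph T K) (l : ℝ) (u : H) :
    ((eigenspace T (-l)).orthogonalProjectionOnto (K.reflection u) : H) =
      K.reflection ((eigenspace T l).orthogonalProjectionOnto u : H) := by
  rw [← Submodule.starProjection_apply, ← Submodule.starProjection_apply]
  refine Submodule.eq_starProjection_of_mem_of_inner_eq_zero
    (hK.reflection_mem (Submodule.starProjection_apply_mem _ _)) fun v hv ↦ ?_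
  have hv' : K.reflection v ∈ eigenspace T l := by simpa using hK.reflection_mem hv
  rw [← map_sub, ← K.reflection_reflection v, LinearIsometryEquiv.inner_map_map]
  exact Submodule.starProjection_inner_eq_zero _ _ hv'

/-- This replaces the existence of a vector of `K` by equations on the components. They are closed
conditions, and they can be solved one pair `{l, -l}` at a time. -/
lemma mem_sobolevSub_iff (hT : IsSymmetricGraph T) (hK : IsOddGraph T K) {s : ℝ} (hs : 0 ≤ s)
    (z : Sobolev T s) : z ∈ sobolevSub T s K ↔
      ∀ l, K.reflection (z.1 l : H) = (z.1 (-l) : H) := by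
  constructor
  · rintro ⟨u, hu, hz⟩ l
    rw [hz, hz, sobolevComponent_apply, sobolevComponent_apply, Submodule.coe_smul,
      Submodule.coe_smul, map_smul, ← hK.projection_reflection, sobolevWeight_neg,
      (K.reflection_eq_self_iff u).2 hu]
  · intro hz
    -- Here `0 ≤ s` enters: the weights are at least one, so dividing by them preserves
    -- square-summability and the family has a sum in `H`.
    have hw : Memℓp (fun l ↦ ((sobolevWeight s l : ℝ) : ℂ)⁻¹ • z.1 l) 2 := by
      have h2 : 0 < (2 : ℝ≥0∞).toReal := by norm_num
      have hz2 := (memℓp_gen_iff h2).1 (lp.memℓp (z.1 : SpectralSum T))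
      refine memℓp_gen (hz2.of_nonneg_of_le (fun l ↦ by positivity) fun l ↦ ?_)
      refine Real.rpow_le_rpow (norm_nonneg _) ?_ h2.le
      rw [norm_smul, norm_inv, Complex.norm_real, Real.norm_of_nonneg (sobolevWeight_pos s l).le]
      exact mul_le_of_le_one_left (norm_nonneg _) (inv_le_one_of_one_le₀ (one_le_sobolevWeight hs l))
    set w : SpectralSum T := ⟨_, hw⟩ with hwdef
    have hwl : ∀ l, w l = ((sobolevWeight s l : ℝ) : ℂ)⁻¹ • z.1 l := fun l ↦ rfl
    have hsum := hT.orthogonalFamily.hasSum_linearIsometry w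
    set u : H := hT.orthogonalFamily.linearIsometry w with hu
    change HasSum (fun l ↦ (w l : H)) u at hsum
    have hproj : ∀ l, (eigenspace T l).orthogonalProjectionOnto u = w l := by
      intro l
      have h1 := hsum.mapL (eigenspace T l).orthogonalProjectionOnto
      refine h1.unique ?_
      convert hasSum_single l ?_ using 1
      · simp
      · intro m hm
        exact hT.projection_of_ne hm (w m).2
    refine ⟨u, ?_, fun l ↦ ?_⟩
    · rw [← K.reflection_eq_self_iff]
      have h1 : HasSum (fun l ↦ K.reflection (w l : H)) (K.reflection u) :=
        hsum.mapL (K.reflection.toContinuousLinearEquiv : H →L[ℂ] H)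
      -- The sum is reindexed by `l ↦ -l`. The weight is even, so `w` inherits the symmetry of `z`.
      have h2 : HasSum (fun l ↦ K.reflection (w l : H)) u := by
        rw [← (Equiv.neg ℝ).hasSum_iff] at hsum
        convert hsum using 2 with l
        simp only [Function.comp, Equiv.neg_apply, hwl, Submodule.coe_smul, map_smul, hz,
          sobolevWeight_neg]
        rfl
      exact h1.unique h2
    · rw [sobolevComponent_apply, hproj, hwl, smul_smul, mul_inv_cancel₀, one_smul]
      exact_mod_cast (sobolevWeight_pos s l).ne'

lemma isClosed_sobolevSub (hT : IsSymmetricGraph T) (hK : IsOddGraph T K) {s : ℝ} (hs : 0 ≤ s) :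
    IsClosed (sobolevSub T s K : Set (Sobolev T s)) := by
  have : (sobolevSub T s K : Set (Sobolev T s)) =
      ⋂ l, {z : Sobolev T s | K.reflection (z.1 l : H) = (z.1 (-l) : H)} := by
    ext z
    rw [Set.mem_iInter]
    exact mem_sobolevSub_iff hT hK hs z
  rw [this]
  exact isClosed_iInter fun l ↦ isClosed_eq
    (K.reflection.continuous.comp (continuous_sobolev_apply s l)) (continuous_sobolev_apply s (-l))

/-- Given `z`, some element of the second space has the same components as `z` for `l < 0`; the
difference then lies in the first space. -/
lemma sobolevInterval_sup_sobolevSub (hT : IsSymmetricGraph T) (hK : IsOddGraph T K) {s : ℝ}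
    (hs : 0 ≤ s) : sobolevInterval T s (Set.Ici 0) ⊔ sobolevSub T s K = ⊤ := by
  rw [eq_top_iff]
  intro z _
  -- The negative components are those of `z`, and the positive ones are forced by the symmetry. The
  -- component at `0` may be any fixed vector of the reflection; `0` is one.
  let w : ∀ l : ℝ, eigenspace T l := fun l ↦
    if l < 0 then z.1 l else if 0 < l then
      ⟨K.reflection (z.1 (-l) : H), by simpa using hK.reflection_mem (z.1 (-l)).2⟩ else 0
  have hw : Memℓp w 2 := by
    have h2 : 0 < (2 : ℝ≥0∞).toReal := by norm_num
    have hz2 := (memℓp_gen_iff h2).1 (lp.memℓp (z.1 : SpectralSum T))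
    have hz3 : Summable fun l : ℝ ↦ ‖z.1 (-l)‖ ^ (2 : ℝ≥0∞).toReal :=
      (Equiv.neg ℝ).summable_iff.2 hz2
    refine memℓp_gen ((hz2.add hz3).of_nonneg_of_le (fun l ↦ by positivity) fun l ↦ ?_)
    have ha : 0 ≤ ‖z.1 l‖ ^ (2 : ℝ≥0∞).toReal := by positivity
    have hb : 0 ≤ ‖z.1 (-l)‖ ^ (2 : ℝ≥0∞).toReal := by positivity
    rcases lt_trichotomy l 0 with h | h | h
    · simp [w, h]
    · subst h
      simp only [w, lt_irrefl, if_false, norm_zero]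
      rw [Real.zero_rpow h2.ne']
      exact add_nonneg ha hb
    · simp [w, h, not_lt.2 h.le]
  have hB : hT.toSobolev s ⟨w, hw⟩ ∈ sobolevSub T s K := by
    rw [mem_sobolevSub_iff hT hK hs]
    intro l
    change K.reflection (w l : H) = (w (-l) : H)
    rcases lt_trichotomy l 0 with h | h | h
    -- The components at `l` and at `- -l` have different types, so they are compared in `H`.
    · have hcast : ∀ m, m = l → ((z.1 l : eigenspace T l) : H) = (z.1 m : H) := by
        rintro m rfl
        rfl
      simpa [w, h, not_lt.2 h.le] using hcast _ (neg_neg l)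
    · subst h
      simp [w]
    · simp [w, h, not_lt.2 h.le]
  have hX : z - hT.toSobolev s ⟨w, hw⟩ ∈ sobolevInterval T s (Set.Ici 0) := by
    intro l hl
    change z.1 l - w l = 0
    have h : l < 0 := by simpa using hl
    simp [w, h]
  rw [← sub_add_cancel z (hT.toSobolev s ⟨w, hw⟩)]
  exact Submodule.add_mem_sup hX hB

-- The isomorphism is `z ↦ z_0`. Negative components vanish in the first space, and the symmetry
-- then kills the positive ones. Conversely, a vector of the kernel fixed by the reflection is a
-- family concentrated at `0`.
open Classical in
lemma exists_equiv_inf (hT : IsSymmetricGraph T) (hK : IsOddGraph T K) {s : ℝ} (hs : 0 ≤ s) :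
    Nonempty (↥(sobolevInterval T s (Set.Ici 0) ⊓ sobolevSub T s K) ≃ₗ[ℂ] kerOn T K) := by
  have hker : ∀ z ∈ sobolevSub T s K, ((z.1 0 : eigenspace T 0) : H) ∈ kerOn T K := by
    intro z hz
    refine ⟨(z.1 0).2, ?_⟩
    have h := (mem_sobolevSub_iff hT hK hs z).1 hz 0
    rw [SetLike.mem_coe, ← K.reflection_eq_self_iff, h, neg_zero]
  let f : ↥(sobolevInterval T s (Set.Ici 0) ⊓ sobolevSub T s K) →ₗ[ℂ] kerOn T K :=
    { toFun z := ⟨_, hker z.1 z.2.2⟩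
      map_add' _ _ := rfl
      map_smul' _ _ := rfl }
  refine ⟨LinearEquiv.ofBijective f ⟨?_, ?_⟩⟩
  · rw [injective_iff_map_eq_zero]
    rintro ⟨z, hzX, hzB⟩ hz
    have h0 : ((z.1 0 : eigenspace T 0) : H) = 0 := congrArg Subtype.val hz
    have hl : ∀ l, ((z.1 l : eigenspace T l) : H) = 0 := by
      intro l
      rcases lt_trichotomy l 0 with h | h | h
      · rw [hzX l (by simpa using h), Submodule.coe_zero]
      · subst h
        exact h0
      · have h1 := (mem_sobolevSub_iff hT hK hs z).1 hzB (-l)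
        rw [hzX (-l) (by simpa using h), Submodule.coe_zero, map_zero, neg_neg] at h1
        exact h1.symm
    refine Subtype.ext (Subtype.ext (Subtype.ext (funext fun l ↦ Subtype.ext ?_)))
    exact hl l
  · rintro ⟨v, hv0, hvK⟩
    let z : Sobolev T s := hT.toSobolev s (lp.single 2 0 ⟨v, hv0⟩)
    have hz0 : ((z.1 0 : eigenspace T 0) : H) = v := by
      change (((lp.single 2 (0 : ℝ) (⟨v, hv0⟩ : eigenspace T 0) : SpectralSum T) 0 :
        eigenspace T 0) : H) = v
      rw [lp.single_apply_self]
    have hzl : ∀ l, l ≠ 0 → z.1 l = 0 := fun l hl ↦ by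
      change (lp.single 2 (0 : ℝ) (⟨v, hv0⟩ : eigenspace T 0) : SpectralSum T) l = 0
      rw [lp.single_apply_ne _ _ _ hl]
    refine ⟨⟨z, fun l hl ↦ hzl l fun h ↦ hl (by simp [h]), ?_⟩, Subtype.ext hz0⟩
    refine (mem_sobolevSub_iff hT hK hs z).2 fun l ↦ ?_
    by_cases h : l = 0
    · subst h
      rw [neg_zero, hz0, K.reflection_eq_self_iff]
      exact hvK
    · rw [hzl l h, hzl (-l) (neg_ne_zero.2 h)]
      simp

theorem isFredholmPair_of_symmetric_of_odd (hT : IsSymmetricGraph T) (hK : IsOddGraph T K)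
    [FiniteDimensional ℂ (kerOn T K)] {s : ℝ} (hs : 0 ≤ s) :
    IsFredholmPair (sobolevInterval T s (Set.Ici 0)) (sobolevSub T s K) ∧
      fredholmPairIndex (sobolevInterval T s (Set.Ici 0)) (sobolevSub T s K) =
        Module.finrank ℂ (kerOn T K) := by
  obtain ⟨e⟩ := exists_equiv_inf hT hK hs
  have htop := sobolevInterval_sup_sobolevSub hT hK hs
  have hsub : Subsingleton (Sobolev T s ⧸ (sobolevInterval T s (Set.Ici 0) ⊔ sobolevSub T s K)) :=
    Submodule.Quotient.subsingleton_iff.2 htop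
  refine ⟨⟨isClosed_sobolevInterval s _, isClosed_sobolevSub hT hK hs, e.symm.finiteDimensional,
    ?_, inferInstance⟩, ?_⟩
  · rw [htop]
    exact isClosed_univ
  · rw [fredholmPairIndex, e.finrank_eq, Module.finrank_zero_of_subsingleton
      (M := Sobolev T s ⧸ (sobolevInterval T s (Set.Ici 0) ⊔ sobolevSub T s K))]
    simp

end AbstractFredholm

/-! ### Extension of germs of smooth sections. -/

section GlobalExtension

variable {n : ℕ} {N : Type*} [EMetricSpace N] [ChartedSpace (EuclideanSpace ℝ (Fin n)) N]
  [IsManifold (𝓡 n) ∞ N]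
  {F : Type*} [NormedAddCommGroup F] [NormedSpace ℝ F]
  {E : N → Type*} [TopologicalSpace (TotalSpace F E)] [∀ y, AddCommGroup (E y)]
  [∀ y, Module ℝ (E y)] [∀ y, TopologicalSpace (E y)] [FiberBundle F E] [VectorBundle ℝ F E]

/-- A smooth section defined near a point extends to a global one with the same germ. -/
lemma exists_contMDiff_section_eventuallyEq {x₀ : N} {W : Set N} (hW : W ∈ nhds x₀) (u : Π y, E y)
    (hu : ContMDiffOn (𝓡 n) ((𝓡 n).prod 𝓘(ℝ, F)) ∞ (fun y ↦ TotalSpace.mk' F y (u y)) W) :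
    ∃ v : Π y, E y, ContMDiff (𝓡 n) ((𝓡 n).prod 𝓘(ℝ, F)) ∞ (fun y ↦ TotalSpace.mk' F y (v y)) ∧
      ∀ᶠ y in nhds x₀, v y = u y := by
  obtain ⟨W', hW'W, hW'o, hxW'⟩ := mem_nhds_iff.1 hW
  obtain ⟨χ, hχ⟩ := ((SmoothBumpFunction.nhds_basis_tsupport (I := 𝓡 n) x₀).mem_iff).1
    (hW'o.mem_nhds hxW')
  refine ⟨(χ : N → ℝ) • u, ContMDiffOn.smul_section_of_tsupport
    χ.contMDiff.contMDiffOn hW'o hχ.2 (hu.mono hW'W), ?_⟩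
  filter_upwards [χ.eventuallyEq_one] with y hy
  simp [hy]

end GlobalExtension

/-! ### Smooth dependence of determinants and inverse matrices. -/

section MatrixFunction

variable {n : ℕ} {N : Type*} [EMetricSpace N] [ChartedSpace (EuclideanSpace ℝ (Fin n)) N]

lemma contMDiffOn_det {M : N → Matrix (Fin n) (Fin n) ℝ} {W : Set N}
    (hM : ∀ i j, ContMDiffOn (𝓡 n) 𝓘(ℝ, ℝ) ∞ (fun y ↦ M y i j) W) :
    ContMDiffOn (𝓡 n) 𝓘(ℝ, ℝ) ∞ (fun y ↦ (M y).det) W := by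
  simp only [Matrix.det_apply']
  refine contMDiffOn_finsetSum fun σ _ ↦ ?_
  exact contMDiffOn_const.mul (contMDiffOn_finsetProd fun i _ ↦ hM (σ i) i)

/-- Cramer's rule: an entry of the adjugate is the determinant of the matrix with one row replaced
by a constant row. -/
lemma contMDiffOn_inv {M : N → Matrix (Fin n) (Fin n) ℝ} {W : Set N}
    (hM : ∀ i j, ContMDiffOn (𝓡 n) 𝓘(ℝ, ℝ) ∞ (fun y ↦ M y i j) W) (h0 : ∀ y ∈ W, (M y).det ≠ 0)
    (i j : Fin n) : ContMDiffOn (𝓡 n) 𝓘(ℝ, ℝ) ∞ (fun y ↦ (M y)⁻¹ i j) W := by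
  have h1 : ContMDiffOn (𝓡 n) 𝓘(ℝ, ℝ) ∞ (fun y ↦ (M y).adjugate i j) W := by
    simp only [Matrix.adjugate_apply]
    refine contMDiffOn_det fun k l ↦ ?_
    by_cases h : k = j
    · simp only [h, Matrix.updateRow_self]
      exact contMDiffOn_const
    · simp only [Matrix.updateRow_ne h]
      exact hM k l
  have h2 := ((contMDiffOn_det hM).inv₀ h0).mul h1
  refine h2.congr fun y hy ↦ ?_
  simp [Matrix.inv_def, Ring.inverse_eq_inv']

end MatrixFunction

/-! ### Coordinate frames, their Gram matrix and their dual frames. -/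

section CoordinateFrame



variable {n : ℕ} {N : Type*} [EMetricSpace N] [ChartedSpace (EuclideanSpace ℝ (Fin n)) N]
  [IsManifold (𝓡 n) ∞ N]

/-- The `i`-th coordinate vector field of the chart at `x₀`. -/
def coordField (x₀ : N) (i : Fin n) (y : N) : TangentSpace (𝓡 n) y :=
  (trivializationAt (EuclideanSpace ℝ (Fin n)) (TangentSpace (𝓡 n)) x₀).symm y
    (EuclideanSpace.single i 1)

lemma contMDiffOn_coordField (x₀ : N) (i : Fin n) :
    ContMDiffOn (𝓡 n) (𝓡 n).tangent ∞
      (fun y ↦ (⟨y, coordField x₀ i y⟩ : TangentBundle (𝓡 n) N))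
      (chartAt (EuclideanSpace ℝ (Fin n)) x₀).source := by
  have h := (trivializationAt (EuclideanSpace ℝ (Fin n))
    (TangentSpace (𝓡 n) : N → Type _) x₀).contMDiffOn_section_baseSet_iff (IB := 𝓡 n) (n := ∞)
      (s := coordField x₀ i)
  refine h.2 ((contMDiffOn_const (c := EuclideanSpace.single i (1 : ℝ))).congr ?_)
  intro y hy
  exact congrArg Prod.snd (Bundle.Trivialization.apply_mk_symm _ hy _)

/-- The coordinate frame at a point. -/
def coordBasis (x₀ : N) {y : N} (hy : y ∈ (chartAt (EuclideanSpace ℝ (Fin n)) x₀).source) :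
    Module.Basis (Fin n) ℝ (TangentSpace (𝓡 n) y) :=
  (EuclideanSpace.basisFun (Fin n) ℝ).toBasis.map
    ((trivializationAt (EuclideanSpace ℝ (Fin n))
      (TangentSpace (𝓡 n) : N → Type _) x₀).linearEquivAt ℝ y hy).symm

lemma coordBasis_apply (x₀ : N) {y : N}
    (hy : y ∈ (chartAt (EuclideanSpace ℝ (Fin n)) x₀).source) (i : Fin n) :
    coordBasis x₀ hy i = coordField x₀ i y := by
  simp only [coordBasis, Module.Basis.map_apply, OrthonormalBasis.coe_toBasis,
    EuclideanSpace.basisFun_apply]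
  rfl

/-- The frame from the trivialization of the tangent bundle, convenient for smoothness, is also the
one in terms of which the Riemannian volume is expressed. -/
lemma coordField_symm (x₀ : N) (i : Fin n) {z : EuclideanSpace ℝ (Fin n)}
    (hz : z ∈ (extChartAt (𝓡 n) x₀).target) :
    coordField x₀ i ((extChartAt (𝓡 n) x₀).symm z) = coordVector x₀ z i := by
  have hx : (extChartAt (𝓡 n) x₀).symm z ∈ (chartAt (EuclideanSpace ℝ (Fin n)) x₀).source := by
    simpa using (extChartAt (𝓡 n) x₀).map_target hz
  have h := TangentBundle.symmL_trivializationAt (I := 𝓡 n) hx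
  rw [(extChartAt (𝓡 n) x₀).right_inv hz] at h
  have h2 := DFunLike.congr_fun h (EuclideanSpace.single i (1 : ℝ))
  rw [Bundle.Trivialization.symmL_apply _ hx] at h2
  refine h2.trans ?_
  rw [coordVector, modelWithCornersSelf_coe, Set.range_id, mfderivWithin_univ]
  rfl


variable [RiemannianBundle (fun y : N ↦ TangentSpace (𝓡 n) y)]
  [IsContMDiffRiemannianBundle (𝓡 n) ∞ (EuclideanSpace ℝ (Fin n))
    (fun y : N ↦ TangentSpace (𝓡 n) y)]

variable (n) in
/-- The matrix of the metric in the coordinate frame of the chart at `x₀`. -/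
def coordGram (x₀ y : N) : Matrix (Fin n) (Fin n) ℝ :=
  Matrix.gram ℝ fun i ↦ coordField x₀ i y

lemma contMDiffOn_coordGram (x₀ : N) (i j : Fin n) :
    ContMDiffOn (𝓡 n) 𝓘(ℝ, ℝ) ∞ (fun y ↦ coordGram n x₀ y i j)
      (chartAt (EuclideanSpace ℝ (Fin n)) x₀).source :=
  ContMDiffOn.inner_bundle (F := EuclideanSpace ℝ (Fin n)) (contMDiffOn_coordField x₀ i)
    (contMDiffOn_coordField x₀ j)

lemma posDef_coordGram (x₀ : N) {y : N}
    (hy : y ∈ (chartAt (EuclideanSpace ℝ (Fin n)) x₀).source) : (coordGram n x₀ y).PosDef := by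
  refine Matrix.posDef_gram_of_linearIndependent ?_
  have h := (coordBasis x₀ hy).linearIndependent
  rw [funext (coordBasis_apply x₀ hy)] at h
  exact h

variable (n) in
/-- Smooth vector fields on `N` which on the open set `dom` are the coordinate frame of the chart
at `x₀` and its dual frame. -/
structure CoordPatch (x₀ : N) where
  dom : Set N
  isOpen_dom : IsOpen dom
  mem_dom : x₀ ∈ dom
  subset_source : dom ⊆ (chartAt (EuclideanSpace ℝ (Fin n)) x₀).source
  frame : Fin n → Π y : N, TangentSpace (𝓡 n) y
  coframe : Fin n → Π y : N, TangentSpace (𝓡 n) y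
  smooth_frame : ∀ i, IsSmoothField n (frame i)
  smooth_coframe : ∀ i, IsSmoothField n (coframe i)
  frame_eq : ∀ y ∈ dom, ∀ i, frame i y = coordField x₀ i y
  dual : ∀ y ∈ dom, ∀ i j, ⟪frame i y, coframe j y⟫_ℝ = if i = j then 1 else 0

/-- The dual frame is `∑ₖ (G⁻¹)ᵢₖ ∂ₖ` with `G` the Gram matrix. Both frames are made global because
smoothness in a `CollarDiracBundle` is stated for global fields and sections only. -/
lemma nonempty_coordPatch (x₀ : N) : Nonempty (CoordPatch n x₀) := by
  have hsrc := (chartAt (EuclideanSpace ℝ (Fin n)) x₀).open_source.mem_nhds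
    (mem_chart_source (EuclideanSpace ℝ (Fin n)) x₀)
  have h1 := fun i ↦ exists_contMDiff_section_eventuallyEq (F := EuclideanSpace ℝ (Fin n))
    hsrc (coordField x₀ i) (contMDiffOn_coordField x₀ i)
  choose X hX hXe using h1
  let G := fun y ↦ coordGram n x₀ y
  have h2 := fun i ↦ exists_contMDiff_section_eventuallyEq (F := EuclideanSpace ℝ (Fin n))
    (E := fun y : N ↦ TangentSpace (𝓡 n) y)
    hsrc (fun y ↦ ∑ k, (G y)⁻¹ i k • coordField x₀ k y) (by
      refine ContMDiffOn.sum_section fun k _ ↦ ContMDiffOn.smul_section ?_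
        (contMDiffOn_coordField x₀ k)
      exact contMDiffOn_inv (contMDiffOn_coordGram x₀)
        (fun y hy ↦ (posDef_coordGram x₀ hy).det_pos.ne') i k)
  choose Y hY hYe using h2
  have hev : ∀ᶠ y in nhds x₀, y ∈ (chartAt (EuclideanSpace ℝ (Fin n)) x₀).source ∧
      (∀ i, X i y = coordField x₀ i y) ∧ (∀ i, Y i y = ∑ k, (G y)⁻¹ i k • coordField x₀ k y) :=
    (Filter.Eventually.and hsrc ((Filter.eventually_all.2 hXe).and (Filter.eventually_all.2 hYe)))
  obtain ⟨W, hW, hWo, hxW⟩ := eventually_nhds_iff.1 hev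
  refine ⟨⟨W, hWo, hxW, fun y hy ↦ (hW y hy).1, X, Y, hX, hY, fun y hy ↦ (hW y hy).2.1, ?_⟩⟩
  intro y hy i j
  obtain ⟨hs, hXy, hYy⟩ := hW y hy
  rw [hXy, hYy, inner_sum]
  simp only [inner_smul_right]
  have hdet : IsUnit (G y).det := (posDef_coordGram x₀ hs).det_pos.ne'.isUnit
  have hmul := congrFun (congrFun (Matrix.nonsing_inv_mul (G y) hdet) j) i
  rw [Matrix.mul_apply, Matrix.one_apply] at hmul
  rw [show (if i = j then (1 : ℝ) else 0) = if j = i then 1 else 0 by simp [eq_comm], ← hmul]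
  refine Finset.sum_congr rfl fun k _ ↦ ?_
  rw [real_inner_comm]
  rfl

namespace CoordPatch

variable {x₀ : N} (P : CoordPatch n x₀) {y : N}

lemma sum_inner_smul_coframe (hy : y ∈ P.dom) (w : TangentSpace (𝓡 n) y) :
    ∑ j, ⟪P.frame j y, w⟫_ℝ • P.coframe j y = w := by
  refine InnerProductSpace.ext_inner_left_basis (𝕜 := ℝ) (coordBasis x₀ (P.subset_source hy))
    fun i ↦ ?_
  rw [coordBasis_apply, ← P.frame_eq y hy, inner_sum]
  simp [inner_smul_right, P.dual y hy]

lemma sum_inner_smul_frame (hy : y ∈ P.dom) (w : TangentSpace (𝓡 n) y) :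
    ∑ j, ⟪P.coframe j y, w⟫_ℝ • P.frame j y = w := by
  refine ext_inner_left ℝ fun v ↦ ?_
  rw [← P.sum_inner_smul_coframe hy v, sum_inner, sum_inner]
  refine Finset.sum_congr rfl fun i _ ↦ ?_
  rw [inner_sum]
  simp only [inner_smul_left, inner_smul_right, real_inner_comm (P.frame _ y) (P.coframe _ y),
    P.dual y hy]
  simp [mul_comm]

/-- The metric trace of a bilinear map is the same for every pair of dual frames. The orthonormal
basis in `tangentialDirac` is chosen point by point without any regularity; this exchanges it for
smooth frames. -/
lemma sum_orthonormalBasis {W : Type*} [AddCommGroup W] [Module ℝ W] (hy : y ∈ P.dom)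
    {ι : Type*} [Fintype ι] (e : OrthonormalBasis ι ℝ (TangentSpace (𝓡 n) y))
    (B : TangentSpace (𝓡 n) y →ₗ[ℝ] TangentSpace (𝓡 n) y →ₗ[ℝ] W) :
    ∑ i, B (e i) (e i) = ∑ j, B (P.coframe j y) (P.frame j y) := by
  have h1 : ∀ i, B (e i) (e i) = ∑ j, B (P.coframe j y) (⟪e i, P.frame j y⟫_ℝ • e i) := by
    intro i
    conv_lhs => enter [1]; rw [← P.sum_inner_smul_coframe hy (e i)]
    simp only [map_sum, map_smul, LinearMap.sum_apply, LinearMap.smul_apply, real_inner_comm]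
  simp only [h1]
  rw [Finset.sum_comm]
  refine Finset.sum_congr rfl fun j _ ↦ ?_
  rw [← map_sum, e.sum_repr' (P.frame j y)]

end CoordPatch

end CoordinateFrame

/-! ### Leibniz rules and smoothness for the tangential Dirac operator. -/

section DiracOperator

variable {n : ℕ} {N : Type*} [EMetricSpace N] [ChartedSpace (EuclideanSpace ℝ (Fin n)) N]
  [IsManifold (𝓡 n) ∞ N]
  [RiemannianBundle (fun y : N ↦ TangentSpace (𝓡 n) y)]
  [IsContMDiffRiemannianBundle (𝓡 n) ∞ (EuclideanSpace ℝ (Fin n))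
    (fun y : N ↦ TangentSpace (𝓡 n) y)]
  {F : Type*} [NormedAddCommGroup F] [NormedSpace ℂ F] [FiniteDimensional ℂ F]
  {E : N → Type*} [TopologicalSpace (TotalSpace F E)] [∀ y, NormedAddCommGroup (E y)]
  [∀ y, InnerProductSpace ℂ (E y)] [FiberBundle F E] [VectorBundle ℂ F E] [VectorBundle ℝ F E]
  [ContMDiffVectorBundle ∞ F E (𝓡 n)] [IsHermitianBundle n F E]

lemma mvfderiv_congr {W : Type*} [NormedAddCommGroup W] [NormedSpace ℝ W] {f g : N → W} {y : N}
    (h : f =ᶠ[nhds y] g) (w : TangentSpace (𝓡 n) y) :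
    mvfderiv (𝓡 n) f y w = mvfderiv (𝓡 n) g y w := by
  -- The two derivatives take values in tangent spaces at `f y` and `g y`, which are different
  -- types; a common value `v` in `W` mediates.
  have h1 : ∀ v, (mfderiv (𝓡 n) 𝓘(ℝ, W) f y w : W) = v →
      (mfderiv (𝓡 n) 𝓘(ℝ, W) g y w : W) = v := by
    intro v hv
    rw [← hv, h.mfderiv_eq]
    rfl
  exact (h1 _ rfl).symm

lemma mvfderiv_comp_of_hasFDerivAt {W W' : Type*} [NormedAddCommGroup W] [NormedSpace ℝ W]
    [NormedAddCommGroup W'] [NormedSpace ℝ W'] {φ : W → W'} {L : W →L[ℝ] W'} {f : N → W} {y : N}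
    (hφ : HasFDerivAt φ L (f y)) (hf : MDifferentiableAt (𝓡 n) 𝓘(ℝ, W) f y)
    (w : TangentSpace (𝓡 n) y) :
    mvfderiv (𝓡 n) (fun x ↦ φ (f x)) y w = L (mvfderiv (𝓡 n) f y w) := by
  have h := hφ.hasMFDerivAt.comp y hf.hasMFDerivAt
  have h2 : mfderiv (𝓡 n) 𝓘(ℝ, W') (fun x ↦ φ (f x)) y = _ := h.mfderiv
  rw [mvfderiv, h2]
  rfl

lemma mvfderiv_clm_comp {W W' : Type*} [NormedAddCommGroup W] [NormedSpace ℝ W]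
    [NormedAddCommGroup W'] [NormedSpace ℝ W'] (L : W →L[ℝ] W') {f : N → W} {y : N}
    (hf : MDifferentiableAt (𝓡 n) 𝓘(ℝ, W) f y) (w : TangentSpace (𝓡 n) y) :
    mvfderiv (𝓡 n) (fun x ↦ L (f x)) y w = L (mvfderiv (𝓡 n) f y w) :=
  mvfderiv_comp_of_hasFDerivAt L.hasFDerivAt hf w

lemma IsSmoothSection.mdifferentiableAt {u : Π y, E y} (hu : IsSmoothSection n F u) (y : N) :
    MDifferentiableAt (𝓡 n) ((𝓡 n).prod 𝓘(ℝ, F)) (fun y ↦ TotalSpace.mk' F y (u y)) y :=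
  (hu y).mdifferentiableAt (by simp)

lemma IsSmoothSection.real_smul {f : N → ℝ} {u : Π y, E y} (hf : ContMDiff (𝓡 n) 𝓘(ℝ, ℝ) ∞ f)
    (hu : IsSmoothSection n F u) : IsSmoothSection n F (f • u) :=
  ContMDiff.smul_section hf hu

/-- The Leibniz rule of the connection concerns real functions. Complex ones are reduced to it by
this splitting, together with complex linearity over constants. -/
lemma fun_smul_eq_add (f : N → ℂ) (u : Π y, E y) :
    (fun y ↦ f y • u y) = (fun y ↦ (f y).re) • u + Complex.I • ((fun y ↦ (f y).im) • u) := by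
  funext y
  change f y • u y = (f y).re • u y + Complex.I • ((f y).im • u y)
  conv_lhs => rw [← Complex.re_add_im (f y), add_smul, mul_comm, mul_smul]
  rfl

lemma IsSmoothSection.complex_smul {f : N → ℂ} {u : Π y, E y}
    (hf : ContMDiff (𝓡 n) 𝓘(ℝ, ℂ) ∞ f) (hu : IsSmoothSection n F u) :
    IsSmoothSection n F (fun y ↦ f y • u y) := by
  rw [fun_smul_eq_add]
  have hre : ContMDiff (𝓡 n) 𝓘(ℝ, ℝ) ∞ (fun y ↦ (f y).re) :=
    Complex.reCLM.contDiff.contMDiff.comp hf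
  have him : ContMDiff (𝓡 n) 𝓘(ℝ, ℝ) ∞ (fun y ↦ (f y).im) :=
    Complex.imCLM.contDiff.contMDiff.comp hf
  exact (hu.real_smul hre).add ((hu.real_smul him).smul _)

lemma IsSmoothSection.sum {ι : Type*} {s : Finset ι} {u : ι → Π y, E y}
    (hu : ∀ i ∈ s, IsSmoothSection n F (u i)) : IsSmoothSection n F (∑ i ∈ s, u i) := by
  have h := ContMDiff.sum_section (I := 𝓡 n) (F := F) (n := ∞) (V := E) (t := u) hu
  simpa only [IsSmoothSection, Finset.sum_apply] using h

namespace CollarDiracBundle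

variable (S : CollarDiracBundle n N F E) {u v : Π y, E y}

lemma isSmoothSection_conn (hu : IsSmoothSection n F u) {X : Π y : N, TangentSpace (𝓡 n) y}
    (hX : IsSmoothField n X) : IsSmoothSection n F (fun y ↦ S.conn u y (X y)) := by
  have h := S.conn_smooth.contMDiff.contMDiff (σ := u) (ContMDiff.contMDiffOn hu)
  exact fun y ↦ ContMDiffAt.clm_bundle_apply (F₁ := EuclideanSpace ℝ (Fin n)) (F₂ := F)
    (E₁ := fun y : N ↦ TangentSpace (𝓡 n) y) (b := id) (contMDiffOn_univ.1 h y) (hX y)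

lemma conn_add (hu : IsSmoothSection n F u) (hv : IsSmoothSection n F v) (y : N) :
    S.conn (u + v) y = S.conn u y + S.conn v y :=
  S.conn.isCovariantDerivativeOnUniv.add (hu.mdifferentiableAt y) (hv.mdifferentiableAt y)

lemma conn_real_smul {f : N → ℝ} (hf : ContMDiff (𝓡 n) 𝓘(ℝ, ℝ) ∞ f) (hu : IsSmoothSection n F u)
    (y : N) (w : TangentSpace (𝓡 n) y) :
    S.conn (f • u) y w = f y • S.conn u y w + mvfderiv (𝓡 n) f y w • u y := by
  rw [S.conn.isCovariantDerivativeOnUniv.leibniz (hu.mdifferentiableAt y)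
    ((hf y).mdifferentiableAt (by simp))]
  rfl

lemma conn_complex_smul {f : N → ℂ} (hf : ContMDiff (𝓡 n) 𝓘(ℝ, ℂ) ∞ f)
    (hu : IsSmoothSection n F u) (y : N) (w : TangentSpace (𝓡 n) y) :
    S.conn (fun x ↦ f x • u x) y w = f y • S.conn u y w + mvfderiv (𝓡 n) f y w • u y := by
  have hre : ContMDiff (𝓡 n) 𝓘(ℝ, ℝ) ∞ (fun y ↦ (f y).re) :=
    Complex.reCLM.contDiff.contMDiff.comp hf
  have him : ContMDiff (𝓡 n) 𝓘(ℝ, ℝ) ∞ (fun y ↦ (f y).im) :=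
    Complex.imCLM.contDiff.contMDiff.comp hf
  have hfd : MDifferentiableAt (𝓡 n) 𝓘(ℝ, ℂ) f y := (hf y).mdifferentiableAt (by simp)
  have h1 : mvfderiv (𝓡 n) (fun y ↦ (f y).re) y w = (mvfderiv (𝓡 n) f y w).re :=
    mvfderiv_clm_comp Complex.reCLM hfd w
  have h2 : mvfderiv (𝓡 n) (fun y ↦ (f y).im) y w = (mvfderiv (𝓡 n) f y w).im :=
    mvfderiv_clm_comp Complex.imCLM hfd w
  rw [fun_smul_eq_add, S.conn_add (hu.real_smul hre) ((hu.real_smul him).smul _),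
    _root_.add_apply, S.conn_smul _ _ (hu.real_smul him), S.conn_real_smul hre hu,
    S.conn_real_smul him hu, h1, h2]
  have key : ∀ (z : ℂ) (e : E y), z • e = z.re • e + Complex.I • (z.im • e) := by
    intro z e
    conv_lhs => rw [← Complex.re_add_im z, add_smul, mul_comm, mul_smul]
    rfl
  rw [key (f y), key (mvfderiv (𝓡 n) f y w)]
  simp only [smul_add]
  abel

/-- The bilinear map `(v, w) ↦ c(v) ∇_w u`. -/
def cliffordConn (u : Π y, E y) (y : N) :
    TangentSpace (𝓡 n) y →ₗ[ℝ] TangentSpace (𝓡 n) y →ₗ[ℝ] E y :=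
  LinearMap.mk₂ ℝ (fun v w ↦ S.c y v (S.conn u y w)) (by simp) (by simp) (by simp) (by simp)

lemma tangentialDirac_eq {x₀ : N} (P : CoordPatch n x₀) {y : N} (hy : y ∈ P.dom)
    (u : Π y, E y) : S.tangentialDirac u y =
      ∑ j, S.c y (P.coframe j y) (S.conn u y (P.frame j y)) :=
  P.sum_orthonormalBasis hy (stdOrthonormalBasis ℝ (TangentSpace (𝓡 n) y)) (S.cliffordConn u y)

lemma isSmoothSection_tangentialDirac (hu : IsSmoothSection n F u) :
    IsSmoothSection n F (S.tangentialDirac u) := by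
  intro x₀
  obtain ⟨P⟩ := nonempty_coordPatch (n := n) x₀
  have h : IsSmoothSection n F (∑ j, fun y ↦ S.c y (P.coframe j y) (S.conn u y (P.frame j y))) :=
    IsSmoothSection.sum fun j _ ↦
      S.c_smooth _ _ (P.smooth_coframe j) (S.isSmoothSection_conn hu (P.smooth_frame j))
  refine (h x₀).congr_of_eventuallyEq ?_
  filter_upwards [P.isOpen_dom.mem_nhds P.mem_dom] with y hy
  rw [S.tangentialDirac_eq P hy, Finset.sum_apply]

lemma tangentialDirac_add (hu : IsSmoothSection n F u) (hv : IsSmoothSection n F v) :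
    S.tangentialDirac (u + v) = S.tangentialDirac u + S.tangentialDirac v := by
  funext y
  simp only [tangentialDirac, S.conn_add hu hv, Pi.add_apply, _root_.add_apply,
    map_add, Finset.sum_add_distrib]

lemma tangentialDirac_smul (a : ℂ) (hu : IsSmoothSection n F u) :
    S.tangentialDirac (a • u) = a • S.tangentialDirac u := by
  funext y
  simp only [tangentialDirac, S.conn_smul a u hu, Pi.smul_apply, map_smul, Finset.smul_sum]

lemma tangentialDirac_complex_smul {x₀ : N} (P : CoordPatch n x₀) {y : N} (hy : y ∈ P.dom)
    {f : N → ℂ} (hf : ContMDiff (𝓡 n) 𝓘(ℝ, ℂ) ∞ f) (hu : IsSmoothSection n F u) :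
    S.tangentialDirac (fun x ↦ f x • u x) y = f y • S.tangentialDirac u y +
      ∑ j, mvfderiv (𝓡 n) f y (P.frame j y) • S.c y (P.coframe j y) (u y) := by
  rw [S.tangentialDirac_eq P hy, S.tangentialDirac_eq P hy, Finset.smul_sum,
    ← Finset.sum_add_distrib]
  refine Finset.sum_congr rfl fun j _ ↦ ?_
  rw [S.conn_complex_smul hf hu, map_add, map_smul, map_smul]

/-- `c(τ)` is parallel, hence passes through each `∇_{eᵢ}`, and it anticommutes with each `c(eᵢ)`.
-/
lemma tangentialDirac_cτ (hu : IsSmoothSection n F u) (y : N) :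
    S.tangentialDirac (fun x ↦ S.cτ x (u x)) y = -S.cτ y (S.tangentialDirac u y) := by
  simp only [tangentialDirac, map_sum, S.cτ_parallel u hu, S.cτ_c, Finset.sum_neg_distrib, neg_neg]

end CollarDiracBundle

end DiracOperator

/-! ### Coordinate fields commute. -/

section LieBracket

variable {n : ℕ} {N : Type*} [EMetricSpace N] [ChartedSpace (EuclideanSpace ℝ (Fin n)) N]
  [IsManifold (𝓡 n) ∞ N]

/-- The constant vector field `w` on `ℝⁿ`. -/
def constField (w : EuclideanSpace ℝ (Fin n)) (z : EuclideanSpace ℝ (Fin n)) :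
    TangentSpace (𝓡 n) z := w

lemma mpullback_constField (x₀ : N) (i : Fin n) {y : N}
    (hy : y ∈ (chartAt (EuclideanSpace ℝ (Fin n)) x₀).source) :
    VectorField.mpullback (𝓡 n) (𝓡 n) (extChartAt (𝓡 n) x₀)
      (constField (EuclideanSpace.single i (1 : ℝ))) y = coordField x₀ i y := by
  have hy' : y ∈ (extChartAt (𝓡 n) x₀).source := by simpa using hy
  have hinv : (mfderiv (𝓡 n) (𝓡 n) (extChartAt (𝓡 n) x₀) y).inverse =
      (trivializationAt (EuclideanSpace ℝ (Fin n))
        (TangentSpace (𝓡 n) : N → Type _) x₀).symmL ℝ y := by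
    rw [TangentBundle.symmL_trivializationAt (I := 𝓡 n) hy]
    exact ContinuousLinearMap.inverse_eq
      (mfderiv_extChartAt_comp_mfderivWithin_extChartAt_symm' hy')
      (mfderivWithin_extChartAt_symm_comp_mfderiv_extChartAt' hy')
  rw [VectorField.mpullback_apply, hinv]
  exact Bundle.Trivialization.symmL_apply (R := ℝ) (trivializationAt (EuclideanSpace ℝ (Fin n))
    (TangentSpace (𝓡 n) : N → Type _) x₀) hy (EuclideanSpace.single i (1 : ℝ))

/-- Near the point the coordinate fields are pullbacks of constant fields under the chart. Brackets
are natural under pullback, and constant fields commute. -/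
lemma mlieBracket_coordField (x₀ : N) (i j : Fin n) {y : N}
    (hy : y ∈ (chartAt (EuclideanSpace ℝ (Fin n)) x₀).source) :
    VectorField.mlieBracket (𝓡 n) (coordField x₀ i) (coordField x₀ j) y = 0 := by
  have hev : ∀ i : Fin n, coordField x₀ i =ᶠ[nhds y]
      VectorField.mpullback (𝓡 n) (𝓡 n) (extChartAt (𝓡 n) x₀)
        (constField (EuclideanSpace.single i (1 : ℝ))) := by
    intro i
    filter_upwards [(chartAt (EuclideanSpace ℝ (Fin n)) x₀).open_source.mem_nhds hy] with x hx
    exact (mpullback_constField x₀ i hx).symm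
  rw [(hev i).mlieBracket_vectorField_eq (hev j)]
  have hsm : ∀ (w z : EuclideanSpace ℝ (Fin n)),
      MDifferentiableAt (𝓡 n) (𝓡 n).tangent
        (fun x ↦ (⟨x, constField w x⟩ : TangentBundle (𝓡 n) (EuclideanSpace ℝ (Fin n)))) z := by
    intro w z
    have h : ContDiffAt ℝ 1 (fun _ : EuclideanSpace ℝ (Fin n) ↦ w) z := contDiffAt_const
    exact (contMDiffAt_vectorSpace_iff_contDiffAt (V := constField w).2 h).mdifferentiableAt
      one_ne_zero
  have h2 : minSmoothness ℝ 2 = 2 := minSmoothness_of_isRCLikeNormedField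
  have : IsManifold (𝓡 n) (minSmoothness ℝ 2) N := by
    rw [h2]
    exact IsManifold.of_le (n := ∞) ENat.LEInfty.out
  have : IsManifold (𝓡 n) (minSmoothness ℝ 2) (EuclideanSpace ℝ (Fin n)) := by
    rw [h2]
    infer_instance
  rw [← VectorField.mpullback_mlieBracket (n := 2) (hsm _ _) (hsm _ _)
    ((contMDiffAt_extChartAt' (n := ∞) hy).of_le ENat.LEInfty.out) h2.le]
  rw [VectorField.mpullback_apply, ← VectorField.mlieBracketWithin_univ,
    VectorField.mlieBracketWithin_eq_lieBracketWithin]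
  have h0 : ∀ w w' : EuclideanSpace ℝ (Fin n), VectorField.lieBracketWithin ℝ
      (fun _ : EuclideanSpace ℝ (Fin n) ↦ w) (fun _ ↦ w') Set.univ (extChartAt (𝓡 n) x₀ y) = 0 := by
    intro w w'
    simp [VectorField.lieBracketWithin]
  refine (congrArg _ (h0 (EuclideanSpace.single i 1) (EuclideanSpace.single j 1))).trans ?_
  exact map_zero _

end LieBracket

/-! ### The derivative of the determinant. -/

section JacobiFormula

lemma det_updateRow_eq_sum {ι : Type*} [Fintype ι] [DecidableEq ι] (M : Matrix ι ι ℝ) (i : ι)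
    (b : ι → ℝ) : (M.updateRow i b).det = ∑ j, M.adjugate j i * b j := by
  rw [← Matrix.cramer_transpose_apply, Matrix.cramer_eq_adjugate_mulVec, Matrix.mulVec,
    ← Matrix.adjugate_transpose]
  rfl

/-- Jacobi's formula for the derivative of a determinant. -/
lemma exists_hasFDerivAt_det {ι : Type*} [Fintype ι] [DecidableEq ι] (M : ι → ι → ℝ) :
    ∃ L : (ι → ι → ℝ) →L[ℝ] ℝ,
      (∀ A, L A = ((Matrix.of M).adjugate * Matrix.of A).trace) ∧
      HasFDerivAt (fun M : ι → ι → ℝ ↦ Matrix.det (Matrix.of M)) L M := by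
  let f : ContinuousMultilinearMap ℝ (fun _ : ι ↦ ι → ℝ) ℝ :=
    ⟨(Matrix.detRowAlternating (n := ι) (R := ℝ)).toMultilinearMap,
      Continuous.matrix_det (A := fun M : ι → ι → ℝ ↦ Matrix.of M) continuous_id⟩
  refine ⟨f.linearDeriv M, fun A ↦ ?_, f.hasFDerivAt M⟩
  rw [ContinuousMultilinearMap.linearDeriv_apply]
  have h : ∀ i, f (Function.update M i (A i)) = ∑ j, (Matrix.of M).adjugate j i * A i j :=
    fun i ↦ det_updateRow_eq_sum (Matrix.of M) i (A i)
  simp only [h, Matrix.trace, Matrix.diag, Matrix.mul_apply, Matrix.of_apply]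
  exact Finset.sum_comm

end JacobiFormula

/-! ### The Levi-Civita connection and the Riemannian density. -/

section Divergence

variable {n : ℕ} {N : Type*} [EMetricSpace N] [ChartedSpace (EuclideanSpace ℝ (Fin n)) N]
  [IsManifold (𝓡 n) ∞ N]
  [RiemannianBundle (fun y : N ↦ TangentSpace (𝓡 n) y)]
  [IsContMDiffRiemannianBundle (𝓡 n) ∞ (EuclideanSpace ℝ (Fin n))
    (fun y : N ↦ TangentSpace (𝓡 n) y)]
  {lc : CovariantDerivative (𝓡 n) (EuclideanSpace ℝ (Fin n)) (fun y : N ↦ TangentSpace (𝓡 n) y)}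
  {x₀ : N} (P : CoordPatch n x₀) {y : N}

lemma IsSmoothField.mdifferentiableAt {X : Π y : N, TangentSpace (𝓡 n) y} (hX : IsSmoothField n X)
    (y : N) : MDifferentiableAt (𝓡 n) (𝓡 n).tangent
      (fun y ↦ (⟨y, X y⟩ : TangentBundle (𝓡 n) N)) y :=
  (hX y).mdifferentiableAt (by simp)

namespace CoordPatch

/-- The trace of `v ↦ ∇_v X_k`, where `X_k` is the `k`-th coordinate field. -/
def christoffelTrace (lc : CovariantDerivative (𝓡 n) (EuclideanSpace ℝ (Fin n))
    (fun y : N ↦ TangentSpace (𝓡 n) y)) (k : Fin n) (y : N) : ℝ :=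
  ∑ j, ⟪lc (P.frame j) y (P.frame k y), P.coframe j y⟫_ℝ

lemma conn_frame_comm (hlc : lc.torsion = 0) (hy : y ∈ P.dom) (j k : Fin n) :
    lc (P.frame j) y (P.frame k y) = lc (P.frame k) y (P.frame j y) := by
  have h := lc.torsion_eq_zero_iff.1 hlc ((P.smooth_frame k).mdifferentiableAt y)
    ((P.smooth_frame j).mdifferentiableAt y)
  have hev : ∀ i, P.frame i =ᶠ[nhds y] coordField x₀ i := fun i ↦ by
    filter_upwards [P.isOpen_dom.mem_nhds hy] with x hx using P.frame_eq x hx i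
  rw [(hev k).mlieBracket_vectorField_eq (hev j),
    mlieBracket_coordField x₀ k j (P.subset_source hy)] at h
  exact sub_eq_zero.1 h

/-- Write `Xⱼ` and `Xʲ` for the two frames. Differentiating the constant `⟨Xₖ, Xʲ⟩` along `Xⱼ` gives
`⟨Xₖ, ∇ⱼXʲ⟩ = -⟨∇ⱼXₖ, Xʲ⟩`, and vanishing torsion lets `∇ⱼXₖ` be replaced by `∇ₖXⱼ`. -/
lemma sum_conn_coframe (hmet : lc.IsMetricCompatible) (hlc : lc.torsion = 0) (hy : y ∈ P.dom) :
    ∑ j, lc (P.coframe j) y (P.frame j y) =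
      -∑ k, P.christoffelTrace lc k y • P.coframe k y := by
  have h : ∀ k, ⟪P.frame k y, ∑ j, lc (P.coframe j) y (P.frame j y)⟫_ℝ =
      -P.christoffelTrace lc k y := by
    intro k
    rw [inner_sum, christoffelTrace, ← Finset.sum_neg_distrib]
    refine Finset.sum_congr rfl fun j _ ↦ ?_
    have h1 := hmet.mvfderiv_inner_eq (P.frame j) ((P.smooth_frame k).mdifferentiableAt y)
      ((P.smooth_coframe j).mdifferentiableAt y)
    have h2 : (fun x ↦ ⟪P.frame k x, P.coframe j x⟫_ℝ) =ᶠ[nhds y]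
        fun _ ↦ if k = j then (1 : ℝ) else 0 := by
      filter_upwards [P.isOpen_dom.mem_nhds hy] with x hx using P.dual x hx k j
    have h3 : mvfderiv (𝓡 n) (fun x ↦ ⟪P.frame k x, P.coframe j x⟫_ℝ) y (P.frame j y) = 0 := by
      rw [mvfderiv_congr h2, mvfderiv_const]
      rfl
    rw [h3] at h1
    beta_reduce at h1
    rw [P.conn_frame_comm hlc hy k j] at h1
    linarith
  rw [← P.sum_inner_smul_coframe hy (∑ j, lc (P.coframe j) y (P.frame j y)),
    ← Finset.sum_neg_distrib]
  simp only [h, neg_smul]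

/-- The Riemannian density `√det (g_ij)` as a function on the manifold. -/
def density (_P : CoordPatch n x₀) (y : N) : ℝ := √(coordGram n x₀ y).det

lemma density_pos (hy : y ∈ P.dom) : 0 < P.density y :=
  Real.sqrt_pos.2 (posDef_coordGram x₀ (P.subset_source hy)).det_pos

lemma contMDiffOn_density :
    ContMDiffOn (𝓡 n) 𝓘(ℝ, ℝ) ∞ P.density (chartAt (EuclideanSpace ℝ (Fin n)) x₀).source := by
  intro y hy
  have h1 := contMDiffOn_det (fun i j ↦ contMDiffOn_coordGram (n := n) x₀ i j) y hy
  have h2 := (Real.contDiffAt_sqrt (n := ∞) (posDef_coordGram x₀ hy).det_pos.ne').contMDiffAt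
  exact h2.comp_contMDiffWithinAt y h1

lemma mvfderiv_coordGram (hmet : lc.IsMetricCompatible) (hy : y ∈ P.dom) (i j k : Fin n) :
    mvfderiv (𝓡 n) (fun x ↦ coordGram n x₀ x i j) y (P.frame k y) =
      ⟪lc (P.frame i) y (P.frame k y), P.frame j y⟫_ℝ +
        ⟪P.frame i y, lc (P.frame j) y (P.frame k y)⟫_ℝ := by
  have h1 := hmet.mvfderiv_inner_eq (P.frame k) ((P.smooth_frame i).mdifferentiableAt y)
      ((P.smooth_frame j).mdifferentiableAt y)
  have h2 : (fun x ↦ coordGram n x₀ x i j) =ᶠ[nhds y] fun x ↦ ⟪P.frame i x, P.frame j x⟫_ℝ := by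
    filter_upwards [P.isOpen_dom.mem_nhds hy] with x hx
    rw [P.frame_eq x hx, P.frame_eq x hx]
    rfl
  rw [mvfderiv_congr h2, h1]

/-- Metric compatibility says that the derivative of `G` along `Xₖ` is `aG + Gaᵀ`, with `a` the
matrix of `∇ₖ` in the frame. Jacobi's formula turns this into `2 det G · tr a`. -/
lemma mvfderiv_det_coordGram (hmet : lc.IsMetricCompatible) (hy : y ∈ P.dom) (k : Fin n) :
    mvfderiv (𝓡 n) (fun x ↦ (coordGram n x₀ x).det) y (P.frame k y) =
      2 * (coordGram n x₀ y).det * P.christoffelTrace lc k y := by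
  have hsrc := P.subset_source hy
  have hnhds := (chartAt (EuclideanSpace ℝ (Fin n)) x₀).open_source.mem_nhds hsrc
  let g : N → Fin n → Fin n → ℝ := fun x i j ↦ coordGram n x₀ x i j
  have hg : MDifferentiableAt (𝓡 n) 𝓘(ℝ, Fin n → Fin n → ℝ) g y := by
    have : ContMDiffAt (𝓡 n) 𝓘(ℝ, Fin n → Fin n → ℝ) ∞ g y :=
      contMDiffAt_pi_space.2 fun i ↦ contMDiffAt_pi_space.2 fun j ↦
        (contMDiffOn_coordGram x₀ i j).contMDiffAt hnhds
    exact this.mdifferentiableAt (by simp)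
  obtain ⟨L, hL, hdet⟩ := exists_hasFDerivAt_det (g y)
  have h1 : mvfderiv (𝓡 n) (fun x ↦ (coordGram n x₀ x).det) y (P.frame k y) =
      L (mvfderiv (𝓡 n) g y (P.frame k y)) := mvfderiv_comp_of_hasFDerivAt hdet hg _
  have h2 : ∀ i j, mvfderiv (𝓡 n) g y (P.frame k y) i j =
      ⟪lc (P.frame i) y (P.frame k y), P.frame j y⟫_ℝ +
        ⟪P.frame i y, lc (P.frame j) y (P.frame k y)⟫_ℝ := by
    intro i j
    rw [← P.mvfderiv_coordGram hmet hy]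
    exact (mvfderiv_clm_comp ((ContinuousLinearMap.proj (R := ℝ) (φ := fun _ : Fin n ↦ ℝ) j).comp
      (ContinuousLinearMap.proj (R := ℝ) (φ := fun _ : Fin n ↦ Fin n → ℝ) i)) hg _).symm
  -- These are the coefficients in `∇ₖXᵢ = ∑ₗ aᵢₗ Xₗ`.
  let a : Matrix (Fin n) (Fin n) ℝ :=
    Matrix.of fun i l ↦ ⟪P.coframe l y, lc (P.frame i) y (P.frame k y)⟫_ℝ
  have hG : ∀ i j, coordGram n x₀ y i j = ⟪P.frame i y, P.frame j y⟫_ℝ := by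
    intro i j
    rw [P.frame_eq y hy, P.frame_eq y hy]
    rfl
  have h3 : Matrix.of (mvfderiv (𝓡 n) g y (P.frame k y)) =
      a * coordGram n x₀ y + coordGram n x₀ y * a.transpose := by
    ext i j
    rw [Matrix.of_apply, h2, Matrix.add_apply, Matrix.mul_apply, Matrix.mul_apply]
    congr 1
    · conv_lhs => rw [← P.sum_inner_smul_frame hy (lc (P.frame i) y (P.frame k y)), sum_inner]
      refine Finset.sum_congr rfl fun l _ ↦ ?_
      rw [real_inner_smul_left, hG]
      rfl
    · conv_lhs => rw [← P.sum_inner_smul_frame hy (lc (P.frame j) y (P.frame k y)), inner_sum]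
      refine Finset.sum_congr rfl fun l _ ↦ ?_
      rw [real_inner_smul_right, hG, mul_comm]
      rfl
  have h4 : (Matrix.of (g y)) = coordGram n x₀ y := rfl
  have h5 : a.trace = P.christoffelTrace lc k y := by
    rw [christoffelTrace]
    exact Finset.sum_congr rfl fun i _ ↦ real_inner_comm (lc (P.frame i) y (P.frame k y)) _
  rw [h1, hL, h3, h4, mul_add, Matrix.trace_add, ← mul_assoc, ← mul_assoc, Matrix.adjugate_mul,
    Matrix.trace_mul_comm, ← mul_assoc, Matrix.mul_adjugate, smul_mul_assoc, smul_mul_assoc,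
    one_mul, one_mul, Matrix.trace_smul, Matrix.trace_smul, Matrix.trace_transpose, h5]
  simp only [smul_eq_mul]
  ring

lemma mvfderiv_density (hmet : lc.IsMetricCompatible) (hy : y ∈ P.dom) (k : Fin n) :
    mvfderiv (𝓡 n) P.density y (P.frame k y) = P.density y * P.christoffelTrace lc k y := by
  have hsrc := P.subset_source hy
  have hpos := (posDef_coordGram x₀ hsrc).det_pos
  have h1 := mvfderiv_det_coordGram P hmet hy k
  have hd : MDifferentiableAt (𝓡 n) 𝓘(ℝ, ℝ) (fun x ↦ (coordGram n x₀ x).det) y :=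
    ((contMDiffOn_det (fun i j ↦ contMDiffOn_coordGram (n := n) x₀ i j)).contMDiffAt
      ((chartAt (EuclideanSpace ℝ (Fin n)) x₀).open_source.mem_nhds hsrc)).mdifferentiableAt
        (by simp)
  have h3 : mvfderiv (𝓡 n) P.density y (P.frame k y) =
      (1 / (2 * √(coordGram n x₀ y).det)) *
        mvfderiv (𝓡 n) (fun x ↦ (coordGram n x₀ x).det) y (P.frame k y) :=
    (mvfderiv_comp_of_hasFDerivAt (f := fun x ↦ (coordGram n x₀ x).det)
      (Real.hasDerivAt_sqrt hpos.ne').hasFDerivAt hd _).trans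
      (mul_comm _ _)
  rw [h3, h1, density]
  have h4 := Real.mul_self_sqrt hpos.le
  have h5 := Real.sqrt_pos.2 hpos
  field_simp
  rw [sq, h4]

end CoordPatch

end Divergence

/-! ### Functions read in a chart and extended by zero. -/

section ChartRepresentation

variable {n : ℕ} {N : Type*} [EMetricSpace N] [ChartedSpace (EuclideanSpace ℝ (Fin n)) N]
  [IsManifold (𝓡 n) ∞ N] {W : Type*} [NormedAddCommGroup W] [NormedSpace ℝ W]

open Classical in
variable (n) in
/-- A function on `N` read in the chart at `x₀`, extended by zero. -/
def chartRep (x₀ : N) (f : N → W) (z : EuclideanSpace ℝ (Fin n)) : W :=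
  if z ∈ (extChartAt (𝓡 n) x₀).target then f ((extChartAt (𝓡 n) x₀).symm z) else 0

variable {x₀ : N} {f : N → W} {K : Set N}

lemma chartRep_of_mem {z : EuclideanSpace ℝ (Fin n)} (hz : z ∈ (extChartAt (𝓡 n) x₀).target) :
    chartRep n x₀ f z = f ((extChartAt (𝓡 n) x₀).symm z) := if_pos hz

lemma chartRep_of_notMem {z : EuclideanSpace ℝ (Fin n)}
    (hz : z ∉ (extChartAt (𝓡 n) x₀).target) : chartRep n x₀ f z = 0 := if_neg hz

lemma chartRep_eq_zero (hK : ∀ y ∉ K, f y = 0) {z : EuclideanSpace ℝ (Fin n)}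
    (hz : z ∉ extChartAt (𝓡 n) x₀ '' K) : chartRep n x₀ f z = 0 := by
  by_cases h : z ∈ (extChartAt (𝓡 n) x₀).target
  · rw [chartRep_of_mem h]
    refine hK _ fun h2 ↦ hz ⟨_, h2, (extChartAt (𝓡 n) x₀).right_inv h⟩
  · exact chartRep_of_notMem h

lemma isCompact_image_extChartAt (hK : IsCompact K) (hKs : K ⊆ (extChartAt (𝓡 n) x₀).source) :
    IsCompact (extChartAt (𝓡 n) x₀ '' K) :=
  hK.image_of_continuousOn ((continuousOn_extChartAt x₀).mono hKs)

lemma hasCompactSupport_chartRep (hKc : IsCompact K) (hKs : K ⊆ (extChartAt (𝓡 n) x₀).source)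
    (hK : ∀ y ∉ K, f y = 0) : HasCompactSupport (chartRep n x₀ f) :=
  HasCompactSupport.intro (isCompact_image_extChartAt hKc hKs) fun _ hz ↦ chartRep_eq_zero hK hz

/-- Extension by zero creates no singularity at the edge of the target: the image of `K` is compact,
hence closed, and points outside the target have a neighbourhood missing it. -/
lemma contDiff_chartRep (hf : ContMDiffOn (𝓡 n) 𝓘(ℝ, W) ∞ f (extChartAt (𝓡 n) x₀).source)
    (hKc : IsCompact K) (hKs : K ⊆ (extChartAt (𝓡 n) x₀).source) (hK : ∀ y ∉ K, f y = 0) :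
    ContDiff ℝ ∞ (chartRep n x₀ f) := by
  rw [contDiff_iff_contDiffAt]
  intro z
  by_cases hz : z ∈ (extChartAt (𝓡 n) x₀).target
  · have h1 : ContMDiffOn (𝓡 n) 𝓘(ℝ, W) ∞ (f ∘ (extChartAt (𝓡 n) x₀).symm)
        (extChartAt (𝓡 n) x₀).target :=
      hf.comp (contMDiffOn_extChartAt_symm x₀) fun _ hw ↦ (extChartAt (𝓡 n) x₀).map_target hw
    have hn := (isOpen_extChartAt_target x₀).mem_nhds hz
    refine ((contMDiffOn_iff_contDiffOn.1 h1).contDiffAt hn).congr_of_eventuallyEq ?_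
    filter_upwards [hn] with w hw using chartRep_of_mem hw
  · have hn : (extChartAt (𝓡 n) x₀ '' K)ᶜ ∈ nhds z := by
      refine (isCompact_image_extChartAt hKc hKs).isClosed.isOpen_compl.mem_nhds fun h ↦ hz ?_
      obtain ⟨y, hy, rfl⟩ := h
      exact (extChartAt (𝓡 n) x₀).map_source (hKs hy)
    refine contDiffAt_const.congr_of_eventuallyEq (?_ : _ =ᶠ[nhds z] fun _ ↦ (0 : W))
    filter_upwards [hn] with w hw using chartRep_eq_zero hK hw

lemma fderiv_chartRep (hf : ContMDiffOn (𝓡 n) 𝓘(ℝ, W) ∞ f (extChartAt (𝓡 n) x₀).source)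
    {z : EuclideanSpace ℝ (Fin n)} (hz : z ∈ (extChartAt (𝓡 n) x₀).target) (j : Fin n) :
    fderiv ℝ (chartRep n x₀ f) z (EuclideanSpace.single j 1) =
      mvfderiv (𝓡 n) f ((extChartAt (𝓡 n) x₀).symm z)
        (coordField x₀ j ((extChartAt (𝓡 n) x₀).symm z)) := by
  have hn := (isOpen_extChartAt_target x₀).mem_nhds hz
  have h1 : chartRep n x₀ f =ᶠ[nhds z] f ∘ (extChartAt (𝓡 n) x₀).symm := by
    filter_upwards [hn] with w hw using chartRep_of_mem hw
  have h2 : MDifferentiableAt (𝓡 n) (𝓡 n) (extChartAt (𝓡 n) x₀).symm z :=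
    ((contMDiffOn_extChartAt_symm (n := ∞) x₀).contMDiffAt hn).mdifferentiableAt (by simp)
  have h3 : MDifferentiableAt (𝓡 n) 𝓘(ℝ, W) f ((extChartAt (𝓡 n) x₀).symm z) :=
    (hf.contMDiffAt ((isOpen_extChartAt_source x₀).mem_nhds
      ((extChartAt (𝓡 n) x₀).map_target hz))).mdifferentiableAt (by simp)
  rw [coordField_symm x₀ j hz, h1.fderiv_eq, ← mfderiv_eq_fderiv, mfderiv_comp z h3 h2]
  rfl

end ChartRepresentation

/-! ### The Riemannian volume in a chart. -/

section ChartIntegral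

variable {n : ℕ} {N : Type*} [EMetricSpace N] [ChartedSpace (EuclideanSpace ℝ (Fin n)) N]
  [IsManifold (𝓡 n) ∞ N]
  [RiemannianBundle (fun y : N ↦ TangentSpace (𝓡 n) y)]
  [IsContMDiffRiemannianBundle (𝓡 n) ∞ (EuclideanSpace ℝ (Fin n))
    (fun y : N ↦ TangentSpace (𝓡 n) y)]
  [MeasurableSpace N] [BorelSpace N] {μ : Measure N} {x₀ : N}
  {W : Type*} [NormedAddCommGroup W] [NormedSpace ℝ W]

lemma CoordPatch.volumeDensity_eq (P : CoordPatch n x₀) {z : EuclideanSpace ℝ (Fin n)}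
    (hz : z ∈ (extChartAt (𝓡 n) x₀).target) :
    volumeDensity x₀ z = P.density ((extChartAt (𝓡 n) x₀).symm z) := by
  rw [volumeDensity, CoordPatch.density, coordGram, Matrix.gram]
  simp only [coordField_symm x₀ _ hz]

lemma CoordPatch.continuousOn_volumeDensity (P : CoordPatch n x₀) :
    ContinuousOn (volumeDensity (n := n) x₀) (extChartAt (𝓡 n) x₀).target := by
  have h : ContinuousOn (fun z ↦ P.density ((extChartAt (𝓡 n) x₀).symm z))
      (extChartAt (𝓡 n) x₀).target :=
    P.contMDiffOn_density.continuousOn.comp (continuousOn_extChartAt_symm x₀) fun z hz ↦ by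
      have h := (extChartAt (𝓡 n) x₀).map_target hz
      rwa [extChartAt_source] at h
  exact h.congr fun z hz ↦ P.volumeDensity_eq hz

/-- The Riemannian measure in the chart at `x₀`. -/
lemma IsRiemannianVolume.restrict_source (hμ : IsRiemannianVolume (n := n) μ) (x₀ : N) :
    μ.restrict (extChartAt (𝓡 n) x₀).source =
      ((volume.restrict (extChartAt (𝓡 n) x₀).target).withDensity
        fun z ↦ ENNReal.ofReal (volumeDensity x₀ z)).map (extChartAt (𝓡 n) x₀).symm := by
  obtain ⟨P⟩ := nonempty_coordPatch (n := n) x₀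
  have htm : MeasurableSet (extChartAt (𝓡 n) x₀).target :=
    (isOpen_extChartAt_target x₀).measurableSet
  have hsm : MeasurableSet (extChartAt (𝓡 n) x₀).source :=
    (isOpen_extChartAt_source x₀).measurableSet
  -- The inverse chart is continuous on the target only, which gives measurability up to null sets
  -- of the restricted measure.
  have hae : AEMeasurable (extChartAt (𝓡 n) x₀).symm
      ((volume.restrict (extChartAt (𝓡 n) x₀).target).withDensity
        fun z ↦ ENNReal.ofReal (volumeDensity x₀ z)) :=
    ((continuousOn_extChartAt_symm x₀).aemeasurable htm).mono_ac
      (withDensity_absolutelyContinuous _ _)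
  ext s hs
  rw [Measure.restrict_apply hs, Measure.map_apply_of_aemeasurable hae hs, withDensity_apply',
    Measure.restrict_restrict' htm, hμ x₀ _ (hs.inter hsm) Set.inter_subset_right]
  congr 2
  ext z
  constructor
  · rintro ⟨y, ⟨hys, hy⟩, rfl⟩
    exact ⟨by
      change (extChartAt (𝓡 n) x₀).symm (extChartAt (𝓡 n) x₀ y) ∈ s
      rwa [(extChartAt (𝓡 n) x₀).left_inv hy], (extChartAt (𝓡 n) x₀).map_source hy⟩
  · rintro ⟨hzs, hz⟩
    exact ⟨_, ⟨hzs, (extChartAt (𝓡 n) x₀).map_target hz⟩, (extChartAt (𝓡 n) x₀).right_inv hz⟩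

/-- The integral of a function supported in the domain of a chart. -/
lemma IsRiemannianVolume.integral_eq (hμ : IsRiemannianVolume (n := n) μ) (P : CoordPatch n x₀)
    {f : N → W} (hf : AEStronglyMeasurable f μ)
    (h0 : ∀ y ∉ (extChartAt (𝓡 n) x₀).source, f y = 0) :
    ∫ y, f y ∂μ = ∫ z, chartRep n x₀ (fun y ↦ P.density y • f y) z := by
  have htm : MeasurableSet (extChartAt (𝓡 n) x₀).target :=
    (isOpen_extChartAt_target x₀).measurableSet
  have hae : AEMeasurable (extChartAt (𝓡 n) x₀).symm
      ((volume.restrict (extChartAt (𝓡 n) x₀).target).withDensity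
        fun z ↦ ENNReal.ofReal (volumeDensity x₀ z)) :=
    ((continuousOn_extChartAt_symm x₀).aemeasurable htm).mono_ac
      (withDensity_absolutelyContinuous _ _)
  have hρ : AEMeasurable (fun z ↦ ENNReal.ofReal (volumeDensity (n := n) x₀ z))
      (volume.restrict (extChartAt (𝓡 n) x₀).target) :=
    (P.continuousOn_volumeDensity.aemeasurable htm).ennreal_ofReal
  rw [← setIntegral_eq_integral_of_forall_compl_eq_zero h0, hμ.restrict_source, integral_map hae,
    integral_withDensity_eq_integral_toReal_smul₀ hρ]
  · rw [← setIntegral_eq_integral_of_forall_compl_eq_zero (s := (extChartAt (𝓡 n) x₀).target)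
      fun z hz ↦ chartRep_of_notMem hz]
    refine setIntegral_congr_fun htm fun z hz ↦ ?_
    rw [chartRep_of_mem hz, ← P.volumeDensity_eq hz, ENNReal.toReal_ofReal
      (show 0 ≤ volumeDensity x₀ z from Real.sqrt_nonneg _)]
  · exact .of_forall fun _ ↦ ENNReal.ofReal_lt_top
  · rw [← hμ.restrict_source]
    exact hf.restrict

end ChartIntegral

/-! ### The divergence theorem in Euclidean space. -/

section Green

/-- Integration by parts against the constant function `1`. -/
lemma integral_fderiv_eq_zero {V : Type*} [NormedAddCommGroup V] [InnerProductSpace ℝ V]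
    [FiniteDimensional ℝ V] [MeasurableSpace V] [BorelSpace V] {H : V → ℂ} (hH : ContDiff ℝ ∞ H)
    (hc : HasCompactSupport H) (w : V) : ∫ z, fderiv ℝ H z w = 0 := by
  have h1 : Continuous fun z ↦ fderiv ℝ H z w :=
    (hH.continuous_fderiv (by simp)).clm_apply continuous_const
  have h2 : HasCompactSupport fun z ↦ fderiv ℝ H z w := hc.fderiv_apply (𝕜 := ℝ) w
  have h := integral_smul_fderiv_eq_neg_fderiv_smul_of_integrable (𝕜 := ℝ) (μ := volume)
    (f := fun _ : V ↦ (1 : ℝ)) (g := H) (v := w) (by simp)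
    (by simpa using h1.integrable_of_hasCompactSupport h2)
    (by simpa using hH.continuous.integrable_of_hasCompactSupport hc)
    (fun _ _ ↦ differentiableAt_const _) (fun z _ ↦ hH.differentiable (by simp) z)
  simpa using h

end Green

/-! ### Green's formula for the tangential Dirac operator. -/

section GreenFormula

variable {n : ℕ} {N : Type*} [EMetricSpace N] [ChartedSpace (EuclideanSpace ℝ (Fin n)) N]
  [IsManifold (𝓡 n) ∞ N]
  [RiemannianBundle (fun y : N ↦ TangentSpace (𝓡 n) y)]
  [IsContMDiffRiemannianBundle (𝓡 n) ∞ (EuclideanSpace ℝ (Fin n))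
    (fun y : N ↦ TangentSpace (𝓡 n) y)]
  {F : Type*} [NormedAddCommGroup F] [NormedSpace ℂ F] [FiniteDimensional ℂ F]
  {E : N → Type*} [TopologicalSpace (TotalSpace F E)] [∀ y, NormedAddCommGroup (E y)]
  [∀ y, InnerProductSpace ℂ (E y)] [FiberBundle F E] [VectorBundle ℂ F E] [VectorBundle ℝ F E]
  [ContMDiffVectorBundle ∞ F E (𝓡 n)] [IsHermitianBundle n F E]

/-- A compactly supported section is a finite sum of sections with small supports. -/
lemma exists_finset_sum_eq [SigmaCompactSpace N] {U : N → Set N} (hUo : ∀ x, IsOpen (U x))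
    (hU : ∀ x, x ∈ U x) {u : Π y, E y} (hu : IsSmoothSection n F u) (huc : HasCompactSupp u) :
    ∃ (t : Finset N) (w : N → Π y, E y), (∀ i, IsSmoothSection n F (w i)) ∧
      (∀ i, ∃ K, IsCompact K ∧ K ⊆ U i ∧ ∀ y ∉ K, w i y = 0) ∧ u = ∑ i ∈ t, w i := by
  obtain ⟨K, hK, hKu⟩ := huc
  obtain ⟨χ, hχ⟩ := SmoothPartitionOfUnity.exists_isSubordinate (𝓡 n) hK.isClosed U hUo
    fun x _ ↦ Set.mem_iUnion.2 ⟨x, hU x⟩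
  have hfin := χ.locallyFinite.finite_nonempty_inter_compact hK
  refine ⟨hfin.toFinset, fun i ↦ (fun y ↦ χ i y) • u, fun i ↦ hu.real_smul (χ i).contMDiff,
    fun i ↦ ⟨K ∩ tsupport (χ i), hK.inter_right (isClosed_tsupport _),
      fun y hy ↦ hχ i hy.2, fun y hy ↦ ?_⟩, ?_⟩
  · by_cases h : y ∈ K
    · have : χ i y = 0 := image_eq_zero_of_notMem_tsupport fun h2 ↦ hy ⟨h, h2⟩
      change χ i y • u y = 0
      rw [this, zero_smul]
    · change χ i y • u y = 0
      rw [hKu y h, smul_zero]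
  · funext y
    rw [Finset.sum_apply]
    change u y = ∑ i ∈ hfin.toFinset, χ i y • u y
    rw [← Finset.sum_smul]
    by_cases h : y ∈ K
    · have h1 := χ.sum_eq_one h
      rw [finsum_eq_sum_of_support_subset _ (s := hfin.toFinset)] at h1
      · rw [h1, one_smul]
      · intro i hi
        exact hfin.mem_toFinset.2 ⟨y, hi, h⟩
    · rw [hKu y h, smul_zero]

namespace CollarDiracBundle

variable (S : CollarDiracBundle n N F E) {u v : Π y, E y} {x₀ : N} (P : CoordPatch n x₀)

lemma conn_eq_zero {y : N} (hu : IsSmoothSection n F u) (h : ∀ᶠ x in nhds y, u x = 0) :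
    S.conn u y = 0 := by
  have h1 := S.conn.isCovariantDerivativeOnUniv.congr_of_eventuallyEq
    (σ := u) (σ' := 0) (hu.mdifferentiableAt y)
    (IsSmoothSection.mdifferentiableAt (contMDiff_zeroSection ℝ E) y) Filter.univ_mem h
  rw [h1, S.conn.zero]
  rfl

lemma tangentialDirac_eq_zero {y : N} (hu : IsSmoothSection n F u)
    (h : ∀ᶠ x in nhds y, u x = 0) : S.tangentialDirac u y = 0 := by
  simp [tangentialDirac, S.conn_eq_zero hu h]

/-- The coefficients of the current of the pair `u`, `v`. -/
def current (u v : Π y, E y) (j : Fin n) (y : N) : ℂ :=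
  ⟪S.c y (P.coframe j y) (u y), v y⟫_ℂ

lemma contMDiff_current (hu : IsSmoothSection n F u) (hv : IsSmoothSection n F v) (j : Fin n) :
    ContMDiff (𝓡 n) 𝓘(ℝ, ℂ) ∞ (S.current P u v j) :=
  IsHermitianBundle.smooth_inner _ _ (S.c_smooth _ _ (P.smooth_coframe j) hu) hv

lemma mvfderiv_current (hu : IsSmoothSection n F u) (hv : IsSmoothSection n F v) (j : Fin n)
    (y : N) (w : TangentSpace (𝓡 n) y) :
    mvfderiv (𝓡 n) (S.current P u v j) y w =
      ⟪S.c y (S.lc (P.coframe j) y w) (u y), v y⟫_ℂ +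
        ⟪S.c y (P.coframe j y) (S.conn u y w), v y⟫_ℂ -
        ⟪u y, S.c y (P.coframe j y) (S.conn v y w)⟫_ℂ := by
  have h := S.conn_metric _ _ (S.c_smooth _ _ (P.smooth_coframe j) hu) hv y w
  rw [S.c_parallel _ _ (P.smooth_coframe j) hu, inner_add_left,
    S.c_skew y (P.coframe j y) (u y) (S.conn v y w), ← sub_eq_add_neg] at h
  exact h

/-- The difference `⟨D u, v⟩ - ⟨u, D v⟩` is a divergence. -/
lemma sum_mvfderiv_density_smul_current (hu : IsSmoothSection n F u) (hv : IsSmoothSection n F v)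
    {y : N} (hy : y ∈ P.dom) :
    ∑ j, mvfderiv (𝓡 n) (fun x ↦ P.density x • S.current P u v j x) y (P.frame j y) =
      P.density y • (⟪S.tangentialDirac u y, v y⟫_ℂ - ⟪u y, S.tangentialDirac v y⟫_ℂ) := by
  have hρ : MDifferentiableAt (𝓡 n) 𝓘(ℝ, ℝ) P.density y :=
    (P.contMDiffOn_density.contMDiffAt ((chartAt (EuclideanSpace ℝ (Fin n)) x₀).open_source.mem_nhds
      (P.subset_source hy))).mdifferentiableAt (by simp)
  have h1 : ∀ j, mvfderiv (𝓡 n) (fun x ↦ P.density x • S.current P u v j x) y (P.frame j y) =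
      P.density y • (mvfderiv (𝓡 n) (S.current P u v j) y (P.frame j y) +
        P.christoffelTrace S.lc j y • S.current P u v j y) := by
    intro j
    have h2 := DFunLike.congr_fun (mvfderiv_smul hρ
      ((S.contMDiff_current P hu hv j y).mdifferentiableAt (by simp))) (P.frame j y)
    refine (h2 : _ = _).trans ?_
    change P.density y • mvfderiv (𝓡 n) (S.current P u v j) y (P.frame j y) +
      mvfderiv (𝓡 n) P.density y (P.frame j y) • S.current P u v j y = _
    rw [P.mvfderiv_density S.lc_metric hy, smul_add, mul_smul]
  -- The derivatives of the dual frame produce exactly the negative of the term from the derivative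
  -- of the density, so the two cancel.
  have h3 : ∑ j, ⟪S.c y (S.lc (P.coframe j) y (P.frame j y)) (u y), v y⟫_ℂ =
      -∑ j, P.christoffelTrace S.lc j y • S.current P u v j y := by
    rw [← sum_inner, ← _root_.sum_apply, ← map_sum,
      P.sum_conn_coframe S.lc_metric S.lc_torsion hy, map_neg, map_sum, _root_.neg_apply,
      inner_neg_left, _root_.sum_apply, sum_inner]
    refine congrArg _ (Finset.sum_congr rfl fun j _ ↦ ?_)
    rw [map_smul, current, _root_.smul_apply, ← Complex.coe_smul, ← Complex.coe_smul,
      inner_smul_left, Complex.conj_ofReal, smul_eq_mul]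
  simp only [h1, S.mvfderiv_current P hu hv]
  rw [← Finset.smul_sum, S.tangentialDirac_eq P hy, S.tangentialDirac_eq P hy, sum_inner, inner_sum]
  simp only [Finset.sum_add_distrib, Finset.sum_sub_distrib]
  rw [h3]
  congr 1
  abel

lemma tangentialDirac_sum {ι : Type*} (t : Finset ι) {w : ι → Π y, E y}
    (hw : ∀ i, IsSmoothSection n F (w i)) :
    S.tangentialDirac (∑ i ∈ t, w i) = ∑ i ∈ t, S.tangentialDirac (w i) := by
  classical
  induction t using Finset.induction_on with
  | empty =>
    funext y
    simp [tangentialDirac, S.conn.zero]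
  | insert i t hi ih =>
    rw [Finset.sum_insert hi, Finset.sum_insert hi,
      S.tangentialDirac_add (hw i) (IsSmoothSection.sum fun i _ ↦ hw i), ih]

lemma hasCompactSupp_tangentialDirac (hu : IsSmoothSection n F u) (huc : HasCompactSupp u) :
    HasCompactSupp (S.tangentialDirac u) := by
  obtain ⟨K, hK, hKu⟩ := huc
  refine ⟨K, hK, fun y hy ↦ S.tangentialDirac_eq_zero hu ?_⟩
  filter_upwards [hK.isClosed.isOpen_compl.mem_nhds hy] with x hx using hKu x hx

lemma isSmoothSection_boundaryOp (hu : IsSmoothSection n F u) :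
    IsSmoothSection n F (S.boundaryOp u) := by
  have h : S.boundaryOp u = (-1 : ℂ) • fun y ↦ S.cτ y ((S.tangentialDirac u +
      fun x ↦ S.pot x (u x)) y) := by
    funext y
    rw [Pi.smul_apply, neg_one_smul]
    rfl
  rw [h]
  exact (S.cτ_smooth _ ((S.isSmoothSection_tangentialDirac hu).add (S.pot_smooth u hu))).smul _

lemma hasCompactSupp_boundaryOp (hu : IsSmoothSection n F u) (huc : HasCompactSupp u) :
    HasCompactSupp (S.boundaryOp u) := by
  obtain ⟨K, hK, hKu⟩ := huc
  refine ⟨K, hK, fun y hy ↦ ?_⟩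
  rw [boundaryOp, S.tangentialDirac_eq_zero hu, hKu y hy]
  · simp
  · filter_upwards [hK.isClosed.isOpen_compl.mem_nhds hy] with x hx using hKu x hx

lemma norm_cτ (y : N) (e : E y) : ‖S.cτ y e‖ = ‖e‖ := by
  have h := S.cτ_skew y e (S.cτ y e)
  rw [S.cτ_sq, inner_neg_right, neg_neg, inner_self_eq_norm_sq_to_K,
    inner_self_eq_norm_sq_to_K] at h
  have h2 : ‖S.cτ y e‖ ^ 2 = ‖e‖ ^ 2 := by exact_mod_cast h
  exact (sq_eq_sq₀ (norm_nonneg _) (norm_nonneg _)).1 h2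

variable [MeasurableSpace N] [BorelSpace N] {μ : Measure N}

/-- In the chart the integrand times the density is a Euclidean divergence of compactly supported
functions. Only `u` has to have small support; `v` is arbitrary. -/
lemma integral_inner_tangentialDirac_of_subset (hμ : IsRiemannianVolume (n := n) μ)
    (hu : IsSmoothSection n F u) (hv : IsSmoothSection n F v) {K : Set N} (hK : IsCompact K)
    (hKP : K ⊆ P.dom) (hKu : ∀ y ∉ K, u y = 0) :
    ∫ y, (⟪S.tangentialDirac u y, v y⟫_ℂ - ⟪u y, S.tangentialDirac v y⟫_ℂ) ∂μ = 0 := by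
  have hKs : K ⊆ (extChartAt (𝓡 n) x₀).source := by
    rw [extChartAt_source]
    exact hKP.trans P.subset_source
  have hnear : ∀ y ∉ K, ∀ᶠ x in nhds y, u x = 0 := fun y hy ↦ by
    filter_upwards [hK.isClosed.isOpen_compl.mem_nhds hy] with x hx using hKu x hx
  have h0 : ∀ y ∉ K, (⟪S.tangentialDirac u y, v y⟫_ℂ - ⟪u y, S.tangentialDirac v y⟫_ℂ) = 0 := by
    intro y hy
    rw [hKu y hy, S.tangentialDirac_eq_zero hu (hnear y hy), inner_zero_left, inner_zero_left,
      sub_zero]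
  have hcont : Continuous fun y ↦
      (⟪S.tangentialDirac u y, v y⟫_ℂ - ⟪u y, S.tangentialDirac v y⟫_ℂ) :=
    (IsHermitianBundle.smooth_inner _ _ (S.isSmoothSection_tangentialDirac hu) hv).continuous.sub
      (IsHermitianBundle.smooth_inner _ _ hu (S.isSmoothSection_tangentialDirac hv)).continuous
  rw [hμ.integral_eq P hcont.aestronglyMeasurable fun y hy ↦ h0 y fun h ↦ hy (hKs h)]
  let H : Fin n → N → ℂ := fun j x ↦ P.density x • S.current P u v j x
  have hH0 : ∀ j, ∀ y ∉ K, H j y = 0 := by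
    intro j y hy
    simp only [H, current, hKu y hy, map_zero, inner_zero_left, smul_zero]
  have hH : ∀ j, ContMDiffOn (𝓡 n) 𝓘(ℝ, ℂ) ∞ (H j) (extChartAt (𝓡 n) x₀).source := by
    intro j
    have h1 := P.contMDiffOn_density
    rw [← extChartAt_source (𝓡 n) x₀] at h1
    exact h1.smul (S.contMDiff_current P hu hv j).contMDiffOn
  have hcd : ∀ j, ContDiff ℝ ∞ (chartRep n x₀ (H j)) := fun j ↦
    contDiff_chartRep (hH j) hK hKs (hH0 j)
  have hcs : ∀ j, HasCompactSupport (chartRep n x₀ (H j)) := fun j ↦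
    hasCompactSupport_chartRep hK hKs (hH0 j)
  have hsum : ∀ z, chartRep n x₀ (fun y ↦ P.density y •
      (⟪S.tangentialDirac u y, v y⟫_ℂ - ⟪u y, S.tangentialDirac v y⟫_ℂ)) z =
      ∑ j, fderiv ℝ (chartRep n x₀ (H j)) z (EuclideanSpace.single j 1) := by
    intro z
    by_cases hz : z ∈ extChartAt (𝓡 n) x₀ '' K
    · obtain ⟨y, hy, rfl⟩ := hz
      have hz := (extChartAt (𝓡 n) x₀).map_source (hKs hy)
      rw [chartRep_of_mem hz]
      simp only [fderiv_chartRep (hH _) hz]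
      rw [(extChartAt (𝓡 n) x₀).left_inv (hKs hy),
        ← S.sum_mvfderiv_density_smul_current P hu hv (hKP hy)]
      refine Finset.sum_congr rfl fun j _ ↦ ?_
      rw [P.frame_eq y (hKP hy)]
    · rw [chartRep_eq_zero (K := K) (fun y hy ↦ by rw [h0 y hy, smul_zero]) hz]
      refine (Finset.sum_eq_zero fun j _ ↦ ?_).symm
      have h1 : chartRep n x₀ (H j) =ᶠ[nhds z] fun _ ↦ (0 : ℂ) := by
        filter_upwards [(isCompact_image_extChartAt hK hKs).isClosed.isOpen_compl.mem_nhds hz]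
          with w hw using chartRep_eq_zero (hH0 j) hw
      rw [h1.fderiv_eq]
      simp
  simp only [hsum]
  rw [integral_finsetSum _ fun j _ ↦ ?_]
  · exact Finset.sum_eq_zero fun j _ ↦ integral_fderiv_eq_zero (hcd j) (hcs j) _
  · exact (((hcd j).continuous_fderiv (by simp)).clm_apply
      continuous_const).integrable_of_hasCompactSupport ((hcs j).fderiv_apply (𝕜 := ℝ) _)

end CollarDiracBundle

lemma integrable_inner_of_hasCompactSupp [MeasurableSpace N] [BorelSpace N] {μ : Measure N}
    [IsLocallyFiniteMeasure μ] {u v : Π y, E y} (hu : IsSmoothSection n F u)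
    (hv : IsSmoothSection n F v) (huc : HasCompactSupp u) :
    Integrable (fun y ↦ ⟪u y, v y⟫_ℂ) μ := by
  obtain ⟨K, hK, hKu⟩ := huc
  refine (IsHermitianBundle.smooth_inner _ _ hu hv).continuous.integrable_of_hasCompactSupport ?_
  exact HasCompactSupport.intro hK fun y hy ↦ by rw [hKu y hy, inner_zero_left]

/-- Green's formula: the tangential Dirac operator is formally self-adjoint. -/
lemma CollarDiracBundle.integral_inner_tangentialDirac (S : CollarDiracBundle n N F E)
    [SigmaCompactSpace N] [MeasurableSpace N] [BorelSpace N] {μ : Measure N}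
    [IsLocallyFiniteMeasure μ] (hμ : IsRiemannianVolume (n := n) μ) {u v : Π y, E y}
    (hu : IsSmoothSection n F u) (hv : IsSmoothSection n F v) (huc : HasCompactSupp u) :
    ∫ y, ⟪S.tangentialDirac u y, v y⟫_ℂ ∂μ = ∫ y, ⟪u y, S.tangentialDirac v y⟫_ℂ ∂μ := by
  have P : ∀ x₀ : N, CoordPatch n x₀ := fun x₀ ↦ (nonempty_coordPatch x₀).some
  obtain ⟨t, w, hw, hwc, rfl⟩ := exists_finset_sum_eq (fun x ↦ (P x).isOpen_dom)
    (fun x ↦ (P x).mem_dom) hu huc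
  have hc : ∀ i, HasCompactSupp (w i) := fun i ↦
    let ⟨K, hK, _, h⟩ := hwc i
    ⟨K, hK, h⟩
  have hi1 : ∀ i, Integrable (fun y ↦ ⟪S.tangentialDirac (w i) y, v y⟫_ℂ) μ := fun i ↦
    integrable_inner_of_hasCompactSupp (S.isSmoothSection_tangentialDirac (hw i)) hv
      (S.hasCompactSupp_tangentialDirac (hw i) (hc i))
  have hi2 : ∀ i, Integrable (fun y ↦ ⟪w i y, S.tangentialDirac v y⟫_ℂ) μ := fun i ↦
    integrable_inner_of_hasCompactSupp (hw i) (S.isSmoothSection_tangentialDirac hv) (hc i)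
  simp only [S.tangentialDirac_sum t hw, Finset.sum_apply, sum_inner]
  rw [integral_finsetSum _ fun i _ ↦ hi1 i, integral_finsetSum _ fun i _ ↦ hi2 i]
  refine Finset.sum_congr rfl fun i _ ↦ sub_eq_zero.1 ?_
  obtain ⟨K, hK, hKP, h⟩ := hwc i
  rw [← integral_sub (hi1 i) (hi2 i)]
  exact S.integral_inner_tangentialDirac_of_subset (P i) hμ (hw i) hv hK hKP h

end GreenFormula

/-! ### Symmetry and oddness of the boundary operator on test sections. -/

section BoundaryOperator

variable {n : ℕ} {N : Type*} [EMetricSpace N] [ChartedSpace (EuclideanSpace ℝ (Fin n)) N]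
  [IsManifold (𝓡 n) ∞ N]
  [RiemannianBundle (fun y : N ↦ TangentSpace (𝓡 n) y)]
  [IsContMDiffRiemannianBundle (𝓡 n) ∞ (EuclideanSpace ℝ (Fin n))
    (fun y : N ↦ TangentSpace (𝓡 n) y)]
  {F : Type*} [NormedAddCommGroup F] [NormedSpace ℂ F] [FiniteDimensional ℂ F]
  {E : N → Type*} [TopologicalSpace (TotalSpace F E)] [∀ y, NormedAddCommGroup (E y)]
  [∀ y, InnerProductSpace ℂ (E y)] [FiberBundle F E] [VectorBundle ℂ F E] [VectorBundle ℝ F E]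
  [ContMDiffVectorBundle ∞ F E (𝓡 n)] [IsHermitianBundle n F E]
  [MeasurableSpace N] {μ : Measure N}

namespace TestSection

/-- A smooth compactly supported section as an element of `C_c^∞(N, E)`. -/
def mk (μ : Measure N) (u : Π y, E y) (hu : IsSmoothSection n F u) (hc : HasCompactSupp u) :
    TestSection n F E μ :=
  (⟨u, hu, hc⟩ : testSections n F E)

lemma ext {φ ψ : TestSection n F E μ} (h : ∀ y, φ.toFun y = ψ.toFun y) : φ = ψ :=
  Subtype.ext (funext h)

lemma smooth (φ : TestSection n F E μ) : IsSmoothSection n F φ.toFun :=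
  (show testSections n F E from φ).2.1

lemma hasCompactSupp (φ : TestSection n F E μ) : HasCompactSupp φ.toFun :=
  (show testSections n F E from φ).2.2

lemma toFun_add (φ ψ : TestSection n F E μ) : (φ + ψ).toFun = φ.toFun + ψ.toFun := rfl

lemma toFun_smul (a : ℂ) (φ : TestSection n F E μ) : (a • φ).toFun = a • φ.toFun := rfl

variable [BorelSpace N] [IsLocallyFiniteMeasure μ]

lemma inner_eq (φ ψ : TestSection n F E μ) : ⟪φ, ψ⟫_ℂ = ∫ y, ⟪φ.toFun y, ψ.toFun y⟫_ℂ ∂μ := rfl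

end TestSection

namespace CollarDiracBundle

variable (S : CollarDiracBundle n N F E) {u v : Π y, E y}

variable (μ) in
/-- The operator `𝒜` on `C_c^∞(N, E)`. -/
def boundaryTest : TestSection n F E μ →ₗ[ℂ] TestSection n F E μ where
  toFun φ := .mk μ (S.boundaryOp φ.toFun) (S.isSmoothSection_boundaryOp φ.smooth)
    (S.hasCompactSupp_boundaryOp φ.smooth φ.hasCompactSupp)
  map_add' φ ψ := TestSection.ext fun y ↦ by
    change S.boundaryOp (φ.toFun + ψ.toFun) y = S.boundaryOp φ.toFun y + S.boundaryOp ψ.toFun y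
    simp only [boundaryOp, S.tangentialDirac_add φ.smooth ψ.smooth, Pi.add_apply, map_add]
    abel
  map_smul' a φ := TestSection.ext fun y ↦ by
    change S.boundaryOp (a • φ.toFun) y = a • S.boundaryOp φ.toFun y
    simp only [boundaryOp, S.tangentialDirac_smul a φ.smooth, Pi.smul_apply, map_smul, ← smul_add,
      smul_neg]

lemma toFun_boundaryTest (φ : TestSection n F E μ) :
    (S.boundaryTest μ φ).toFun = S.boundaryOp φ.toFun := rfl

variable [BorelSpace N] [IsLocallyFiniteMeasure μ]

/-- Moving the skew `c(τ)` to the right cancels the minus sign of `𝒜`. Then `D + Ψ` is moved by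
Green's formula and the symmetry of `Ψ`, and it anticommutes with `c(τ)`. For `Ψ` this is the
vanishing of the `∂_t` coefficient of `[D, Ψ]₊`. -/
lemma inner_boundaryTest [SigmaCompactSpace N] (hμ : IsRiemannianVolume (n := n) μ)
    (hS : S.IsStronglyCallias) (φ ψ : TestSection n F E μ) :
    ⟪S.boundaryTest μ φ, ψ⟫_ℂ = ⟪φ, S.boundaryTest μ ψ⟫_ℂ := by
  rw [TestSection.inner_eq, TestSection.inner_eq]
  have hcψ := S.cτ_smooth _ ψ.smooth
  have hpψ := S.pot_smooth _ hcψ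
  have h1 : ∀ y, ⟪(S.boundaryTest μ φ).toFun y, ψ.toFun y⟫_ℂ =
      ⟪S.tangentialDirac φ.toFun y, S.cτ y (ψ.toFun y)⟫_ℂ +
        ⟪φ.toFun y, S.pot y (S.cτ y (ψ.toFun y))⟫_ℂ := by
    intro y
    rw [toFun_boundaryTest, boundaryOp, inner_neg_left, S.cτ_skew, neg_neg, inner_add_left,
      S.pot_symm]
  have h2 : ∀ y, ⟪φ.toFun y, (S.boundaryTest μ ψ).toFun y⟫_ℂ =
      ⟪φ.toFun y, S.tangentialDirac (fun x ↦ S.cτ x (ψ.toFun x)) y⟫_ℂ +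
        ⟪φ.toFun y, S.pot y (S.cτ y (ψ.toFun y))⟫_ℂ := by
    intro y
    rw [toFun_boundaryTest, boundaryOp, ← inner_add_right, S.tangentialDirac_cτ ψ.smooth, map_add,
      eq_neg_of_add_eq_zero_left (hS.cτ_pot y (ψ.toFun y)), neg_add, neg_neg]
  simp only [h1, h2]
  have i0 := integrable_inner_of_hasCompactSupp (μ := μ) φ.smooth hpψ φ.hasCompactSupp
  rw [integral_add (integrable_inner_of_hasCompactSupp
      (S.isSmoothSection_tangentialDirac φ.smooth) hcψ
      (S.hasCompactSupp_tangentialDirac φ.smooth φ.hasCompactSupp)) i0,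
    integral_add (integrable_inner_of_hasCompactSupp φ.smooth
      (S.isSmoothSection_tangentialDirac hcψ) φ.hasCompactSupp) i0,
    S.integral_inner_tangentialDirac hμ φ.smooth hcψ φ.hasCompactSupp]

/-- The pairs spanning the graph already form a subspace, since `𝒜` is linear and preserves test
sections. -/
lemma mem_testGraph_iff {p : L2 n F E μ × L2 n F E μ} : p ∈ testGraph n F E μ S.boundaryOp ↔
    ∃ φ : TestSection n F E μ, p = ((φ : L2 n F E μ), (S.boundaryTest μ φ : L2 n F E μ)) := by
  constructor
  · intro hp
    induction hp using Submodule.span_induction with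
    | mem p hp =>
      obtain ⟨φ, ψ, hψ, rfl⟩ := hp
      refine ⟨φ, ?_⟩
      rw [TestSection.ext (φ := ψ) (ψ := S.boundaryTest μ φ) hψ]
    | zero => exact ⟨0, by rw [map_zero]; rfl⟩
    | add p q _ _ hp hq =>
      obtain ⟨φ, rfl⟩ := hp
      obtain ⟨ψ, rfl⟩ := hq
      refine ⟨φ + ψ, ?_⟩
      rw [map_add, UniformSpace.Completion.coe_add, UniformSpace.Completion.coe_add]
      rfl
    | smul a p _ hp =>
      obtain ⟨φ, rfl⟩ := hp
      refine ⟨a • φ, ?_⟩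
      rw [map_smul, UniformSpace.Completion.coe_smul, UniformSpace.Completion.coe_smul]
      rfl
  · rintro ⟨φ, rfl⟩
    exact Submodule.subset_span ⟨φ, _, fun _ ↦ rfl, rfl⟩

lemma isSymmetricGraph_testGraph [SigmaCompactSpace N] (hμ : IsRiemannianVolume (n := n) μ)
    (hS : S.IsStronglyCallias) : IsSymmetricGraph (testGraph n F E μ S.boundaryOp) := by
  intro p hp q hq
  obtain ⟨φ, rfl⟩ := S.mem_testGraph_iff.1 hp
  obtain ⟨ψ, rfl⟩ := S.mem_testGraph_iff.1 hq
  simp only [UniformSpace.Completion.inner_coe]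
  exact S.inner_boundaryTest hμ hS φ ψ

end CollarDiracBundle

/-- The grading with the two summands exchanged. -/
def OddGrading.swap {A : (Π y, E y) → (Π y, E y)} (G : OddGrading n F A) : OddGrading n F A where
  plus := G.minus
  minus := G.plus
  orthogonal y := (G.orthogonal y).symm
  sup_eq_top y := by rw [sup_comm, G.sup_eq_top]
  smooth u hu := by
    obtain ⟨u₁, u₂, h₁, h₂, h⟩ := G.smooth u hu
    exact ⟨u₂, u₁, h₂, h₁, fun y ↦ ⟨(h y).2.1, (h y).1, (h y).2.2.trans (add_comm _ _)⟩⟩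
  odd_plus := G.odd_minus
  odd_minus := G.odd_plus

variable [BorelSpace N] [IsLocallyFiniteMeasure μ]

instance (E' : Π y, Submodule ℂ (E y)) : CompleteSpace (L2Sub n F E μ E') :=
  (Submodule.isClosed_topologicalClosure _).completeSpace_coe

lemma coe_mem_L2Sub {E' : Π y, Submodule ℂ (E y)} {φ : TestSection n F E μ}
    (h : ∀ y, φ.toFun y ∈ E' y) : (φ : L2 n F E μ) ∈ L2Sub n F E μ E' :=
  subset_closure (Submodule.subset_span ⟨φ, h, rfl⟩)

lemma coe_mem_L2Sub_orthogonal {E' E'' : Π y, Submodule ℂ (E y)} (hE : ∀ y, E' y ⟂ E'' y)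
    {φ : TestSection n F E μ} (h : ∀ y, φ.toFun y ∈ E'' y) :
    (φ : L2 n F E μ) ∈ (L2Sub n F E μ E')ᗮ := by
  rw [L2Sub, Submodule.orthogonal_closure, Submodule.mem_orthogonal]
  intro w hw
  induction hw using Submodule.span_induction with
  | mem w hw =>
    obtain ⟨ψ, hψ, rfl⟩ := hw
    rw [UniformSpace.Completion.inner_coe, TestSection.inner_eq]
    simp only [fun y ↦ (hE y).inner_eq (hψ y) (h y), integral_zero]
  | zero => exact inner_zero_left _
  | add w z _ _ hw hz => rw [inner_add_left, hw, hz, add_zero]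
  | smul a w _ hw => rw [inner_smul_left, hw, mul_zero]

lemma OddGrading.exists_add_eq {A : (Π y, E y) → (Π y, E y)} (G : OddGrading n F A)
    (φ : TestSection n F E μ) : ∃ φ₁ φ₂ : TestSection n F E μ,
      (∀ y, φ₁.toFun y ∈ G.plus y) ∧ (∀ y, φ₂.toFun y ∈ G.minus y) ∧ φ = φ₁ + φ₂ := by
  obtain ⟨u₁, u₂, h₁, h₂, h⟩ := G.smooth _ φ.smooth
  obtain ⟨K, hK, hKφ⟩ := φ.hasCompactSupp
  have h0 : ∀ y ∉ K, u₁ y = 0 ∧ u₂ y = 0 := by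
    intro y hy
    obtain ⟨hp, hm, hs⟩ := h y
    rw [hKφ y hy] at hs
    have h1 : u₁ y = -u₂ y := eq_neg_of_add_eq_zero_left hs.symm
    have h2 : u₁ y ∈ G.plus y ⊓ G.minus y := ⟨hp, by rw [h1]; exact neg_mem hm⟩
    rw [(G.orthogonal y).disjoint.eq_bot, Submodule.mem_bot] at h2
    exact ⟨h2, by rw [h2, zero_add] at hs; exact hs.symm⟩
  exact ⟨.mk μ u₁ h₁ ⟨K, hK, fun y hy ↦ (h0 y hy).1⟩, .mk μ u₂ h₂ ⟨K, hK, fun y hy ↦ (h0 y hy).2⟩,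
    fun y ↦ (h y).1, fun y ↦ (h y).2.1, TestSection.ext fun y ↦ (h y).2.2⟩

/-- On test sections the reflection is `φ₁ + φ₂ ↦ φ₁ - φ₂`. As `𝒜φ₁` has values in `E⁻` and `𝒜φ₂` in
`E⁺`, it sends `𝒜(φ₁ + φ₂)` to `-𝒜(φ₁ - φ₂)`. -/
lemma CollarDiracBundle.isOddGraph_testGraph (S : CollarDiracBundle n N F E)
    (G : OddGrading n F S.boundaryOp) :
    IsOddGraph (testGraph n F E μ S.boundaryOp) (L2Sub n F E μ G.plus) := by
  intro p hp
  obtain ⟨φ, rfl⟩ := S.mem_testGraph_iff.1 hp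
  obtain ⟨φ₁, φ₂, h₁, h₂, rfl⟩ := G.exists_add_eq φ
  have a₁ : ∀ y, (S.boundaryTest μ φ₁).toFun y ∈ G.minus y := G.odd_plus _ φ₁.smooth h₁
  have a₂ : ∀ y, (S.boundaryTest μ φ₂).toFun y ∈ G.plus y := G.odd_minus _ φ₂.smooth h₂
  refine S.mem_testGraph_iff.2 ⟨φ₁ - φ₂, ?_⟩
  rw [map_add, map_sub, UniformSpace.Completion.coe_add, UniformSpace.Completion.coe_add,
    UniformSpace.Completion.coe_sub, UniformSpace.Completion.coe_sub, map_add, map_add,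
    Submodule.reflection_mem_subspace_eq_self (coe_mem_L2Sub h₁),
    Submodule.reflection_mem_subspace_eq_self (coe_mem_L2Sub a₂),
    Submodule.reflection_mem_subspace_orthogonalComplement_eq_neg
      (coe_mem_L2Sub_orthogonal G.orthogonal h₂),
    Submodule.reflection_mem_subspace_orthogonalComplement_eq_neg
      (coe_mem_L2Sub_orthogonal G.orthogonal a₁)]
  ext1
  · exact (sub_eq_add_neg _ _).symm
  · change -(-(_ : L2 n F E μ) + _) = _ - _
    abel

end BoundaryOperator

/-! ### Gårding's inequality and Rellich's theorem via the Fourier transform. -/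

section EuclideanEstimates

open scoped FourierTransform SchwartzMap LineDeriv

variable {n : ℕ} {W : Type*} [NormedAddCommGroup W] [InnerProductSpace ℂ W] [CompleteSpace W]

local notation "𝔼" => EuclideanSpace ℝ (Fin n)

/-- The square of the norm of the gradient. -/
def gradSq (f : EuclideanSpace ℝ (Fin n) → W) (z : EuclideanSpace ℝ (Fin n)) : ℝ :=
  ∑ j, ‖fderiv ℝ f z (EuclideanSpace.single j 1)‖ ^ 2

lemma gradSq_nonneg (f : 𝔼 → W) (z : 𝔼) : 0 ≤ gradSq f z :=
  Finset.sum_nonneg fun _ _ ↦ sq_nonneg _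

lemma integrable_norm_sq_schwartz (f : 𝓢(𝔼, W)) : Integrable fun z ↦ ‖f z‖ ^ 2 :=
  (f.memLp 2).integrable_norm_pow (by norm_num)

lemma fourier_partial (f : 𝓢(𝔼, W)) (j : Fin n) (ξ : 𝔼) :
    𝓕 (∂_{(EuclideanSpace.single j 1 : 𝔼)} f) ξ = (2 * Real.pi * Complex.I * ξ j) • 𝓕 f ξ := by
  rw [SchwartzMap.fourier_lineDerivOp_eq, _root_.smul_apply,
    SchwartzMap.smulLeftCLM_apply_apply (by fun_prop), EuclideanSpace.inner_single_right,
    ← Complex.coe_smul, smul_smul]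
  simp

lemma sum_norm_sq_fourier_partial (f : 𝓢(𝔼, W)) (ξ : 𝔼) :
    ∑ j, ‖𝓕 (∂_{(EuclideanSpace.single j 1 : 𝔼)} f) ξ‖ ^ 2 =
      (2 * Real.pi) ^ 2 * (‖ξ‖ ^ 2 * ‖𝓕 f ξ‖ ^ 2) := by
  simp only [fourier_partial, norm_smul, norm_mul, mul_pow, EuclideanSpace.real_norm_sq_eq]
  rw [Finset.sum_mul, Finset.mul_sum]
  refine Finset.sum_congr rfl fun j _ ↦ ?_
  simp
  ring

lemma integral_gradSq (f : 𝓢(𝔼, W)) :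
    ∫ z, gradSq f z = ∫ ξ, (2 * Real.pi) ^ 2 * (‖ξ‖ ^ 2 * ‖𝓕 f ξ‖ ^ 2) := by
  simp only [← sum_norm_sq_fourier_partial]
  rw [integral_finsetSum _ fun j _ ↦ integrable_norm_sq_schwartz _]
  simp only [SchwartzMap.integral_norm_sq_fourier]
  rw [← integral_finsetSum _ fun j _ ↦ integrable_norm_sq_schwartz _]
  rfl

lemma integrable_sq_mul_fourier (f : 𝓢(𝔼, W)) :
    Integrable fun ξ : 𝔼 ↦ (2 * Real.pi) ^ 2 * (‖ξ‖ ^ 2 * ‖𝓕 f ξ‖ ^ 2) := by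
  simp only [← sum_norm_sq_fourier_partial]
  exact integrable_finsetSum _ fun j _ ↦ integrable_norm_sq_schwartz _

lemma fourier_postcompCLM (L : W →L[ℂ] W) (f : 𝓢(𝔼, W)) (ξ : 𝔼) :
    𝓕 (f.postcompCLM L) ξ = L (𝓕 f ξ) := by
  rw [SchwartzMap.fourier_coe, SchwartzMap.fourier_coe, Real.fourier_eq, Real.fourier_eq,
    ← L.integral_comp_comm ((Real.fourierIntegral_convergent_iff ξ).2 f.integrable)]
  refine integral_congr_ae (.of_forall fun v ↦ ?_)
  simp [Circle.smul_def]

/-- Gårding's inequality for an elliptic operator of order one with constant coefficients. -/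
lemma sq_mul_integral_gradSq_le {γ : Fin n → W →L[ℂ] W} {c : ℝ} (hc : 0 ≤ c)
    (hγ : ∀ (ξ : 𝔼) (w : W), c * (‖ξ‖ * ‖w‖) ≤ ‖∑ j, (ξ j : ℂ) • γ j w‖)
    {f : 𝔼 → W} (hf : ContDiff ℝ ∞ f) (hfc : HasCompactSupport f) :
    c ^ 2 * ∫ z, gradSq f z ≤ ∫ z, ‖∑ j, γ j (fderiv ℝ f z (EuclideanSpace.single j 1))‖ ^ 2 := by
  let S : 𝓢(𝔼, W) := hfc.toSchwartzMap hf
  let D : 𝓢(𝔼, W) := ∑ j, (∂_{(EuclideanSpace.single j 1 : 𝔼)} S).postcompCLM (γ j)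
  have hD : ∀ z, D z = ∑ j, γ j (fderiv ℝ f z (EuclideanSpace.single j 1)) := by
    intro z
    simp only [D, _root_.sum_apply, SchwartzMap.postcompCLM_apply]
    rfl
  have hFD : ∀ ξ, 𝓕 D ξ = (2 * Real.pi * Complex.I) • ∑ j, (ξ j : ℂ) • γ j (𝓕 S ξ) := by
    intro ξ
    simp only [D, FourierTransform.fourier_sum, _root_.sum_apply, fourier_postcompCLM,
      fourier_partial, map_smul, Finset.smul_sum, smul_smul]
  have h1 : ∫ z, gradSq f z = ∫ ξ, (2 * Real.pi) ^ 2 * (‖ξ‖ ^ 2 * ‖𝓕 S ξ‖ ^ 2) :=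
    integral_gradSq S
  simp only [← hD]
  rw [h1, ← SchwartzMap.integral_norm_sq_fourier D, ← integral_const_mul]
  refine integral_mono ((integrable_sq_mul_fourier S).const_mul _)
    (integrable_norm_sq_schwartz _) fun ξ ↦ ?_
  have h2 := hγ ξ (𝓕 S ξ)
  have h3 : ‖𝓕 D ξ‖ = 2 * Real.pi * ‖∑ j, (ξ j : ℂ) • γ j (𝓕 S ξ)‖ := by
    rw [hFD, norm_smul]
    simp [abs_of_pos Real.pi_pos]
  change c ^ 2 * ((2 * Real.pi) ^ 2 * (‖ξ‖ ^ 2 * ‖𝓕 S ξ‖ ^ 2)) ≤ ‖𝓕 D ξ‖ ^ 2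
  rw [h3]
  have h4 : (c * (‖ξ‖ * ‖𝓕 S ξ‖)) ^ 2 ≤ ‖∑ j, (ξ j : ℂ) • γ j (𝓕 S ξ)‖ ^ 2 :=
    pow_le_pow_left₀ (by positivity) h2 2
  calc _ = (2 * Real.pi) ^ 2 * (c * (‖ξ‖ * ‖𝓕 S ξ‖)) ^ 2 := by ring
    _ ≤ _ := mul_le_mul_of_nonneg_left h4 (by positivity)
    _ = _ := (mul_pow _ _ _).symm

/-- Cauchy–Schwarz on `B`, obtained by integrating `2a‖f‖ ≤ ‖f‖² + a²` over `B` and choosing `a`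
well. The added `1` keeps the divisor positive when `B` is a null set. -/
lemma sq_setIntegral_le {f : 𝔼 → W} (hf : Continuous f) (hfc : HasCompactSupport f) {B : Set 𝔼}
    (hB : IsCompact B) (h0 : ∀ z ∉ B, f z = 0) :
    (∫ z, ‖f z‖) ^ 2 ≤ (volume.real B + 1) * ∫ z, ‖f z‖ ^ 2 := by
  have hv : 0 ≤ volume.real B := measureReal_nonneg
  have i1 : Integrable fun z ↦ ‖f z‖ := (hf.integrable_of_hasCompactSupport hfc).norm
  have i2 : Integrable fun z ↦ ‖f z‖ ^ 2 :=
    (by fun_prop : Continuous fun z ↦ ‖f z‖ ^ 2).integrable_of_hasCompactSupport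
      (hfc.comp_left (g := fun w : W ↦ ‖w‖ ^ 2) (by simp))
  have key : ∀ a : ℝ, 2 * a * ∫ z, ‖f z‖ ≤ (∫ z, ‖f z‖ ^ 2) + a ^ 2 * (volume.real B + 1) := by
    intro a
    have i3 : Integrable (B.indicator fun _ : 𝔼 ↦ a ^ 2) :=
      (integrable_indicator_iff hB.measurableSet).2 (integrableOn_const hB.measure_lt_top.ne)
    have h1 : ∫ z, B.indicator (fun _ : 𝔼 ↦ a ^ 2) z = volume.real B * a ^ 2 := by
      rw [integral_indicator hB.measurableSet, setIntegral_const, smul_eq_mul]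
    have h2 : ∫ z, 2 * a * ‖f z‖ ≤ ∫ z, (‖f z‖ ^ 2 + B.indicator (fun _ : 𝔼 ↦ a ^ 2) z) := by
      refine integral_mono (i1.const_mul _) (i2.add i3) fun z ↦ ?_
      by_cases hz : z ∈ B
      · simp only [Set.indicator_of_mem hz]
        nlinarith [sq_nonneg (‖f z‖ - a)]
      · simp [Set.indicator_of_notMem hz, h0 z hz]
    rw [integral_const_mul, integral_add i2 i3, h1] at h2
    nlinarith [sq_nonneg a]
  have hV : 0 < volume.real B + 1 := by linarith
  have h := key ((∫ z, ‖f z‖) / (volume.real B + 1))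
  have h2 : 2 * ((∫ z, ‖f z‖) / (volume.real B + 1)) * ∫ z, ‖f z‖ =
      2 * ((∫ z, ‖f z‖) ^ 2 / (volume.real B + 1)) := by ring
  have h3 : ((∫ z, ‖f z‖) / (volume.real B + 1)) ^ 2 * (volume.real B + 1) =
      (∫ z, ‖f z‖) ^ 2 / (volume.real B + 1) := by field_simp
  rw [h2, h3] at h
  have h4 : (∫ z, ‖f z‖) ^ 2 / (volume.real B + 1) ≤ ∫ z, ‖f z‖ ^ 2 := by linarith
  rwa [div_le_iff₀' hV] at h4

lemma norm_fourierChar_sub_le (a b : ℝ) :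
    ‖((Real.fourierChar a : Circle) : ℂ) - Real.fourierChar b‖ ≤ 2 * Real.pi * |a - b| := by
  have h1 : ((Real.fourierChar a : Circle) : ℂ) =
      Real.fourierChar b * Complex.exp (Complex.I * ((2 * Real.pi * (a - b) : ℝ) : ℂ)) := by
    rw [Real.fourierChar_apply, Real.fourierChar_apply, ← Complex.exp_add]
    congr 1
    push_cast
    ring
  rw [h1, ← mul_sub_one, norm_mul, Circle.norm_coe, one_mul]
  refine Real.norm_exp_I_mul_ofReal_sub_one_le.trans ?_
  rw [Real.norm_eq_abs, abs_mul, abs_of_pos Real.two_pi_pos]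

/-- On the support of `f` the characters with frequencies `ξ` and `η` differ by at most `2πR‖ξ -
η‖`. This equicontinuity is what reduces a ball of frequencies to a finite net. -/
lemma norm_fourier_sub_le {f : 𝔼 → W} (hf : Continuous f) (hfc : HasCompactSupport f) {R : ℝ}
    (hR : ∀ z, R < ‖z‖ → f z = 0) (ξ η : 𝔼) :
    ‖𝓕 f ξ - 𝓕 f η‖ ≤ 2 * Real.pi * (R * ‖ξ - η‖) * ∫ z, ‖f z‖ := by
  have i1 : Integrable f := hf.integrable_of_hasCompactSupport hfc
  rw [Real.fourier_eq, Real.fourier_eq, ← integral_sub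
    ((Real.fourierIntegral_convergent_iff ξ).2 i1) ((Real.fourierIntegral_convergent_iff η).2 i1),
    ← integral_const_mul]
  refine norm_integral_le_of_norm_le (i1.norm.const_mul _) (.of_forall fun z ↦ ?_)
  by_cases hz : R < ‖z‖
  · simp [hR z hz]
  · rw [Circle.smul_def, Circle.smul_def, ← sub_smul, norm_smul]
    refine mul_le_mul_of_nonneg_right ((norm_fourierChar_sub_le _ _).trans ?_) (norm_nonneg _)
    have h2 : |-⟪z, ξ⟫_ℝ - -⟪z, η⟫_ℝ| ≤ R * ‖ξ - η‖ := by
      rw [neg_sub_neg, ← inner_sub_right, norm_sub_rev ξ η]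
      exact (abs_real_inner_le_norm _ _).trans
        (mul_le_mul_of_nonneg_right (not_lt.1 hz) (norm_nonneg _))
    have := Real.two_pi_pos
    gcongr

/-- A quantitative form of Rellich's theorem: up to a small error, the `L²` norm is controlled by
finitely many values of the Fourier transform. -/
lemma exists_integral_norm_sq_le {B : Set (EuclideanSpace ℝ (Fin n))} (hB : IsCompact B) {ε : ℝ}
    (hε : 0 < ε) :
    ∃ (t : Finset (EuclideanSpace ℝ (Fin n))) (C : ℝ), 0 ≤ C ∧ ∀ f : EuclideanSpace ℝ (Fin n) → W,
      ContDiff ℝ ∞ f → (∀ z ∉ B, f z = 0) →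
        ∫ z, ‖f z‖ ^ 2 ≤ C * (∑ ξ ∈ t, ‖𝓕 f ξ‖ ^ 2) +
          ε * ((∫ z, gradSq f z) + ∫ z, ‖f z‖ ^ 2) := by
  obtain ⟨R, hR0, hR⟩ := hB.isBounded.exists_pos_norm_le
  -- The cut-off frequency: beyond it `1 ≤ ε(2π‖ξ‖)²`, so the high frequencies are absorbed by `ε`
  -- times the gradient term.
  let M : ℝ := 1 / (2 * Real.pi * √ε)
  have hM : 0 < M := by positivity
  have hMε : ε * ((2 * Real.pi) ^ 2 * M ^ 2) = 1 := by
    have : 0 < √ε := Real.sqrt_pos.2 hε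
    simp only [M]
    rw [div_pow, mul_pow (2 * Real.pi) (√ε), Real.sq_sqrt hε.le]
    field_simp
  let v : ℝ := volume.real (Metric.closedBall (0 : 𝔼) M)
  have hv : 0 ≤ v := measureReal_nonneg
  let b : ℝ := volume.real B + 1
  have hb : 0 < b := by
    have : 0 ≤ volume.real B := measureReal_nonneg
    simp only [b]
    linarith
  -- `Aδ²` is the factor of `∫‖f‖²` in the error made on the low frequencies by a net of mesh `δ`;
  -- hence the choice of `δ`.
  let A : ℝ := 2 * v * (2 * Real.pi * R) ^ 2 * b
  have hA : 0 ≤ A := by positivity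
  obtain ⟨δ, hδ, hAδ⟩ : ∃ δ : ℝ, 0 < δ ∧ A * δ ^ 2 ≤ ε := by
    refine ⟨√(ε / (A + 1)), by positivity, ?_⟩
    rw [Real.sq_sqrt (by positivity), mul_div_assoc', div_le_iff₀ (by positivity)]
    nlinarith
  obtain ⟨t, -, ht⟩ := (isCompact_closedBall (0 : 𝔼) M).finite_cover_balls hδ
  obtain ⟨htf, htc⟩ := ht
  refine ⟨htf.toFinset, 2 * v, by positivity, fun f hf h0 ↦ ?_⟩
  have hfc : HasCompactSupport f := HasCompactSupport.intro hB h0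
  let S : 𝓢(𝔼, W) := hfc.toSchwartzMap hf
  have hS : 𝓕 f = ⇑(𝓕 S : 𝓢(𝔼, W)) := (SchwartzMap.fourier_coe S).symm
  have hF : ∫ z, ‖f z‖ ^ 2 = ∫ ξ, ‖𝓕 f ξ‖ ^ 2 := by
    rw [hS]
    exact (SchwartzMap.integral_norm_sq_fourier S).symm
  have iF : Integrable fun ξ ↦ ‖𝓕 f ξ‖ ^ 2 := by
    rw [hS]
    exact integrable_norm_sq_schwartz _
  have hG : ∫ z, gradSq f z = ∫ ξ, (2 * Real.pi) ^ 2 * (‖ξ‖ ^ 2 * ‖𝓕 f ξ‖ ^ 2) := by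
    rw [hS]
    exact integral_gradSq S
  have iG : Integrable fun ξ : 𝔼 ↦ (2 * Real.pi) ^ 2 * (‖ξ‖ ^ 2 * ‖𝓕 f ξ‖ ^ 2) := by
    rw [hS]
    exact integrable_sq_mul_fourier S
  let Q : ℝ := ∑ ξ ∈ htf.toFinset, ‖𝓕 f ξ‖ ^ 2
  -- Compare with a net point at distance less than `δ`, using `(x + y)² ≤ 2x² + 2y²`.
  have hball : ∀ ξ ∈ Metric.closedBall (0 : 𝔼) M,
      ‖𝓕 f ξ‖ ^ 2 ≤ 2 * Q + 2 * ((2 * Real.pi * (R * δ)) ^ 2 * (b * ∫ z, ‖f z‖ ^ 2)) := by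
    intro ξ hξ
    obtain ⟨η, hη, hξη⟩ := Set.mem_iUnion₂.1 (htc hξ)
    have h1 : ‖𝓕 f ξ - 𝓕 f η‖ ≤ 2 * Real.pi * (R * δ) * ∫ z, ‖f z‖ := by
      refine (norm_fourier_sub_le hf.continuous hfc (R := R)
        (fun z hz ↦ h0 z fun h ↦ absurd (hR z h) (not_le.2 hz)) ξ η).trans ?_
      have h2 : ‖ξ - η‖ ≤ δ := by
        rw [← dist_eq_norm]
        exact (Metric.mem_ball.1 hξη).le
      have h3 : 0 ≤ ∫ z, ‖f z‖ := integral_nonneg fun _ ↦ norm_nonneg _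
      have := Real.two_pi_pos
      gcongr
    have h4 : ‖𝓕 f ξ - 𝓕 f η‖ ^ 2 ≤ (2 * Real.pi * (R * δ)) ^ 2 * (b * ∫ z, ‖f z‖ ^ 2) := by
      refine (pow_le_pow_left₀ (norm_nonneg _) h1 2).trans ?_
      rw [mul_pow]
      exact mul_le_mul_of_nonneg_left (sq_setIntegral_le hf.continuous hfc hB h0) (sq_nonneg _)
    have h5 : ‖𝓕 f η‖ ^ 2 ≤ Q :=
      Finset.single_le_sum (f := fun ξ ↦ ‖𝓕 f ξ‖ ^ 2) (fun _ _ ↦ sq_nonneg _)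
        (htf.mem_toFinset.2 hη)
    have h6 : ‖𝓕 f ξ‖ ≤ ‖𝓕 f η‖ + ‖𝓕 f ξ - 𝓕 f η‖ := norm_le_norm_add_norm_sub' _ _
    have h7 : ‖𝓕 f ξ‖ ^ 2 ≤ (‖𝓕 f η‖ + ‖𝓕 f ξ - 𝓕 f η‖) ^ 2 :=
      pow_le_pow_left₀ (norm_nonneg _) h6 2
    nlinarith [sq_nonneg (‖𝓕 f η‖ - ‖𝓕 f ξ - 𝓕 f η‖)]
  have hin : ∫ ξ in Metric.closedBall (0 : 𝔼) M, ‖𝓕 f ξ‖ ^ 2 ≤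
      2 * v * Q + ε * ∫ z, ‖f z‖ ^ 2 := by
    have h1 : ∫ ξ in Metric.closedBall (0 : 𝔼) M, ‖𝓕 f ξ‖ ^ 2 ≤
        ∫ _ in Metric.closedBall (0 : 𝔼) M,
          (2 * Q + 2 * ((2 * Real.pi * (R * δ)) ^ 2 * (b * ∫ z, ‖f z‖ ^ 2))) :=
      setIntegral_mono_on iF.integrableOn
        (integrableOn_const (isCompact_closedBall _ _).measure_lt_top.ne)
        Metric.isClosed_closedBall.measurableSet hball
    rw [setIntegral_const, smul_eq_mul] at h1
    refine h1.trans ?_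
    have h2 : 0 ≤ ∫ z, ‖f z‖ ^ 2 := integral_nonneg fun _ ↦ sq_nonneg _
    calc _ = 2 * v * Q + (A * δ ^ 2) * ∫ z, ‖f z‖ ^ 2 := by
          simp only [A, v]
          ring
      _ ≤ _ := by gcongr
  have hout : ∫ ξ in (Metric.closedBall (0 : 𝔼) M)ᶜ, ‖𝓕 f ξ‖ ^ 2 ≤ ε * ∫ z, gradSq f z := by
    rw [hG, ← integral_const_mul]
    have h1 : ∫ ξ in (Metric.closedBall (0 : 𝔼) M)ᶜ, ‖𝓕 f ξ‖ ^ 2 ≤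
        ∫ ξ in (Metric.closedBall (0 : 𝔼) M)ᶜ,
          ε * ((2 * Real.pi) ^ 2 * (‖ξ‖ ^ 2 * ‖𝓕 f ξ‖ ^ 2)) := by
      refine setIntegral_mono_on iF.integrableOn (iG.const_mul ε).integrableOn
        Metric.isClosed_closedBall.measurableSet.compl fun ξ hξ ↦ ?_
      have h2 : M ≤ ‖ξ‖ := by
        rw [Set.mem_compl_iff, mem_closedBall_zero_iff, not_le] at hξ
        exact hξ.le
      have h3 : M ^ 2 ≤ ‖ξ‖ ^ 2 := pow_le_pow_left₀ hM.le h2 2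
      have h4 : 1 ≤ ε * ((2 * Real.pi) ^ 2 * ‖ξ‖ ^ 2) := by
        rw [← hMε]
        gcongr
      calc _ = 1 * ‖𝓕 f ξ‖ ^ 2 := (one_mul _).symm
        _ ≤ (ε * ((2 * Real.pi) ^ 2 * ‖ξ‖ ^ 2)) * ‖𝓕 f ξ‖ ^ 2 := by gcongr
        _ = _ := by ring
    exact h1.trans (setIntegral_le_integral (iG.const_mul ε) (.of_forall fun ξ ↦ by positivity))
  have hsplit := integral_add_compl
    (Metric.isClosed_closedBall (x := (0 : 𝔼)) (ε := M)).measurableSet iF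
  calc ∫ z, ‖f z‖ ^ 2 = ∫ ξ, ‖𝓕 f ξ‖ ^ 2 := hF
    _ = _ := hsplit.symm
    _ ≤ (2 * v * Q + ε * ∫ z, ‖f z‖ ^ 2) + ε * ∫ z, gradSq f z := add_le_add hin hout
    _ = _ := by ring

end EuclideanEstimates

/-! ### Local frames of the Hermitian bundle. -/

section BundleFrame

variable {n : ℕ} {N : Type*} [EMetricSpace N] [ChartedSpace (EuclideanSpace ℝ (Fin n)) N]
  [IsManifold (𝓡 n) ∞ N]
  {F : Type*} [NormedAddCommGroup F] [NormedSpace ℂ F] [FiniteDimensional ℂ F]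
  {E : N → Type*} [TopologicalSpace (TotalSpace F E)] [∀ y, NormedAddCommGroup (E y)]
  [∀ y, InnerProductSpace ℂ (E y)] [FiberBundle F E] [VectorBundle ℂ F E] [VectorBundle ℝ F E]
  [ContMDiffVectorBundle ∞ F E (𝓡 n)] [IsHermitianBundle n F E]

variable (n F E) in
/-- Global smooth sections which form a frame near `x₀`, orthonormal at `x₀`, together with the
coordinates with respect to this frame. -/
structure BundlePatch (x₀ : N) where
  rank : ℕ
  dom : Set N
  isOpen_dom : IsOpen dom
  mem_dom : x₀ ∈ dom
  sec : Fin rank → Π y, E y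
  smooth_sec : ∀ a, IsSmoothSection n F (sec a)
  coef : Fin rank → Π y, E y →ₗ[ℂ] ℂ
  smooth_coef : ∀ a (u : Π y, E y), IsSmoothSection n F u →
    ContMDiffOn (𝓡 n) 𝓘(ℝ, ℂ) ∞ (fun y ↦ coef a y (u y)) dom
  sum_coef : ∀ y ∈ dom, ∀ e : E y, ∑ a, coef a y e • sec a y = e
  orthonormal : Orthonormal ℂ fun a ↦ sec a x₀

/-- An orthonormal basis of the fibre at `x₀` is continued as constant sections in the
trivialization, then made global by a cut-off. -/
lemma nonempty_bundlePatch (x₀ : N) : Nonempty (BundlePatch n F E x₀) := by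
  let e := trivializationAt F E x₀
  have hx₀ : x₀ ∈ e.baseSet := FiberBundle.mem_baseSet_trivializationAt' x₀
  have hbase : e.baseSet ∈ nhds x₀ := e.open_baseSet.mem_nhds hx₀
  let L : E x₀ ≃L[ℂ] F := e.continuousLinearEquivAt ℂ x₀ hx₀
  have : FiniteDimensional ℂ (E x₀) := L.symm.toLinearEquiv.finiteDimensional
  let b := stdOrthonormalBasis ℂ (E x₀)
  have ht : ∀ v : F, ContMDiffOn (𝓡 n) ((𝓡 n).prod 𝓘(ℝ, F)) ∞
      (fun y ↦ TotalSpace.mk' F y (e.symm y v)) e.baseSet := by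
    intro v
    have h := e.contMDiffOn_section_baseSet_iff (IB := 𝓡 n) (n := ∞) (s := fun y ↦ e.symm y v)
    refine h.2 ((contMDiffOn_const (c := v)).congr fun y hy ↦ ?_)
    exact congrArg Prod.snd (e.apply_mk_symm hy _)
  choose s hs hse using fun a ↦ exists_contMDiff_section_eventuallyEq (F := F) hbase _ (ht (L (b a)))
  obtain ⟨U, hU, hUo, hxU⟩ := eventually_nhds_iff.1
    ((show ∀ᶠ y in nhds x₀, y ∈ e.baseSet from hbase).and (Filter.eventually_all.2 hse))
  let coef : Fin (Module.finrank ℂ (E x₀)) → Π y, E y →ₗ[ℂ] ℂ := fun a y ↦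
    (b.toBasis.coord a).comp ((L.symm : F →ₗ[ℂ] E x₀).comp (e.linearMapAt ℂ y))
  have hcoef : ∀ a, ∀ y ∈ e.baseSet, ∀ w : E y,
      coef a y w = b.toBasis.coord a (L.symm (e ⟨y, w⟩).2) := by
    intro a y hy w
    simp only [coef, LinearMap.comp_apply, e.linearMapAt_apply, if_pos hy]
    rfl
  refine ⟨⟨_, U, hUo, hxU, s, hs, coef, ?_, ?_, ?_⟩⟩
  · intro a u hu
    let Λ : F →L[ℝ] ℂ := ((b.toBasis.coord a).toContinuousLinearMap.comp
      (L.symm : F →L[ℂ] E x₀)).restrictScalars ℝ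
    have h1 : ContMDiffOn (𝓡 n) 𝓘(ℝ, F) ∞ (fun y ↦ (e ⟨y, u y⟩).2) e.baseSet :=
      (e.contMDiffOn_section_baseSet_iff (IB := 𝓡 n) (n := ∞) (s := u)).1 hu.contMDiffOn
    refine ((Λ.contDiff.contMDiff.comp_contMDiffOn h1).mono fun y hy ↦ (hU y hy).1).congr ?_
    intro y hy
    exact hcoef a y (hU y hy).1 (u y)
  · intro y hy w
    obtain ⟨hyb, hys⟩ := hU y hy
    have h1 : ∀ v : F, e.symm y v = (e.continuousLinearEquivAt ℂ y hyb).symm v := fun v ↦ rfl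
    simp only [hys, hcoef _ y hyb, h1]
    simp only [← map_smul, ← map_sum]
    have h2 := b.toBasis.sum_repr (L.symm (e ⟨y, w⟩).2)
    simp only [Module.Basis.coord_apply]
    simp only [OrthonormalBasis.coe_toBasis] at h2
    rw [h2, L.apply_symm_apply]
    exact (e.continuousLinearEquivAt ℂ y hyb).symm_apply_apply w
  · have h1 : ∀ a, s a x₀ = b a := by
      intro a
      rw [(hU x₀ hxU).2 a]
      exact (e.continuousLinearEquivAt ℂ x₀ hx₀).symm_apply_apply (b a)
    simp only [h1]
    exact b.orthonormal

lemma IsSmoothSection.continuous_norm_sq {u : Π y, E y} (hu : IsSmoothSection n F u) :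
    Continuous fun y ↦ ‖u y‖ ^ 2 := by
  have h := Complex.continuous_re.comp (IsHermitianBundle.smooth_inner u u hu hu).continuous
  refine h.congr fun y ↦ ?_
  exact inner_self_eq_norm_sq (𝕜 := ℂ) (u y)

lemma norm_sum_smul_sq_le {ι : Type*} (t : Finset ι) {V : Type*} [NormedAddCommGroup V]
    [NormedSpace ℂ V] (w : ι → ℂ) (v : ι → V) :
    ‖∑ a ∈ t, w a • v a‖ ^ 2 ≤ (∑ a ∈ t, ‖v a‖ ^ 2) * ∑ a ∈ t, ‖w a‖ ^ 2 := by
  have h1 : ‖∑ a ∈ t, w a • v a‖ ≤ ∑ a ∈ t, ‖v a‖ * ‖w a‖ :=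
    (norm_sum_le _ _).trans (Finset.sum_le_sum fun a _ ↦ by rw [norm_smul, mul_comm])
  exact (pow_le_pow_left₀ (norm_nonneg _) h1 2).trans (Finset.sum_mul_sq_le_sq_mul_sq _ _ _)

namespace BundlePatch

variable {x₀ : N} (Q : BundlePatch n F E x₀)

/-- The vector with given coordinates in the frame. -/
def combine (y : N) : EuclideanSpace ℂ (Fin Q.rank) →ₗ[ℂ] E y where
  toFun w := ∑ a, w a • Q.sec a y
  map_add' w w' := by simp [add_smul, Finset.sum_add_distrib]
  map_smul' z w := by simp [mul_smul, Finset.smul_sum]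

lemma combine_apply (y : N) (w : EuclideanSpace ℂ (Fin Q.rank)) :
    Q.combine y w = ∑ a, w a • Q.sec a y := rfl

/-- The coordinates of a vector in the frame. -/
def coord (y : N) (e : E y) : EuclideanSpace ℂ (Fin Q.rank) :=
  WithLp.toLp 2 fun a ↦ Q.coef a y e

@[simp]
lemma coord_apply (y : N) (e : E y) (a : Fin Q.rank) : Q.coord y e a = Q.coef a y e := rfl

lemma combine_coord {y : N} (hy : y ∈ Q.dom) (e : E y) : Q.combine y (Q.coord y e) = e :=
  Q.sum_coef y hy e

lemma norm_combine_base (w : EuclideanSpace ℂ (Fin Q.rank)) : ‖Q.combine x₀ w‖ = ‖w‖ := by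
  have h : ‖Q.combine x₀ w‖ ^ 2 = ‖w‖ ^ 2 := by
    have h1 : ((‖Q.combine x₀ w‖ ^ 2 : ℝ) : ℂ) = ((‖w‖ ^ 2 : ℝ) : ℂ) := by
      rw [EuclideanSpace.norm_sq_eq]
      push_cast
      rw [← Complex.coe_algebraMap, ← inner_self_eq_norm_sq_to_K (𝕜 := ℂ), combine_apply,
        Q.orthonormal.inner_sum]
      exact Finset.sum_congr rfl fun a _ ↦ Complex.conj_mul' _
    exact_mod_cast h1
  exact (sq_eq_sq₀ (norm_nonneg _) (norm_nonneg _)).1 h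

/-- Near the base point the frame is almost orthonormal. -/
lemma eventually_norm_combine : ∀ᶠ y in nhds x₀, ∀ w : EuclideanSpace ℂ (Fin Q.rank),
    ‖w‖ ^ 2 ≤ 2 * ‖Q.combine y w‖ ^ 2 ∧ ‖Q.combine y w‖ ^ 2 ≤ 2 * ‖w‖ ^ 2 := by
  let G : N → Fin Q.rank → Fin Q.rank → ℂ := fun y a b ↦
    ⟪Q.sec a y, Q.sec b y⟫_ℂ - if a = b then 1 else 0
  have hGc : ∀ a b, Continuous fun y ↦ G y a b := fun a b ↦
    (IsHermitianBundle.smooth_inner _ _ (Q.smooth_sec a) (Q.smooth_sec b)).continuous.sub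
      continuous_const
  have hG0 : ∀ a b, G x₀ a b = 0 := fun a b ↦ by
    simp only [G, orthonormal_iff_ite.1 Q.orthonormal a b, sub_self]
  -- If the Gram matrix is entrywise this close to the identity, then Cauchy–Schwarz bounds the
  -- error in the squared norm by `‖w‖² / 2`. The `+ 1` covers rank zero.
  have hδ : (0 : ℝ) < 1 / (2 * (Q.rank + 1)) := by positivity
  have hev : ∀ᶠ y in nhds x₀, ∀ a b, ‖G y a b‖ < 1 / (2 * (Q.rank + 1)) := by
    refine Filter.eventually_all.2 fun a ↦ Filter.eventually_all.2 fun b ↦ ?_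
    have h1 := (hGc a b).norm.continuousAt (x := x₀)
    refine h1.eventually_lt continuousAt_const ?_
    rw [hG0, norm_zero]
    exact hδ
  filter_upwards [hev] with y hy w
  have h1 : ((‖Q.combine y w‖ ^ 2 - ‖w‖ ^ 2 : ℝ) : ℂ) =
      ∑ a, ∑ b, (starRingEnd ℂ) (w a) * (w b * G y a b) := by
    rw [EuclideanSpace.norm_sq_eq]
    push_cast
    rw [← Complex.coe_algebraMap, ← inner_self_eq_norm_sq_to_K (𝕜 := ℂ), combine_apply, sum_inner,
      ← Finset.sum_sub_distrib]
    refine Finset.sum_congr rfl fun a _ ↦ ?_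
    simp only [G, inner_sum, inner_smul_left, inner_smul_right, mul_sub, Finset.sum_sub_distrib]
    congr 1
    · exact Finset.sum_congr rfl fun b _ ↦ by ring
    · simp [Complex.conj_mul']
  have h2 : |‖Q.combine y w‖ ^ 2 - ‖w‖ ^ 2| ≤ (1 / (2 * (Q.rank + 1))) * (∑ a, ‖w a‖) ^ 2 := by
    rw [← Real.norm_eq_abs, ← Complex.norm_real, h1]
    have h3 : (∑ a, ‖w a‖) ^ 2 = ∑ a, ∑ b, ‖w a‖ * ‖w b‖ := by
      rw [sq, Finset.sum_mul_sum]
    rw [h3, Finset.mul_sum]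
    refine (norm_sum_le _ _).trans (Finset.sum_le_sum fun a _ ↦ ?_)
    rw [Finset.mul_sum]
    refine (norm_sum_le _ _).trans (Finset.sum_le_sum fun b _ ↦ ?_)
    rw [norm_mul, norm_mul, RCLike.norm_conj]
    calc ‖w a‖ * (‖w b‖ * ‖G y a b‖) = ‖G y a b‖ * (‖w a‖ * ‖w b‖) := by ring
      _ ≤ _ := mul_le_mul_of_nonneg_right (hy a b).le (by positivity)
  have h4 : (∑ a, ‖w a‖) ^ 2 ≤ Q.rank * ‖w‖ ^ 2 := by
    rw [EuclideanSpace.norm_sq_eq]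
    simpa using sq_sum_le_card_mul_sum_sq (s := Finset.univ) (f := fun a ↦ ‖w a‖)
  have h5 : (1 / (2 * (Q.rank + 1)) : ℝ) * (∑ a, ‖w a‖) ^ 2 ≤ ‖w‖ ^ 2 / 2 := by
    calc _ ≤ (1 / (2 * (Q.rank + 1)) : ℝ) * ((Q.rank + 1) * ‖w‖ ^ 2) := by
          refine mul_le_mul_of_nonneg_left (h4.trans ?_) hδ.le
          nlinarith [sq_nonneg ‖w‖]
      _ = _ := by field_simp
  have h6 := abs_le.1 (h2.trans h5)
  constructor <;> nlinarith [sq_nonneg ‖w‖]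

end BundlePatch

end BundleFrame

/-! ### Comparison of Riemannian and Lebesgue integrals. -/

section ChartIntegralBounds

variable {n : ℕ} {N : Type*} [EMetricSpace N] [ChartedSpace (EuclideanSpace ℝ (Fin n)) N]
  [IsManifold (𝓡 n) ∞ N] {x₀ : N} {K : Set N}

lemma continuous_chartRep {W : Type*} [NormedAddCommGroup W] [NormedSpace ℝ W] {f : N → W}
    (hf : ContinuousOn f (extChartAt (𝓡 n) x₀).source) (hKc : IsCompact K)
    (hKs : K ⊆ (extChartAt (𝓡 n) x₀).source) (hK : ∀ y ∉ K, f y = 0) :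
    Continuous (chartRep n x₀ f) := by
  rw [continuous_iff_continuousAt]
  intro z
  by_cases hz : z ∈ (extChartAt (𝓡 n) x₀).target
  · have h1 : ContinuousOn (f ∘ (extChartAt (𝓡 n) x₀).symm) (extChartAt (𝓡 n) x₀).target :=
      hf.comp (continuousOn_extChartAt_symm x₀) fun _ hw ↦ (extChartAt (𝓡 n) x₀).map_target hw
    have hn := (isOpen_extChartAt_target x₀).mem_nhds hz
    refine (h1.continuousAt hn).congr ?_
    filter_upwards [hn] with w hw using (chartRep_of_mem hw).symm
  · have hn : (extChartAt (𝓡 n) x₀ '' K)ᶜ ∈ nhds z := by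
      refine (isCompact_image_extChartAt hKc hKs).isClosed.isOpen_compl.mem_nhds fun h ↦ hz ?_
      obtain ⟨y, hy, rfl⟩ := h
      exact (extChartAt (𝓡 n) x₀).map_source (hKs hy)
    refine (continuousAt_const (y := (0 : W))).congr ?_
    filter_upwards [hn] with w hw using (chartRep_eq_zero hK hw).symm

variable [RiemannianBundle (fun y : N ↦ TangentSpace (𝓡 n) y)]
  [IsContMDiffRiemannianBundle (𝓡 n) ∞ (EuclideanSpace ℝ (Fin n))
    (fun y : N ↦ TangentSpace (𝓡 n) y)]
  [MeasurableSpace N] [BorelSpace N] {μ : Measure N}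

lemma CoordPatch.integral_bounds (P : CoordPatch n x₀) (hμ : IsRiemannianVolume (n := n) μ)
    {ρ₁ ρ₂ : ℝ} (hKc : IsCompact K) (hKs : K ⊆ (extChartAt (𝓡 n) x₀).source)
    (hρ : ∀ y ∈ K, ρ₁ ≤ P.density y ∧ P.density y ≤ ρ₂) {h : N → ℝ} (hh : Continuous h)
    (h0 : ∀ y, 0 ≤ h y) (hK : ∀ y ∉ K, h y = 0) :
    ρ₁ * ∫ z, chartRep n x₀ h z ≤ ∫ y, h y ∂μ ∧ ∫ y, h y ∂μ ≤ ρ₂ * ∫ z, chartRep n x₀ h z := by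
  have hi : Integrable (chartRep n x₀ h) :=
    (continuous_chartRep hh.continuousOn hKc hKs hK).integrable_of_hasCompactSupport
      (hasCompactSupport_chartRep hKc hKs hK)
  have hK2 : ∀ y ∉ K, P.density y • h y = 0 := fun y hy ↦ by rw [hK y hy, smul_zero]
  have hρc : ContinuousOn P.density (extChartAt (𝓡 n) x₀).source := by
    rw [extChartAt_source]
    exact P.contMDiffOn_density.continuousOn
  have hi2 : Integrable (chartRep n x₀ fun y ↦ P.density y • h y) :=
    (continuous_chartRep (hρc.smul hh.continuousOn) hKc hKs hK2).integrable_of_hasCompactSupport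
      (hasCompactSupport_chartRep hKc hKs hK2)
  rw [hμ.integral_eq P hh.aestronglyMeasurable fun y hy ↦ hK y fun h ↦ hy (hKs h),
    ← integral_const_mul, ← integral_const_mul]
  have key : ∀ z, ρ₁ * chartRep n x₀ h z ≤ chartRep n x₀ (fun y ↦ P.density y • h y) z ∧
      chartRep n x₀ (fun y ↦ P.density y • h y) z ≤ ρ₂ * chartRep n x₀ h z := by
    intro z
    by_cases hz : z ∈ extChartAt (𝓡 n) x₀ '' K
    · obtain ⟨y, hy, rfl⟩ := hz
      have hz := (extChartAt (𝓡 n) x₀).map_source (hKs hy)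
      rw [chartRep_of_mem hz, chartRep_of_mem hz, (extChartAt (𝓡 n) x₀).left_inv (hKs hy)]
      exact ⟨mul_le_mul_of_nonneg_right (hρ y hy).1 (h0 y),
        mul_le_mul_of_nonneg_right (hρ y hy).2 (h0 y)⟩
    · rw [chartRep_eq_zero hK hz, chartRep_eq_zero hK2 hz]
      simp
  exact ⟨integral_mono (hi.const_mul _) hi2 fun z ↦ (key z).1,
    integral_mono hi2 (hi.const_mul _) fun z ↦ (key z).2⟩

end ChartIntegralBounds

/-! ### The principal symbol and the operator with frozen coefficients. -/

section LocalEllipticEstimate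

variable {n : ℕ} {N : Type*} [EMetricSpace N] [ChartedSpace (EuclideanSpace ℝ (Fin n)) N]
  [IsManifold (𝓡 n) ∞ N]
  [RiemannianBundle (fun y : N ↦ TangentSpace (𝓡 n) y)]
  [IsContMDiffRiemannianBundle (𝓡 n) ∞ (EuclideanSpace ℝ (Fin n))
    (fun y : N ↦ TangentSpace (𝓡 n) y)]
  {F : Type*} [NormedAddCommGroup F] [NormedSpace ℂ F] [FiniteDimensional ℂ F]
  {E : N → Type*} [TopologicalSpace (TotalSpace F E)] [∀ y, NormedAddCommGroup (E y)]
  [∀ y, InnerProductSpace ℂ (E y)] [FiberBundle F E] [VectorBundle ℂ F E] [VectorBundle ℝ F E]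
  [ContMDiffVectorBundle ∞ F E (𝓡 n)] [IsHermitianBundle n F E]

namespace BundlePatch

variable {x₀ : N} (Q : BundlePatch n F E x₀) {K : Set N} {u : Π y, E y}

/-- The coefficient maps are smooth on the patch only, but `u` vanishes near every point outside it.
-/
lemma contMDiff_coef (hu : IsSmoothSection n F u) (hK : IsCompact K) (hKQ : K ⊆ Q.dom)
    (hKu : ∀ y ∉ K, u y = 0) (a : Fin Q.rank) :
    ContMDiff (𝓡 n) 𝓘(ℝ, ℂ) ∞ fun y ↦ Q.coef a y (u y) := by
  intro x
  by_cases hx : x ∈ Q.dom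
  · exact (Q.smooth_coef a u hu).contMDiffAt (Q.isOpen_dom.mem_nhds hx)
  · refine (contMDiffAt_const (c := (0 : ℂ))).congr_of_eventuallyEq ?_
    filter_upwards [hK.isClosed.isOpen_compl.mem_nhds fun h ↦ hx (hKQ h)] with y hy
    rw [hKu y hy, map_zero]

lemma contMDiff_coord (hu : IsSmoothSection n F u) (hK : IsCompact K) (hKQ : K ⊆ Q.dom)
    (hKu : ∀ y ∉ K, u y = 0) :
    ContMDiff (𝓡 n) 𝓘(ℝ, EuclideanSpace ℂ (Fin Q.rank)) ∞ fun y ↦ Q.coord y (u y) := by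
  have h : ContMDiff (𝓡 n) 𝓘(ℝ, Fin Q.rank → ℂ) ∞ fun y a ↦ Q.coef a y (u y) :=
    contMDiff_pi_space.2 fun a ↦ Q.contMDiff_coef hu hK hKQ hKu a
  exact ((PiLp.continuousLinearEquiv 2 ℝ (fun _ : Fin Q.rank ↦ ℂ)).symm.contDiff.contMDiff).comp h

lemma eq_sum_coef (hKQ : K ⊆ Q.dom) (hKu : ∀ y ∉ K, u y = 0) :
    u = ∑ a, fun y ↦ Q.coef a y (u y) • Q.sec a y := by
  funext y
  rw [Finset.sum_apply]
  by_cases hy : y ∈ K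
  · exact (Q.sum_coef y (hKQ hy) (u y)).symm
  · simp [hKu y hy]

lemma isSmoothSection_combine (w : EuclideanSpace ℂ (Fin Q.rank)) :
    IsSmoothSection n F fun y ↦ Q.combine y w := by
  have h : (fun y ↦ Q.combine y w) = ∑ a, w a • Q.sec a := by
    funext y
    rw [Finset.sum_apply]
    rfl
  rw [h]
  exact IsSmoothSection.sum fun a _ ↦ (Q.smooth_sec a).smul _

end BundlePatch

namespace CollarDiracBundle

variable (S : CollarDiracBundle n N F E) {x₀ : N} (P : CoordPatch n x₀) {u : Π y, E y}

lemma norm_c (y : N) (w : TangentSpace (𝓡 n) y) (e : E y) : ‖S.c y w e‖ = ‖w‖ * ‖e‖ := by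
  have h := S.c_skew y w e (S.c y w e)
  rw [S.c_sq, inner_smul_right, inner_self_eq_norm_sq_to_K, inner_self_eq_norm_sq_to_K] at h
  have h2 : ‖S.c y w e‖ ^ 2 = (‖w‖ * ‖e‖) ^ 2 := by
    rw [neg_mul, neg_neg] at h
    rw [mul_pow]
    simp only [Complex.coe_algebraMap] at h
    exact_mod_cast h
  exact (sq_eq_sq₀ (norm_nonneg _) (by positivity)).1 h2

/-- The coefficients of the first order part of the operator `𝒜`. -/
def symb (j : Fin n) (y : N) : E y →L[ℂ] E y := -(S.cτ y ∘L S.c y (P.coframe j y))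

lemma symb_apply (j : Fin n) (y : N) (e : E y) :
    S.symb P j y e = -S.cτ y (S.c y (P.coframe j y) e) := rfl

lemma isSmoothSection_symb (hu : IsSmoothSection n F u) (j : Fin n) :
    IsSmoothSection n F fun y ↦ S.symb P j y (u y) := by
  have h := (S.cτ_smooth _ (S.c_smooth _ _ (P.smooth_coframe j) hu)).smul (-1)
  convert h using 1
  funext y
  simp [symb_apply]

/-- Ellipticity: the symbol at a covector `ξ` is `-c(τ)c(ξ)`, and both Clifford factors are
isometric up to the length of `ξ`. -/
lemma norm_sum_smul_symb (ξ : EuclideanSpace ℝ (Fin n)) (y : N) (e : E y) :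
    ‖∑ j, (ξ j : ℂ) • S.symb P j y e‖ = ‖∑ j, ξ j • P.coframe j y‖ * ‖e‖ := by
  have h : ∑ j, (ξ j : ℂ) • S.symb P j y e =
      -S.cτ y (S.c y (∑ j, ξ j • P.coframe j y) e) := by
    simp only [map_sum, map_smul, _root_.sum_apply, _root_.smul_apply, symb_apply, smul_neg,
      Finset.sum_neg_distrib, Complex.coe_smul]
    refine congrArg _ (Finset.sum_congr rfl fun j _ ↦ ?_)
    rw [← Complex.coe_smul, ← Complex.coe_smul, map_smul]
  rw [h, norm_neg, S.norm_cτ, S.norm_c]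

lemma boundaryOp_complex_smul {y : N} (hy : y ∈ P.dom) {f : N → ℂ}
    (hf : ContMDiff (𝓡 n) 𝓘(ℝ, ℂ) ∞ f) (hu : IsSmoothSection n F u) :
    S.boundaryOp (fun x ↦ f x • u x) y = f y • S.boundaryOp u y +
      ∑ j, mvfderiv (𝓡 n) f y (P.frame j y) • S.symb P j y (u y) := by
  simp only [boundaryOp, S.tangentialDirac_complex_smul P hy hf hu, symb_apply, map_add, map_smul,
    map_sum, smul_neg, smul_add, Finset.sum_neg_distrib]
  abel

lemma boundaryOp_sum {ι : Type*} (t : Finset ι) {w : ι → Π y, E y}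
    (hw : ∀ i, IsSmoothSection n F (w i)) (y : N) :
    S.boundaryOp (∑ i ∈ t, w i) y = ∑ i ∈ t, S.boundaryOp (w i) y := by
  simp only [boundaryOp, S.tangentialDirac_sum t hw, Finset.sum_apply, map_sum, map_add,
    Finset.sum_neg_distrib, Finset.sum_add_distrib]

variable (Q : BundlePatch n F E x₀) {K : Set N}

/-- The first order part of `𝒜` at the base point, in the frame. -/
def frozenSymb (j : Fin n) : EuclideanSpace ℂ (Fin Q.rank) →L[ℂ] EuclideanSpace ℂ (Fin Q.rank) :=
  ∑ a, (EuclideanSpace.proj a).smulRight (Q.coord x₀ (S.symb P j x₀ (Q.sec a x₀)))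

lemma frozenSymb_apply (j : Fin n) (w : EuclideanSpace ℂ (Fin Q.rank)) :
    S.frozenSymb P Q j w = ∑ a, w a • Q.coord x₀ (S.symb P j x₀ (Q.sec a x₀)) := by
  simp [frozenSymb, _root_.sum_apply]

lemma combine_frozenSymb (j : Fin n) (w : EuclideanSpace ℂ (Fin Q.rank)) :
    Q.combine x₀ (S.frozenSymb P Q j w) = S.symb P j x₀ (Q.combine x₀ w) := by
  rw [frozenSymb_apply, map_sum, Q.combine_apply, map_sum]
  refine Finset.sum_congr rfl fun a _ ↦ ?_
  rw [map_smul, map_smul, Q.combine_coord Q.mem_dom]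

/-- Because the frame is orthonormal at the base point, the frozen symbol scales norms by the
Riemannian length of `ξ`; this length dominates a multiple of the Euclidean one, since `ξᵢ` is the
pairing with the `i`-th coordinate field. -/
lemma exists_frozenSymb_bound : ∃ c : ℝ, 0 < c ∧ ∀ (ξ : EuclideanSpace ℝ (Fin n))
    (w : EuclideanSpace ℂ (Fin Q.rank)),
      c * (‖ξ‖ * ‖w‖) ≤ ‖∑ j, (ξ j : ℂ) • S.frozenSymb P Q j w‖ := by
  -- Below `M + 1` is used so that the divisor is positive also when `n = 0`.
  let M : ℝ := ∑ i, ‖P.frame i x₀‖ ^ 2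
  have hM : 0 ≤ M := Finset.sum_nonneg fun _ _ ↦ sq_nonneg _
  refine ⟨1 / √(M + 1), by positivity, fun ξ w ↦ ?_⟩
  have h1 : ‖∑ j, (ξ j : ℂ) • S.frozenSymb P Q j w‖ = ‖∑ j, ξ j • P.coframe j x₀‖ * ‖w‖ := by
    rw [← Q.norm_combine_base, map_sum]
    simp only [map_smul, S.combine_frozenSymb]
    rw [S.norm_sum_smul_symb, Q.norm_combine_base]
  have h2 : ‖ξ‖ ^ 2 ≤ (M + 1) * ‖∑ j, ξ j • P.coframe j x₀‖ ^ 2 := by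
    have h3 : ∀ i, ξ i = ⟪P.frame i x₀, ∑ j, ξ j • P.coframe j x₀⟫_ℝ := by
      intro i
      rw [inner_sum]
      simp [inner_smul_right, P.dual x₀ P.mem_dom]
    rw [EuclideanSpace.real_norm_sq_eq]
    calc ∑ i, ξ i ^ 2 ≤ ∑ i, ‖P.frame i x₀‖ ^ 2 * ‖∑ j, ξ j • P.coframe j x₀‖ ^ 2 := by
          refine Finset.sum_le_sum fun i _ ↦ ?_
          rw [← mul_pow]
          conv_lhs => rw [h3 i]
          rw [← sq_abs]
          exact pow_le_pow_left₀ (abs_nonneg _) (abs_real_inner_le_norm _ _) 2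
      _ = M * ‖∑ j, ξ j • P.coframe j x₀‖ ^ 2 := (Finset.sum_mul _ _ _).symm
      _ ≤ _ := mul_le_mul_of_nonneg_right (by linarith) (sq_nonneg _)
  have h4 : ‖ξ‖ ≤ √(M + 1) * ‖∑ j, ξ j • P.coframe j x₀‖ := by
    refine le_of_sq_le_sq ?_ (by positivity)
    rw [mul_pow, Real.sq_sqrt (by positivity)]
    exact h2
  rw [h1, ← mul_assoc]
  refine mul_le_mul_of_nonneg_right ?_ (norm_nonneg _)
  rw [one_div, inv_mul_le_iff₀ (by positivity)]
  exact h4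

/-- The variation of the first order part of `𝒜` with respect to the base point. -/
def symbError (p : Fin n × Fin Q.rank) (y : N) : E y :=
  S.symb P p.1 y (Q.sec p.2 y) - Q.combine y (Q.coord x₀ (S.symb P p.1 x₀ (Q.sec p.2 x₀)))

lemma isSmoothSection_symbError (p : Fin n × Fin Q.rank) :
    IsSmoothSection n F (S.symbError P Q p) := by
  have h := (S.isSmoothSection_symb P (Q.smooth_sec p.2) p.1).add
    ((Q.isSmoothSection_combine (Q.coord x₀ (S.symb P p.1 x₀ (Q.sec p.2 x₀)))).smul (-1))
  convert h using 1
  funext y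
  simp [symbError, sub_eq_add_neg]

lemma symbError_base (p : Fin n × Fin Q.rank) : S.symbError P Q p x₀ = 0 := by
  rw [symbError, Q.combine_coord Q.mem_dom, sub_self]

/-- The decomposition of `𝒜 u` into the operator frozen at the base point and error terms. -/
lemma combine_frozen_eq (hu : IsSmoothSection n F u) (hK : IsCompact K) (hKQ : K ⊆ Q.dom)
    (hKu : ∀ y ∉ K, u y = 0) {y : N} (hy : y ∈ P.dom)
    (d : Fin n → EuclideanSpace ℂ (Fin Q.rank))
    (hd : ∀ j, d j = mvfderiv (𝓡 n) (fun x ↦ Q.coord x (u x)) y (P.frame j y)) :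
    Q.combine y (∑ j, S.frozenSymb P Q j (d j)) =
      S.boundaryOp u y - ∑ a, Q.coord y (u y) a • S.boundaryOp (Q.sec a) y -
        ∑ p : Fin n × Fin Q.rank, d p.1 p.2 • S.symbError P Q p y := by
  have hf := Q.contMDiff_coef hu hK hKQ hKu
  have hd2 : ∀ j a, mvfderiv (𝓡 n) (fun x ↦ Q.coef a x (u x)) y (P.frame j y) = d j a := by
    intro j a
    rw [hd]
    exact mvfderiv_clm_comp ((EuclideanSpace.proj (𝕜 := ℂ) a).restrictScalars ℝ)
      ((Q.contMDiff_coord hu hK hKQ hKu y).mdifferentiableAt (by simp)) (P.frame j y)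
  have h1 : S.boundaryOp u y = ∑ a, (Q.coef a y (u y) • S.boundaryOp (Q.sec a) y +
      ∑ j, d j a • S.symb P j y (Q.sec a y)) := by
    conv_lhs => rw [Q.eq_sum_coef hKQ hKu]
    rw [S.boundaryOp_sum _ fun a ↦ (Q.smooth_sec a).complex_smul (hf a)]
    refine Finset.sum_congr rfl fun a _ ↦ ?_
    rw [S.boundaryOp_complex_smul P hy (hf a) (Q.smooth_sec a)]
    simp only [hd2]
  have h2 : ∑ p : Fin n × Fin Q.rank, d p.1 p.2 • S.symbError P Q p y =
      (∑ a, ∑ j, d j a • S.symb P j y (Q.sec a y)) -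
        Q.combine y (∑ j, S.frozenSymb P Q j (d j)) := by
    rw [Fintype.sum_prod_type, Finset.sum_comm (s := Finset.univ (α := Fin Q.rank)), map_sum,
      ← Finset.sum_sub_distrib]
    refine Finset.sum_congr rfl fun j _ ↦ ?_
    rw [S.frozenSymb_apply, map_sum, ← Finset.sum_sub_distrib]
    refine Finset.sum_congr rfl fun a _ ↦ ?_
    rw [symbError, smul_sub, map_smul]
  rw [h2, h1, Finset.sum_add_distrib]
  simp only [Q.coord_apply]
  abel

end CollarDiracBundle

end LocalEllipticEstimate

/-! ### The local elliptic estimate. -/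

section LocalGarding

variable {n : ℕ} {N : Type*} [EMetricSpace N] [ChartedSpace (EuclideanSpace ℝ (Fin n)) N]
  [IsManifold (𝓡 n) ∞ N]
  [RiemannianBundle (fun y : N ↦ TangentSpace (𝓡 n) y)]
  [IsContMDiffRiemannianBundle (𝓡 n) ∞ (EuclideanSpace ℝ (Fin n))
    (fun y : N ↦ TangentSpace (𝓡 n) y)]
  {F : Type*} [NormedAddCommGroup F] [NormedSpace ℂ F] [FiniteDimensional ℂ F]
  {E : N → Type*} [TopologicalSpace (TotalSpace F E)] [∀ y, NormedAddCommGroup (E y)]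
  [∀ y, InnerProductSpace ℂ (E y)] [FiberBundle F E] [VectorBundle ℂ F E] [VectorBundle ℝ F E]
  [ContMDiffVectorBundle ∞ F E (𝓡 n)] [IsHermitianBundle n F E]

lemma norm_sub_sub_sq_le {V : Type*} [NormedAddCommGroup V] (x y z : V) :
    ‖x - y - z‖ ^ 2 ≤ 3 * (‖x‖ ^ 2 + ‖y‖ ^ 2 + ‖z‖ ^ 2) := by
  have h : ‖x - y - z‖ ≤ ‖x‖ + ‖y‖ + ‖z‖ :=
    (norm_sub_le _ _).trans (add_le_add_left (norm_sub_le _ _) _)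
  nlinarith [pow_le_pow_left₀ (norm_nonneg _) h 2, sq_nonneg (‖x‖ - ‖y‖), sq_nonneg (‖x‖ - ‖z‖),
    sq_nonneg (‖y‖ - ‖z‖)]

lemma eventually_sum_norm_sq_lt {ι : Type*} [Fintype ι] {v : ι → Π y, E y}
    (hv : ∀ i, IsSmoothSection n F (v i)) {x₀ : N} {b : ℝ} (hb : ∑ i, ‖v i x₀‖ ^ 2 < b) :
    ∀ᶠ y in nhds x₀, ∑ i, ‖v i y‖ ^ 2 < b :=
  (continuous_finsetSum _ fun i _ ↦ (hv i).continuous_norm_sq).continuousAt.eventually_lt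
    continuousAt_const hb

namespace CollarDiracBundle

variable (S : CollarDiracBundle n N F E) {x₀ : N} (P : CoordPatch n x₀) (Q : BundlePatch n F E x₀)

/-- The conditions, on a neighbourhood of the base point, under which `𝒜` is well approximated by
the operator frozen there. -/
structure IsGoodPoint (C η : ℝ) (y : N) : Prop where
  mem_coord : y ∈ P.dom
  mem_bundle : y ∈ Q.dom
  norm_combine : ∀ w : EuclideanSpace ℂ (Fin Q.rank),
    ‖w‖ ^ 2 ≤ 2 * ‖Q.combine y w‖ ^ 2 ∧ ‖Q.combine y w‖ ^ 2 ≤ 2 * ‖w‖ ^ 2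
  bound : ∑ a, ‖S.boundaryOp (Q.sec a) y‖ ^ 2 < C
  small : ∑ p, ‖S.symbError P Q p y‖ ^ 2 < η
  density : P.density x₀ / 2 < P.density y ∧ P.density y < 2 * P.density x₀

/-- All conditions are open. The variation of the symbol vanishes at the base point, so `η` may be
arbitrarily small. -/
lemma eventually_isGoodPoint {η : ℝ} (hη : 0 < η) :
    ∃ C, 0 ≤ C ∧ ∀ᶠ y in nhds x₀, S.IsGoodPoint P Q C η y := by
  have hC : 0 ≤ ∑ a, ‖S.boundaryOp (Q.sec a) x₀‖ ^ 2 := Finset.sum_nonneg fun _ _ ↦ sq_nonneg _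
  refine ⟨(∑ a, ‖S.boundaryOp (Q.sec a) x₀‖ ^ 2) + 1, by linarith, ?_⟩
  have hρ := P.density_pos P.mem_dom
  have hρc : ContinuousAt P.density x₀ := P.contMDiffOn_density.continuousOn.continuousAt
    ((chartAt (EuclideanSpace ℝ (Fin n)) x₀).open_source.mem_nhds (P.subset_source P.mem_dom))
  filter_upwards [P.isOpen_dom.mem_nhds P.mem_dom, Q.isOpen_dom.mem_nhds Q.mem_dom,
    Q.eventually_norm_combine,
    eventually_sum_norm_sq_lt (fun a ↦ S.isSmoothSection_boundaryOp (Q.smooth_sec a))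
      (lt_add_one (∑ a, ‖S.boundaryOp (Q.sec a) x₀‖ ^ 2)),
    eventually_sum_norm_sq_lt (S.isSmoothSection_symbError P Q) (x₀ := x₀) (b := η)
      (by simpa [S.symbError_base P Q] using hη),
    continuousAt_const.eventually_lt hρc (half_lt_self hρ),
    hρc.eventually_lt continuousAt_const (by linarith : P.density x₀ < 2 * P.density x₀)]
    with y h1 h2 h3 h4 h5 h6 h7 using ⟨h1, h2, h3, h4, h5, h6, h7⟩

variable {P Q} {C η : ℝ} {u : Π y, E y} {K : Set N}

lemma IsGoodPoint.norm_coord {y : N} (h : S.IsGoodPoint P Q C η y) (e : E y) :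
    ‖Q.coord y e‖ ^ 2 ≤ 2 * ‖e‖ ^ 2 ∧ ‖e‖ ^ 2 ≤ 2 * ‖Q.coord y e‖ ^ 2 := by
  have h1 := h.norm_combine (Q.coord y e)
  rwa [Q.combine_coord h.mem_bundle] at h1

/-- The factor `6` is `2` for passing from coordinates to the fibre, times `3` for squaring a sum of
three terms. -/
lemma norm_frozen_sq_le (hu : IsSmoothSection n F u) (hK : IsCompact K) (hKQ : K ⊆ Q.dom)
    (hKu : ∀ y ∉ K, u y = 0) {y : N} (hy : S.IsGoodPoint P Q C η y)
    (d : Fin n → EuclideanSpace ℂ (Fin Q.rank))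
    (hd : ∀ j, d j = mvfderiv (𝓡 n) (fun x ↦ Q.coord x (u x)) y (P.frame j y)) :
    ‖∑ j, S.frozenSymb P Q j (d j)‖ ^ 2 ≤
      6 * (‖S.boundaryOp u y‖ ^ 2 + C * ‖Q.coord y (u y)‖ ^ 2 + η * ∑ j, ‖d j‖ ^ 2) := by
  have h1 := (hy.norm_combine (∑ j, S.frozenSymb P Q j (d j))).1
  rw [S.combine_frozen_eq P Q hu hK hKQ hKu hy.mem_coord d hd] at h1
  have h2 := norm_sub_sub_sq_le (S.boundaryOp u y)
    (∑ a, Q.coord y (u y) a • S.boundaryOp (Q.sec a) y)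
    (∑ p : Fin n × Fin Q.rank, d p.1 p.2 • S.symbError P Q p y)
  have h3 : ‖∑ a, Q.coord y (u y) a • S.boundaryOp (Q.sec a) y‖ ^ 2 ≤
      C * ‖Q.coord y (u y)‖ ^ 2 := by
    refine (norm_sum_smul_sq_le _ _ _).trans ?_
    rw [← EuclideanSpace.norm_sq_eq]
    exact mul_le_mul_of_nonneg_right hy.bound.le (sq_nonneg _)
  have h4 : ‖∑ p : Fin n × Fin Q.rank, d p.1 p.2 • S.symbError P Q p y‖ ^ 2 ≤
      η * ∑ j, ‖d j‖ ^ 2 := by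
    refine (norm_sum_smul_sq_le _ _ _).trans ?_
    have h5 : ∑ p : Fin n × Fin Q.rank, ‖d p.1 p.2‖ ^ 2 = ∑ j, ‖d j‖ ^ 2 := by
      rw [Fintype.sum_prod_type]
      exact Finset.sum_congr rfl fun j _ ↦ (EuclideanSpace.norm_sq_eq (d j)).symm
    rw [h5]
    exact mul_le_mul_of_nonneg_right hy.small.le (Finset.sum_nonneg fun _ _ ↦ sq_nonneg _)
  linarith

/-- A section read in the chart and in the frame. -/
def localRep (Q : BundlePatch n F E x₀) (u : Π y, E y) :
    EuclideanSpace ℝ (Fin n) → EuclideanSpace ℂ (Fin Q.rank) :=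
  chartRep n x₀ fun y ↦ Q.coord y (u y)

lemma contDiff_localRep (hu : IsSmoothSection n F u) (hK : IsCompact K) (hKQ : K ⊆ Q.dom)
    (hKs : K ⊆ (extChartAt (𝓡 n) x₀).source) (hKu : ∀ y ∉ K, u y = 0) :
    ContDiff ℝ ∞ (localRep Q u) :=
  contDiff_chartRep (Q.contMDiff_coord hu hK hKQ hKu).contMDiffOn hK hKs fun y hy ↦ by
    rw [hKu y hy]
    ext a
    simp

lemma localRep_eq_zero (hKu : ∀ y ∉ K, u y = 0) {z : EuclideanSpace ℝ (Fin n)}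
    (hz : z ∉ extChartAt (𝓡 n) x₀ '' K) : localRep Q u z = 0 :=
  chartRep_eq_zero (fun y hy ↦ by
    rw [hKu y hy]
    ext a
    simp) hz

lemma norm_frozen_localRep_sq_le (hu : IsSmoothSection n F u) (hK : IsCompact K)
    (hKg : ∀ y ∈ K, S.IsGoodPoint P Q C η y) (hC : 0 ≤ C) (hη : 0 ≤ η) (hKu : ∀ y ∉ K, u y = 0)
    (z : EuclideanSpace ℝ (Fin n)) :
    ‖∑ j, S.frozenSymb P Q j (fderiv ℝ (localRep Q u) z (EuclideanSpace.single j 1))‖ ^ 2 ≤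
      6 * (chartRep n x₀ (fun y ↦ ‖S.boundaryOp u y‖ ^ 2) z + C * ‖localRep Q u z‖ ^ 2 +
        η * gradSq (localRep Q u) z) := by
  have hKQ : K ⊆ Q.dom := fun y hy ↦ (hKg y hy).mem_bundle
  have hKs : K ⊆ (extChartAt (𝓡 n) x₀).source := by
    rw [extChartAt_source]
    exact fun y hy ↦ P.subset_source (hKg y hy).mem_coord
  by_cases hz : z ∈ extChartAt (𝓡 n) x₀ '' K
  · obtain ⟨y, hy, rfl⟩ := hz
    have hz := (extChartAt (𝓡 n) x₀).map_source (hKs hy)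
    have hd : ∀ j, fderiv ℝ (localRep Q u) (extChartAt (𝓡 n) x₀ y) (EuclideanSpace.single j 1) =
        mvfderiv (𝓡 n) (fun x ↦ Q.coord x (u x)) y (P.frame j y) := by
      intro j
      rw [localRep, fderiv_chartRep (Q.contMDiff_coord hu hK hKQ hKu).contMDiffOn hz,
        (extChartAt (𝓡 n) x₀).left_inv (hKs hy), P.frame_eq y (hKg y hy).mem_coord]
    have h := S.norm_frozen_sq_le hu hK hKQ hKu (hKg y hy) _ hd
    rw [chartRep_of_mem hz, localRep, chartRep_of_mem hz, (extChartAt (𝓡 n) x₀).left_inv (hKs hy)]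
    exact h
  · have h1 : localRep Q u =ᶠ[nhds z] fun _ ↦ 0 := by
      filter_upwards [(isCompact_image_extChartAt hK hKs).isClosed.isOpen_compl.mem_nhds hz]
        with w hw using localRep_eq_zero hKu hw
    have h2 : 0 ≤ chartRep n x₀ (fun y ↦ ‖S.boundaryOp u y‖ ^ 2) z := by
      rw [chartRep]
      split_ifs <;> positivity
    have h3 := gradSq_nonneg (localRep Q u) z
    have h4 : ∑ j, S.frozenSymb P Q j (fderiv ℝ (localRep Q u) z (EuclideanSpace.single j 1)) =
        0 := by
      rw [h1.fderiv_eq]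
      simp
    rw [h4, norm_zero, zero_pow two_ne_zero]
    have h5 : 0 ≤ C * ‖localRep Q u z‖ ^ 2 := by positivity
    linarith [mul_nonneg hη h3]

variable [MeasurableSpace N] [BorelSpace N] {μ : Measure N}

/-- The elliptic estimate for sections supported near a point. -/
lemma exists_elliptic_estimate (hμ : IsRiemannianVolume (n := n) μ) (x₀ : N) :
    ∃ (Q : BundlePatch n F E x₀) (U : Set N) (C : ℝ), IsOpen U ∧ x₀ ∈ U ∧ U ⊆ Q.dom ∧
      U ⊆ (extChartAt (𝓡 n) x₀).source ∧ 0 ≤ C ∧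
      (∀ y ∈ U, ∀ e : E y, ‖Q.coord y e‖ ^ 2 ≤ 2 * ‖e‖ ^ 2) ∧
      ∀ (u : Π y, E y) (K : Set N), IsSmoothSection n F u → IsCompact K → K ⊆ U →
        (∀ y ∉ K, u y = 0) →
        (∫ z, gradSq (localRep Q u) z) + ∫ z, ‖localRep Q u z‖ ^ 2 ≤
          C * ((∫ y, ‖S.boundaryOp u y‖ ^ 2 ∂μ) + ∫ y, ‖u y‖ ^ 2 ∂μ) ∧
        ∫ y, ‖u y‖ ^ 2 ∂μ ≤ C * ∫ z, ‖localRep Q u z‖ ^ 2 ∧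
        ∫ z, ‖localRep Q u z‖ ^ 2 ≤ C * ∫ y, ‖u y‖ ^ 2 ∂μ := by
  obtain ⟨P⟩ := nonempty_coordPatch (n := n) x₀
  obtain ⟨Q⟩ := nonempty_bundlePatch (n := n) (F := F) (E := E) x₀
  obtain ⟨c, hc, hγ⟩ := S.exists_frozenSymb_bound P Q
  -- With this `η` the error `6η∫|∇f|²` is half of the left side `c²∫|∇f|²` of Gårding's inequality
  -- and can be absorbed; what remains is divided by `c² / 2`, whence the constant `12 / c²`.
  have hη : 0 < c ^ 2 / 12 := by positivity
  obtain ⟨B, hB, hev⟩ := S.eventually_isGoodPoint P Q hη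
  obtain ⟨U, hU, hUo, hxU⟩ := eventually_nhds_iff.1 hev
  have hρ := P.density_pos P.mem_dom
  set ρ := P.density x₀ with hρdef
  have hUs : U ⊆ (extChartAt (𝓡 n) x₀).source := by
    rw [extChartAt_source]
    exact fun y hy ↦ P.subset_source (hU y hy).mem_coord
  -- `4 / ρ` combines `2` from the frame with `2 / ρ` from the density. Adding `4 * ρ` below makes
  -- one constant serve all three estimates.
  let C₀ : ℝ := (12 / c ^ 2 * (1 + B) + 1) * (4 / ρ + 1)
  have hC₀ : 0 ≤ C₀ := by positivity
  refine ⟨Q, U, C₀ + 4 * ρ, hUo, hxU, fun y hy ↦ (hU y hy).mem_bundle, hUs, by positivity,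
    fun y hy e ↦ ((hU y hy).norm_coord S e).1, fun u K hu hK hKU hKu ↦ ?_⟩
  have hKg : ∀ y ∈ K, S.IsGoodPoint P Q B (c ^ 2 / 12) y := fun y hy ↦ hU y (hKU hy)
  have hKQ : K ⊆ Q.dom := fun y hy ↦ (hKg y hy).mem_bundle
  have hKs := hKU.trans hUs
  let f := localRep Q u
  have hf : ContDiff ℝ ∞ f := contDiff_localRep hu hK hKQ hKs hKu
  have hfc : HasCompactSupport f :=
    HasCompactSupport.intro (isCompact_image_extChartAt hK hKs) fun z hz ↦ localRep_eq_zero hKu hz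
  have hAc : Continuous fun y ↦ ‖S.boundaryOp u y‖ ^ 2 :=
    (S.isSmoothSection_boundaryOp hu).continuous_norm_sq
  have hA0 : ∀ y ∉ K, ‖S.boundaryOp u y‖ ^ 2 = 0 := by
    intro y hy
    have h1 : S.tangentialDirac u y = 0 := S.tangentialDirac_eq_zero hu <| by
      filter_upwards [hK.isClosed.isOpen_compl.mem_nhds hy] with x hx using hKu x hx
    rw [boundaryOp, h1, hKu y hy]
    simp
  have hu0 : ∀ y ∉ K, ‖u y‖ ^ 2 = 0 := fun y hy ↦ by simp [hKu y hy]
  have hdens : ∀ y ∈ K, ρ / 2 ≤ P.density y ∧ P.density y ≤ 2 * ρ := fun y hy ↦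
    ⟨(hKg y hy).density.1.le, (hKg y hy).density.2.le⟩
  have bA := (P.integral_bounds hμ hK hKs hdens hAc (fun _ ↦ sq_nonneg _) hA0).1
  have bu := P.integral_bounds hμ hK hKs hdens hu.continuous_norm_sq (fun _ ↦ sq_nonneg _) hu0
  have iA : Integrable (chartRep n x₀ fun y ↦ ‖S.boundaryOp u y‖ ^ 2) :=
    (continuous_chartRep hAc.continuousOn hK hKs hA0).integrable_of_hasCompactSupport
      (hasCompactSupport_chartRep hK hKs hA0)
  have iu : Integrable (chartRep n x₀ fun y ↦ ‖u y‖ ^ 2) :=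
    (continuous_chartRep hu.continuous_norm_sq.continuousOn hK hKs hu0).integrable_of_hasCompactSupport
      (hasCompactSupport_chartRep hK hKs hu0)
  have i_f : Integrable fun z ↦ ‖f z‖ ^ 2 :=
    integrable_norm_sq_schwartz (hfc.toSchwartzMap hf)
  have i_g : Integrable (gradSq f) :=
    integrable_finsetSum _ fun j _ ↦ integrable_norm_sq_schwartz (LineDeriv.lineDerivOp
      (EuclideanSpace.single j 1 : EuclideanSpace ℝ (Fin n)) (hfc.toSchwartzMap hf))
  have hcmp : ∀ z, ‖f z‖ ^ 2 ≤ 2 * chartRep n x₀ (fun y ↦ ‖u y‖ ^ 2) z ∧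
      chartRep n x₀ (fun y ↦ ‖u y‖ ^ 2) z ≤ 2 * ‖f z‖ ^ 2 := by
    intro z
    by_cases hz : z ∈ extChartAt (𝓡 n) x₀ '' K
    · obtain ⟨y, hy, rfl⟩ := hz
      have hz := (extChartAt (𝓡 n) x₀).map_source (hKs hy)
      simp only [f, localRep]
      rw [chartRep_of_mem hz, chartRep_of_mem hz, (extChartAt (𝓡 n) x₀).left_inv (hKs hy)]
      exact (hKg y hy).norm_coord S (u y)
    · rw [show f z = 0 from localRep_eq_zero hKu hz, chartRep_eq_zero hu0 hz]
      simp
  have c1 : ∫ z, ‖f z‖ ^ 2 ≤ 2 * ∫ z, chartRep n x₀ (fun y ↦ ‖u y‖ ^ 2) z := by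
    rw [← integral_const_mul]
    exact integral_mono i_f (iu.const_mul _) fun z ↦ (hcmp z).1
  have c2 : ∫ z, chartRep n x₀ (fun y ↦ ‖u y‖ ^ 2) z ≤ 2 * ∫ z, ‖f z‖ ^ 2 := by
    rw [← integral_const_mul]
    exact integral_mono iu (i_f.const_mul _) fun z ↦ (hcmp z).2
  have hgar := sq_mul_integral_gradSq_le hc.le hγ hf hfc
  have hup : ∫ z, ‖∑ j, S.frozenSymb P Q j (fderiv ℝ f z (EuclideanSpace.single j 1))‖ ^ 2 ≤
      6 * ((∫ z, chartRep n x₀ (fun y ↦ ‖S.boundaryOp u y‖ ^ 2) z) + B * (∫ z, ‖f z‖ ^ 2) +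
        c ^ 2 / 12 * ∫ z, gradSq f z) := by
    have i1 : Integrable fun z ↦ chartRep n x₀ (fun y ↦ ‖S.boundaryOp u y‖ ^ 2) z +
        B * ‖f z‖ ^ 2 := iA.add (i_f.const_mul _)
    rw [← integral_const_mul, ← integral_const_mul, ← integral_add iA (i_f.const_mul _),
      ← integral_add i1 (i_g.const_mul _), ← integral_const_mul]
    refine integral_mono_of_nonneg (.of_forall fun _ ↦ sq_nonneg _)
      ((i1.add (i_g.const_mul _)).const_mul _) (.of_forall fun z ↦ ?_)
    exact S.norm_frozen_localRep_sq_le hu hK hKg hB hη.le hKu z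
  set a := ∫ z, chartRep n x₀ (fun y ↦ ‖S.boundaryOp u y‖ ^ 2) z
  set b := ∫ z, chartRep n x₀ (fun y ↦ ‖u y‖ ^ 2) z
  set X := ∫ y, ‖S.boundaryOp u y‖ ^ 2 ∂μ
  set Y := ∫ y, ‖u y‖ ^ 2 ∂μ
  have hX : 0 ≤ X := integral_nonneg fun _ ↦ sq_nonneg _
  have hY : 0 ≤ Y := integral_nonneg fun _ ↦ sq_nonneg _
  have hg : ∫ z, gradSq f z ≤ 12 / c ^ 2 * (a + B * ∫ z, ‖f z‖ ^ 2) := by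
    rw [div_mul_eq_mul_div, le_div_iff₀ (by positivity)]
    linarith [hgar.trans hup]
  have ha : a ≤ 4 / ρ * X := by
    rw [div_mul_eq_mul_div, le_div_iff₀ hρ]
    nlinarith
  have hb : ∫ z, ‖f z‖ ^ 2 ≤ 4 / ρ * Y := by
    rw [div_mul_eq_mul_div, le_div_iff₀ hρ]
    nlinarith [bu.1]
  have hf0 : 0 ≤ ∫ z, ‖f z‖ ^ 2 := integral_nonneg fun _ ↦ sq_nonneg _
  have hκ : 0 ≤ 4 / ρ := by positivity
  have hm : 0 ≤ 12 / c ^ 2 := by positivity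
  have hfin : (∫ z, gradSq f z) + ∫ z, ‖f z‖ ^ 2 ≤ C₀ * (X + Y) := by
    have e1 : (∫ z, gradSq f z) + ∫ z, ‖f z‖ ^ 2 ≤
        12 / c ^ 2 * (4 / ρ * X + B * (4 / ρ * Y)) + 4 / ρ * Y := by
      refine add_le_add (hg.trans (mul_le_mul_of_nonneg_left ?_ hm)) hb
      exact add_le_add ha (mul_le_mul_of_nonneg_left hb hB)
    refine e1.trans ?_
    have e2 : C₀ * (X + Y) - (12 / c ^ 2 * (4 / ρ * X + B * (4 / ρ * Y)) + 4 / ρ * Y) =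
        12 / c ^ 2 * (4 / ρ) * (Y + B * X) + 4 / ρ * X +
          (12 / c ^ 2 * (1 + B) + 1) * (X + Y) := by
      simp only [C₀]
      ring
    have e3 : 0 ≤ 12 / c ^ 2 * (4 / ρ) * (Y + B * X) + 4 / ρ * X +
          (12 / c ^ 2 * (1 + B) + 1) * (X + Y) := by positivity
    linarith
  refine ⟨hfin.trans (mul_le_mul_of_nonneg_right (by linarith) (by positivity)), ?_, ?_⟩
  · have e1 : Y ≤ 2 * ρ * (2 * ∫ z, ‖f z‖ ^ 2) := bu.2.trans (by gcongr)
    calc Y ≤ 4 * ρ * ∫ z, ‖f z‖ ^ 2 := by linarith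
      _ ≤ _ := mul_le_mul_of_nonneg_right (by linarith) hf0
  · refine hb.trans (mul_le_mul_of_nonneg_right ?_ hY)
    have e1 : 4 / ρ + 1 ≤ C₀ := le_mul_of_one_le_left (by positivity)
      (by linarith [mul_nonneg hm (by linarith : 0 ≤ 1 + B)])
    linarith

end CollarDiracBundle

end LocalGarding

/-! ### Relatively compact forms and finite-dimensional kernels. -/

section RelativeCompactness

variable {V : Type*} [SeminormedAddCommGroup V] [NormedSpace ℂ V] {A : V →ₗ[ℂ] V}

/-- Up to a small multiple of the square of the graph norm of `A`, the quadratic form `q` is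
controlled by finitely many continuous functionals. -/
def IsRelCompactForm (A : V →ₗ[ℂ] V) (q : V → ℝ) : Prop :=
  ∀ ε : ℝ, 0 < ε → ∃ (ι : Type) (_ : Fintype ι) (ℓ : ι → V →L[ℂ] ℂ) (C : ℝ),
    ∀ φ, q φ ≤ C * (∑ i, ‖ℓ i φ‖ ^ 2) + ε * (‖A φ‖ ^ 2 + ‖φ‖ ^ 2)

lemma IsRelCompactForm.zero : IsRelCompactForm A fun _ ↦ 0 := by
  refine fun ε hε ↦ ⟨Empty, inferInstance, Empty.elim, 0, fun φ ↦ ?_⟩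
  rw [zero_mul, zero_add]
  positivity

lemma IsRelCompactForm.add {q q' : V → ℝ} (h : IsRelCompactForm A q) (h' : IsRelCompactForm A q') :
    IsRelCompactForm A fun φ ↦ q φ + q' φ := by
  intro ε hε
  obtain ⟨ι, _, ℓ, C, hC⟩ := h (ε / 2) (half_pos hε)
  obtain ⟨ι', _, ℓ', C', hC'⟩ := h' (ε / 2) (half_pos hε)
  refine ⟨ι ⊕ ι', inferInstance, Sum.elim ℓ ℓ', max C C', fun φ ↦ ?_⟩
  simp only [Fintype.sum_sum_type, Sum.elim_inl, Sum.elim_inr]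
  have e1 : C * (∑ i, ‖ℓ i φ‖ ^ 2) ≤ max C C' * ∑ i, ‖ℓ i φ‖ ^ 2 :=
    mul_le_mul_of_nonneg_right (le_max_left _ _) (Finset.sum_nonneg fun _ _ ↦ sq_nonneg _)
  have e2 : C' * (∑ i, ‖ℓ' i φ‖ ^ 2) ≤ max C C' * ∑ i, ‖ℓ' i φ‖ ^ 2 :=
    mul_le_mul_of_nonneg_right (le_max_right _ _) (Finset.sum_nonneg fun _ _ ↦ sq_nonneg _)
  linarith [hC φ, hC' φ]

lemma IsRelCompactForm.sum {κ : Type*} (t : Finset κ) {q : κ → V → ℝ}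
    (h : ∀ i, IsRelCompactForm A (q i)) : IsRelCompactForm A fun φ ↦ ∑ i ∈ t, q i φ := by
  classical
  induction t using Finset.induction_on with
  | empty => simpa using IsRelCompactForm.zero
  | insert i t hi ih =>
    simp only [Finset.sum_insert hi]
    exact (h i).add ih

/-- A coercive estimate modulo a relatively compact form makes the kernel of the closure
finite-dimensional. -/
lemma finiteDimensional_eigenspace_zero {W : Type*} [SeminormedAddCommGroup W]
    [InnerProductSpace ℂ W] {A : W →ₗ[ℂ] W}
    {T : Submodule ℂ (UniformSpace.Completion W × UniformSpace.Completion W)}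
    (hT : ∀ p ∈ T, ∃ φ : W, p = ((φ : UniformSpace.Completion W), (A φ : UniformSpace.Completion W)))
    {q : W → ℝ} (hq : IsRelCompactForm A q) {C : ℝ} (hC : 0 ≤ C)
    (h : ∀ φ, ‖φ‖ ^ 2 ≤ C * (‖A φ‖ ^ 2 + q φ)) : FiniteDimensional ℂ (eigenspace T 0) := by
  -- This `ε` satisfies `Cε ≤ 1/2`, so half of `‖φ‖²` can be absorbed on the left.
  obtain ⟨ι, _, ℓ, C', hℓ⟩ := hq (1 / (2 * (C + 1))) (by positivity)
  let e : W →L[ℂ] UniformSpace.Completion W := UniformSpace.Completion.toComplL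
  let ℓ' : ι → UniformSpace.Completion W →L[ℂ] ℂ := fun i ↦ (ℓ i).extend e
  have hℓ' : ∀ i (φ : W), ℓ' i (φ : UniformSpace.Completion W) = ℓ i φ := fun i φ ↦
    (ℓ i).extend_eq (e := e) UniformSpace.Completion.denseRange_coe
      (UniformSpace.Completion.isUniformInducing_coe W) φ
  let B : ℝ := 2 * C + 1
  have hW : ∀ φ : W, ‖φ‖ ^ 2 ≤ B * ‖A φ‖ ^ 2 + 2 * C * C' * ∑ i, ‖ℓ i φ‖ ^ 2 := by
    intro φ
    have h2 : C * (1 / (2 * (C + 1))) ≤ 1 / 2 := by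
      rw [mul_one_div, div_le_div_iff₀ (by positivity) (by positivity)]
      linarith
    have h3 := mul_le_mul_of_nonneg_left (hℓ φ) hC
    have h4 : C * (1 / (2 * (C + 1))) * (‖A φ‖ ^ 2 + ‖φ‖ ^ 2) ≤
        1 / 2 * (‖A φ‖ ^ 2 + ‖φ‖ ^ 2) := mul_le_mul_of_nonneg_right h2 (by positivity)
    simp only [B]
    nlinarith [h φ]
  -- The estimate is a closed condition on pairs, so it persists on the closure of the graph. For a
  -- kernel vector the second entry vanishes, and only the finitely many functionals remain; hence
  -- `Λ` below is injective.
  have hcl : ∀ p ∈ T.topologicalClosure,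
      ‖p.1‖ ^ 2 ≤ B * ‖p.2‖ ^ 2 + 2 * C * C' * ∑ i, ‖ℓ' i p.1‖ ^ 2 := by
    intro p hp
    have hclosed : IsClosed {p : UniformSpace.Completion W × UniformSpace.Completion W |
        ‖p.1‖ ^ 2 ≤ B * ‖p.2‖ ^ 2 + 2 * C * C' * ∑ i, ‖ℓ' i p.1‖ ^ 2} :=
      isClosed_le (by fun_prop) (by fun_prop)
    refine closure_minimal (fun p hp ↦ ?_) hclosed hp
    obtain ⟨φ, rfl⟩ := hT p hp
    simpa only [Set.mem_ofPred_eq, hℓ', UniformSpace.Completion.norm_coe] using hW φ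
  let Λ : eigenspace T 0 →ₗ[ℂ] (ι → ℂ) :=
    LinearMap.pi fun i ↦ (ℓ' i : UniformSpace.Completion W →ₗ[ℂ] ℂ).comp (eigenspace T 0).subtype
  refine FiniteDimensional.of_injective Λ (LinearMap.ker_eq_bot.1 (LinearMap.ker_eq_bot'.2 ?_))
  intro u hu
  have h1 := hcl _ (mem_eigenspace.1 u.2)
  have h2 : ∀ i, ℓ' i (u : UniformSpace.Completion W) = 0 := fun i ↦ congrFun hu i
  simp only [h2, norm_zero, Complex.ofReal_zero, zero_smul, ne_eq, OfNat.ofNat_ne_zero,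
    not_false_eq_true, zero_pow, Finset.sum_const_zero, mul_zero, add_zero] at h1
  have h3 : ‖(u : UniformSpace.Completion W)‖ = 0 := by
    nlinarith [norm_nonneg (u : UniformSpace.Completion W)]
  exact Subtype.ext (norm_eq_zero.1 h3)

end RelativeCompactness

/-! ### Cut-off functions and commutators. -/

section LocalCompactness

variable {n : ℕ} {N : Type*} [EMetricSpace N] [ChartedSpace (EuclideanSpace ℝ (Fin n)) N]
  [IsManifold (𝓡 n) ∞ N]
  [RiemannianBundle (fun y : N ↦ TangentSpace (𝓡 n) y)]
  [IsContMDiffRiemannianBundle (𝓡 n) ∞ (EuclideanSpace ℝ (Fin n))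
    (fun y : N ↦ TangentSpace (𝓡 n) y)]
  {F : Type*} [NormedAddCommGroup F] [NormedSpace ℂ F] [FiniteDimensional ℂ F]
  {E : N → Type*} [TopologicalSpace (TotalSpace F E)] [∀ y, NormedAddCommGroup (E y)]
  [∀ y, InnerProductSpace ℂ (E y)] [FiberBundle F E] [VectorBundle ℂ F E] [VectorBundle ℝ F E]
  [ContMDiffVectorBundle ∞ F E (𝓡 n)] [IsHermitianBundle n F E]

lemma HasCompactSupp.continuous_norm_sq_integrable [MeasurableSpace N] [BorelSpace N]
    {μ : Measure N} [IsLocallyFiniteMeasure μ] {u : Π y, E y} (hc : HasCompactSupp u)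
    (hu : IsSmoothSection n F u) : Integrable (fun y ↦ ‖u y‖ ^ 2) μ := by
  obtain ⟨K, hK, hKu⟩ := hc
  refine hu.continuous_norm_sq.integrable_of_hasCompactSupport ?_
  exact HasCompactSupport.intro hK fun y hy ↦ by simp [hKu y hy]

/-- The commutator of a first order operator with a function involves no derivative of `u`. It is
therefore determined by its values on the frame, which are smooth sections and bounded on `K`. -/
lemma CollarDiracBundle.exists_commutator_bound (S : CollarDiracBundle n N F E) {x₀ : N}
    (P : CoordPatch n x₀) (Q : BundlePatch n F E x₀) {f : N → ℂ}
    (hf : ContMDiff (𝓡 n) 𝓘(ℝ, ℂ) ∞ f) {K : Set N} (hK : IsCompact K) (hKP : K ⊆ P.dom)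
    (hKQ : K ⊆ Q.dom) (hKn : ∀ y ∈ K, ∀ e : E y, ‖Q.coord y e‖ ^ 2 ≤ 2 * ‖e‖ ^ 2) :
    ∃ C, 0 ≤ C ∧ ∀ u : Π y, E y, IsSmoothSection n F u → ∀ y ∈ K,
      ‖S.boundaryOp (fun x ↦ f x • u x) y - f y • S.boundaryOp u y‖ ^ 2 ≤ C * ‖u y‖ ^ 2 := by
  let κ : Fin Q.rank → Π y, E y := fun a y ↦
    S.boundaryOp (fun x ↦ f x • Q.sec a x) y - f y • S.boundaryOp (Q.sec a) y
  have hκ : ∀ a, IsSmoothSection n F (κ a) := by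
    intro a
    have h := (S.isSmoothSection_boundaryOp ((Q.smooth_sec a).complex_smul hf)).add
      (((S.isSmoothSection_boundaryOp (Q.smooth_sec a)).complex_smul hf).smul (-1))
    convert h using 1
    funext y
    simp [κ, sub_eq_add_neg]
  have hcont : Continuous fun y ↦ ∑ a, ‖κ a y‖ ^ 2 :=
    continuous_finsetSum _ fun a _ ↦ (hκ a).continuous_norm_sq
  obtain ⟨C, hC⟩ := (hK.image hcont).bddAbove
  refine ⟨2 * max C 0, by positivity, fun u hu y hy ↦ ?_⟩
  have hC' : ∑ a, ‖κ a y‖ ^ 2 ≤ max C 0 := (hC ⟨y, hy, rfl⟩).trans (le_max_left _ _)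
  have hy' := hKP hy
  have h1 : S.boundaryOp (fun x ↦ f x • u x) y - f y • S.boundaryOp u y =
      ∑ a, Q.coord y (u y) a • κ a y := by
    simp only [κ, S.boundaryOp_complex_smul P hy' hf hu,
      S.boundaryOp_complex_smul P hy' hf (Q.smooth_sec _), add_sub_cancel_left]
    simp only [Finset.smul_sum]
    rw [Finset.sum_comm]
    refine Finset.sum_congr rfl fun j _ ↦ ?_
    conv_lhs => rw [← Q.combine_coord (hKQ hy) (u y), Q.combine_apply, map_sum, Finset.smul_sum]
    refine Finset.sum_congr rfl fun a _ ↦ ?_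
    rw [map_smul, smul_comm]
  rw [h1]
  refine (norm_sum_smul_sq_le _ _ _).trans ?_
  rw [← EuclideanSpace.norm_sq_eq]
  calc _ ≤ max C 0 * (2 * ‖u y‖ ^ 2) := mul_le_mul hC' (hKn y hy _) (sq_nonneg _) (le_max_right _ _)
    _ = _ := by ring

namespace TestSection

variable [MeasurableSpace N] {μ : Measure N}

/-- Multiplication of test sections by a smooth function. -/
def mulFun {f : N → ℂ} (hf : ContMDiff (𝓡 n) 𝓘(ℝ, ℂ) ∞ f) :
    TestSection n F E μ →ₗ[ℂ] TestSection n F E μ where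
  toFun φ := .mk μ (fun y ↦ f y • φ.toFun y) (φ.smooth.complex_smul hf) <| by
    obtain ⟨K, hK, hKφ⟩ := φ.hasCompactSupp
    exact ⟨K, hK, fun y hy ↦ by simp [hKφ y hy]⟩
  map_add' φ ψ := TestSection.ext fun y ↦ smul_add _ _ _
  map_smul' a φ := TestSection.ext fun y ↦ smul_comm _ _ _

lemma toFun_mulFun {f : N → ℂ} (hf : ContMDiff (𝓡 n) 𝓘(ℝ, ℂ) ∞ f) (φ : TestSection n F E μ)
    (y : N) : (mulFun hf φ).toFun y = f y • φ.toFun y := rfl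

variable [BorelSpace N] [IsLocallyFiniteMeasure μ]

lemma integrable_norm_sq (φ : TestSection n F E μ) : Integrable (fun y ↦ ‖φ.toFun y‖ ^ 2) μ :=
  φ.hasCompactSupp.continuous_norm_sq_integrable φ.smooth

lemma norm_sq_eq (φ : TestSection n F E μ) : ‖φ‖ ^ 2 = ∫ y, ‖φ.toFun y‖ ^ 2 ∂μ := by
  rw [← inner_self_eq_norm_sq (𝕜 := ℂ) φ, inner_eq,
    ← integral_re (integrable_inner_section n F E μ φ φ)]
  exact integral_congr_ae (.of_forall fun y ↦ inner_self_eq_norm_sq _)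

lemma norm_mulFun_le {f : N → ℂ} (hf : ContMDiff (𝓡 n) 𝓘(ℝ, ℂ) ∞ f) (hf1 : ∀ y, ‖f y‖ ≤ 1)
    (φ : TestSection n F E μ) : ‖mulFun hf φ‖ ≤ ‖φ‖ := by
  refine le_of_sq_le_sq ?_ (norm_nonneg _)
  rw [norm_sq_eq, norm_sq_eq]
  refine integral_mono (mulFun hf φ).integrable_norm_sq φ.integrable_norm_sq fun y ↦ ?_
  refine pow_le_pow_left₀ (norm_nonneg _) ?_ 2
  rw [toFun_mulFun, norm_smul]
  exact mul_le_of_le_one_left (norm_nonneg _) (hf1 y)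

end TestSection

end LocalCompactness

/-! ### Relative compactness near a point, the Callias estimate and the kernel. -/

section CalliasEstimate

open scoped FourierTransform

variable {n : ℕ} {N : Type*} [EMetricSpace N] [ChartedSpace (EuclideanSpace ℝ (Fin n)) N]
  [IsManifold (𝓡 n) ∞ N]
  [RiemannianBundle (fun y : N ↦ TangentSpace (𝓡 n) y)]
  [IsContMDiffRiemannianBundle (𝓡 n) ∞ (EuclideanSpace ℝ (Fin n))
    (fun y : N ↦ TangentSpace (𝓡 n) y)]
  {F : Type*} [NormedAddCommGroup F] [NormedSpace ℂ F] [FiniteDimensional ℂ F]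
  {E : N → Type*} [TopologicalSpace (TotalSpace F E)] [∀ y, NormedAddCommGroup (E y)]
  [∀ y, InnerProductSpace ℂ (E y)] [FiberBundle F E] [VectorBundle ℂ F E] [VectorBundle ℝ F E]
  [ContMDiffVectorBundle ∞ F E (𝓡 n)] [IsHermitianBundle n F E]

lemma norm_fourier_le_integral {W : Type*} [NormedAddCommGroup W] [NormedSpace ℂ W]
    (f : EuclideanSpace ℝ (Fin n) → W) (ξ : EuclideanSpace ℝ (Fin n)) : ‖𝓕 f ξ‖ ≤ ∫ z, ‖f z‖ := by
  rw [Real.fourier_eq]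
  refine (norm_integral_le_integral_norm _).trans_eq ?_
  simp

namespace CollarDiracBundle

variable (S : CollarDiracBundle n N F E) {x₀ : N}

lemma localRep_add (Q : BundlePatch n F E x₀) (u v : Π y, E y) :
    localRep Q (u + v) = localRep Q u + localRep Q v := by
  funext z
  simp only [localRep, chartRep, Pi.add_apply]
  split_ifs
  · ext a
    exact map_add (Q.coef a _) _ _
  · simp

lemma localRep_smul (Q : BundlePatch n F E x₀) (c : ℂ) (u : Π y, E y) :
    localRep Q (c • u) = c • localRep Q u := by
  funext z
  simp only [localRep, chartRep, Pi.smul_apply]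
  split_ifs
  · ext a
    exact map_smul (Q.coef a _) _ _
  · simp

variable [MeasurableSpace N] [BorelSpace N] {μ : Measure N} [IsLocallyFiniteMeasure μ]

/-- Rellich's theorem for the graph norm of `𝒜`, near a point. -/
lemma exists_isRelCompactForm (hμ : IsRiemannianVolume (n := n) μ) (x₀ : N) :
    ∃ (χ : N → ℂ) (hχ : ContMDiff (𝓡 n) 𝓘(ℝ, ℂ) ∞ χ), (∀ᶠ y in nhds x₀, χ y = 1) ∧
      IsRelCompactForm (S.boundaryTest μ) fun φ ↦ ‖TestSection.mulFun hχ φ‖ ^ 2 := by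
  obtain ⟨Q, U, C, hUo, hxU, hUQ, hUs, hC, hUn, hest⟩ := S.exists_elliptic_estimate hμ x₀
  obtain ⟨P⟩ := nonempty_coordPatch (n := n) x₀
  obtain ⟨b, hb⟩ := ((SmoothBumpFunction.nhds_basis_tsupport (I := 𝓡 n) x₀).mem_iff).1
    ((hUo.inter P.isOpen_dom).mem_nhds ⟨hxU, P.mem_dom⟩)
  have hχ : ContMDiff (𝓡 n) 𝓘(ℝ, ℂ) ∞ fun y ↦ (b y : ℂ) :=
    Complex.ofRealCLM.contDiff.contMDiff.comp b.contMDiff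
  have hχ1 : ∀ y, ‖(b y : ℂ)‖ ≤ 1 := by
    intro y
    rw [Complex.norm_real, Real.norm_of_nonneg b.nonneg]
    exact b.le_one
  refine ⟨fun y ↦ (b y : ℂ), hχ, ?_, ?_⟩
  · filter_upwards [b.eventuallyEq_one] with y hy
    simp [hy]
  let M : TestSection n F E μ →ₗ[ℂ] TestSection n F E μ := TestSection.mulFun hχ
  have hK : IsCompact (tsupport b) := b.hasCompactSupport
  have hKU : tsupport b ⊆ U := fun y hy ↦ (hb.2 hy).1
  have hK0 : ∀ φ, ∀ y ∉ tsupport b, (M φ).toFun y = 0 := by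
    intro φ y hy
    rw [TestSection.toFun_mulFun, image_eq_zero_of_notMem_tsupport hy]
    simp
  obtain ⟨C₁, hC₁, hcomm⟩ := S.exists_commutator_bound P Q hχ hK (fun y hy ↦ (hb.2 hy).2)
    (hKU.trans hUQ) fun y hy ↦ hUn y (hKU hy)
  have hM1 : ∀ φ, ‖M φ‖ ≤ ‖φ‖ := TestSection.norm_mulFun_le hχ hχ1
  -- The cut-off is bounded for the graph norm: on its support by the commutator bound, elsewhere
  -- because `𝒜` is local.
  have hAM : ∀ φ, ‖S.boundaryTest μ (M φ)‖ ^ 2 ≤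
      2 * ‖S.boundaryTest μ φ‖ ^ 2 + 2 * C₁ * ‖φ‖ ^ 2 := by
    intro φ
    rw [TestSection.norm_sq_eq, TestSection.norm_sq_eq, TestSection.norm_sq_eq,
      ← integral_const_mul, ← integral_const_mul,
      ← integral_add ((S.boundaryTest μ φ).integrable_norm_sq.const_mul _)
        (φ.integrable_norm_sq.const_mul _)]
    refine integral_mono (S.boundaryTest μ (M φ)).integrable_norm_sq
      (((S.boundaryTest μ φ).integrable_norm_sq.const_mul _).add
        (φ.integrable_norm_sq.const_mul _)) fun y ↦ ?_
    simp only [toFun_boundaryTest]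
    by_cases hy : y ∈ tsupport b
    · have h1 := hcomm _ φ.smooth y hy
      set p := S.boundaryOp (M φ).toFun y
      set q := S.boundaryOp φ.toFun y
      have h2 : ‖p - (b y : ℂ) • q‖ ^ 2 ≤ C₁ * ‖φ.toFun y‖ ^ 2 := h1
      have h3 : ‖p‖ ≤ ‖(b y : ℂ) • q‖ + ‖p - (b y : ℂ) • q‖ := norm_le_norm_add_norm_sub' _ _
      have h4 : ‖(b y : ℂ) • q‖ ≤ ‖q‖ := by
        rw [norm_smul]
        exact mul_le_of_le_one_left (norm_nonneg _) (hχ1 y)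
      have h5 : ‖p‖ ^ 2 ≤ (‖q‖ + ‖p - (b y : ℂ) • q‖) ^ 2 :=
        pow_le_pow_left₀ (norm_nonneg _) (h3.trans (add_le_add_left h4 _)) 2
      nlinarith [sq_nonneg (‖q‖ - ‖p - (b y : ℂ) • q‖)]
    · have h1 : S.boundaryOp (M φ).toFun y = 0 := by
        have h2 : S.tangentialDirac (M φ).toFun y = 0 :=
          S.tangentialDirac_eq_zero (M φ).smooth <| by
            filter_upwards [(isClosed_tsupport b).isOpen_compl.mem_nhds hy] with x hx
              using hK0 φ x hx
        rw [boundaryOp, h2, hK0 φ y hy]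
        simp
      rw [h1, norm_zero, zero_pow two_ne_zero]
      positivity
  have hfd : ∀ φ, ContDiff ℝ ∞ (localRep Q (M φ).toFun) := fun φ ↦
    contDiff_localRep (M φ).smooth hK (hKU.trans hUQ) (hKU.trans hUs) (hK0 φ)
  let B := extChartAt (𝓡 n) x₀ '' tsupport b
  have hB : IsCompact B := isCompact_image_extChartAt hK (hKU.trans hUs)
  have hf0 : ∀ φ, ∀ z ∉ B, localRep Q (M φ).toFun z = 0 := fun φ z hz ↦
    localRep_eq_zero (hK0 φ) hz
  have hfc : ∀ φ, HasCompactSupport (localRep Q (M φ).toFun) := fun φ ↦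
    HasCompactSupport.intro hB (hf0 φ)
  have hfi : ∀ φ, Integrable (localRep Q (M φ).toFun) := fun φ ↦
    (hfd φ).continuous.integrable_of_hasCompactSupport (hfc φ)
  have hest' := fun φ ↦ hest (M φ).toFun _ (M φ).smooth hK hKU (hK0 φ)
  simp only [← TestSection.norm_sq_eq, ← S.toFun_boundaryTest] at hest'
  -- The functionals are the components of the Fourier transform of the localized section at a given
  -- frequency. They are `L²`-bounded because the support is compact.
  let L : EuclideanSpace ℝ (Fin n) → Fin Q.rank → TestSection n F E μ →ₗ[ℂ] ℂ := fun ξ a ↦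
    { toFun := fun φ ↦ 𝓕 (localRep Q (M φ).toFun) ξ a
      map_add' := fun φ ψ ↦ by
        have h1 : localRep Q (M (φ + ψ)).toFun =
            localRep Q (M φ).toFun + localRep Q (M ψ).toFun := by
          rw [map_add, TestSection.toFun_add, localRep_add]
        have h2 : 𝓕 (localRep Q (M φ).toFun + localRep Q (M ψ).toFun) ξ =
            𝓕 (localRep Q (M φ).toFun) ξ + 𝓕 (localRep Q (M ψ).toFun) ξ := by
          rw [Real.fourier_eq, Real.fourier_eq, Real.fourier_eq, ← integral_add
            ((Real.fourierIntegral_convergent_iff ξ).2 (hfi φ))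
            ((Real.fourierIntegral_convergent_iff ξ).2 (hfi ψ))]
          simp only [Pi.add_apply, smul_add]
        rw [h1, h2]
        rfl
      map_smul' := fun c φ ↦ by
        have h1 : localRep Q (M (c • φ)).toFun = c • localRep Q (M φ).toFun := by
          rw [map_smul, TestSection.toFun_smul, localRep_smul]
        have h2 : 𝓕 (c • localRep Q (M φ).toFun) ξ = c • 𝓕 (localRep Q (M φ).toFun) ξ := by
          rw [Real.fourier_eq, Real.fourier_eq, ← integral_smul]
          simp only [Pi.smul_apply, smul_comm c]
        rw [h1, h2]
        rfl }
  let m : ℝ := √((volume.real B + 1) * C)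
  have hL : ∀ ξ a φ, ‖L ξ a φ‖ ≤ m * ‖φ‖ := by
    intro ξ a φ
    have h1 : ‖L ξ a φ‖ ≤ ∫ z, ‖localRep Q (M φ).toFun z‖ :=
      (PiLp.norm_apply_le _ _).trans (norm_fourier_le_integral _ _)
    have hv : 0 ≤ volume.real B + 1 := by positivity
    refine h1.trans (le_of_sq_le_sq ?_ (by positivity))
    refine (sq_setIntegral_le (hfd φ).continuous (hfc φ) hB (hf0 φ)).trans ?_
    rw [mul_pow, Real.sq_sqrt (by positivity), mul_assoc]
    refine mul_le_mul_of_nonneg_left ((hest' φ).2.2.trans ?_) hv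
    exact mul_le_mul_of_nonneg_left (pow_le_pow_left₀ (norm_nonneg _) (hM1 φ) 2) hC
  intro ε hε
  let G : ℝ := 2 * C₁ + 3
  have hG : 0 < G := by positivity
  -- One factor `C` comes from passing between the norm on `N` and the norm in the chart, the other
  -- from the elliptic estimate, and `G` from the cut-off.
  obtain ⟨t, C₂, hC₂, ht⟩ := exists_integral_norm_sq_le (W := EuclideanSpace ℂ (Fin Q.rank)) hB
    (ε := ε / (C * C * G + 1)) (by positivity)
  refine ⟨t × Fin Q.rank, inferInstance, fun p ↦ (L p.1 p.2).mkContinuous m (hL p.1 p.2), C * C₂,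
    fun φ ↦ ?_⟩
  have hsum : ∑ p : t × Fin Q.rank, ‖(L p.1 p.2).mkContinuous m (hL p.1 p.2) φ‖ ^ 2 =
      ∑ ξ ∈ t, ‖𝓕 (localRep Q (M φ).toFun) ξ‖ ^ 2 := by
    rw [Fintype.sum_prod_type, ← Finset.sum_coe_sort t]
    refine Finset.sum_congr rfl fun ξ _ ↦ ?_
    rw [EuclideanSpace.norm_sq_eq]
    rfl
  rw [hsum]
  have h1 := ht _ (hfd φ) (hf0 φ)
  obtain ⟨e1, e2, -⟩ := hest' φ
  have e3 : ‖S.boundaryTest μ (M φ)‖ ^ 2 + ‖M φ‖ ^ 2 ≤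
      G * (‖S.boundaryTest μ φ‖ ^ 2 + ‖φ‖ ^ 2) := by
    have h2 := pow_le_pow_left₀ (norm_nonneg _) (hM1 φ) 2
    have h3 : 0 ≤ C₁ * ‖S.boundaryTest μ φ‖ ^ 2 := by positivity
    simp only [G]
    nlinarith [hAM φ, sq_nonneg ‖S.boundaryTest μ φ‖, sq_nonneg ‖φ‖]
  set X := ‖S.boundaryTest μ φ‖ ^ 2 + ‖φ‖ ^ 2
  have hX : 0 ≤ X := by positivity
  have e4 := e1.trans (mul_le_mul_of_nonneg_left e3 hC)
  have e5 : C * (ε / (C * C * G + 1) * (C * (G * X))) ≤ ε * X := by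
    have e6 : C * (ε / (C * C * G + 1) * (C * (G * X))) =
        (C * C * G) / (C * C * G + 1) * (ε * X) := by ring
    rw [e6]
    refine mul_le_of_le_one_left (by positivity) ?_
    rw [div_le_one (by positivity)]
    linarith
  change ‖M φ‖ ^ 2 ≤ _
  refine e2.trans ((mul_le_mul_of_nonneg_left (h1.trans (add_le_add_right
    (mul_le_mul_of_nonneg_left e4 (by positivity)) _)) hC).trans ?_)
  rw [mul_add, ← mul_assoc]
  linarith

/-- A bundle map which sends smooth sections to smooth sections is locally bounded. -/
lemma eventually_norm_apply_le {Θ : Π y : N, E y →L[ℂ] E y}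
    (hΘ : ∀ u : Π y, E y, IsSmoothSection n F u → IsSmoothSection n F fun y ↦ Θ y (u y)) (x₀ : N) :
    ∃ B : ℝ, 0 ≤ B ∧ ∀ᶠ y in nhds x₀, ∀ e : E y, ‖Θ y e‖ ≤ B * ‖e‖ := by
  obtain ⟨Q⟩ := nonempty_bundlePatch (n := n) (F := F) (E := E) x₀
  let b : ℝ := (∑ a, ‖Θ x₀ (Q.sec a x₀)‖ ^ 2) + 1
  have hb : 0 ≤ b := by positivity
  refine ⟨√(2 * b), by positivity, ?_⟩
  filter_upwards [Q.isOpen_dom.mem_nhds Q.mem_dom, Q.eventually_norm_combine,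
    eventually_sum_norm_sq_lt (fun a ↦ hΘ _ (Q.smooth_sec a)) (lt_add_one _)] with y hy h1 h2 e
  refine le_of_sq_le_sq ?_ (by positivity)
  rw [mul_pow, Real.sq_sqrt (by positivity)]
  have h3 := (h1 (Q.coord y e)).1
  rw [Q.combine_coord hy] at h3
  conv_lhs => rw [← Q.combine_coord hy e, Q.combine_apply, map_sum]
  simp only [map_smul]
  refine (norm_sum_smul_sq_le _ _ _).trans ?_
  rw [← EuclideanSpace.norm_sq_eq]
  calc _ ≤ b * (2 * ‖e‖ ^ 2) := mul_le_mul h2.le h3 (sq_nonneg _) hb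
    _ = _ := by ring

/-- The basic estimate for a Callias-type operator. -/
lemma integral_callias_le [SigmaCompactSpace N] (hμ : IsRiemannianVolume (n := n) μ)
    {Θ : Π y : N, E y →L[ℂ] E y}
    (hΘ : ∀ u : Π y, E y, IsSmoothSection n F u → ∀ y,
      S.tangentialDirac (fun x ↦ S.pot x (u x)) y + S.pot y (S.tangentialDirac u y) = Θ y (u y))
    (φ : TestSection n F E μ) :
    Integrable (fun y ↦ ‖S.pot y (φ.toFun y)‖ ^ 2 + (⟪φ.toFun y, Θ y (φ.toFun y)⟫_ℂ).re) μ ∧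
    ∫ y, (‖S.pot y (φ.toFun y)‖ ^ 2 + (⟪φ.toFun y, Θ y (φ.toFun y)⟫_ℂ).re) ∂μ ≤
      ‖S.boundaryTest μ φ‖ ^ 2 := by
  have hu := φ.smooth
  have huc := φ.hasCompactSupp
  set u := φ.toFun
  have hD := S.isSmoothSection_tangentialDirac hu
  have hDc := S.hasCompactSupp_tangentialDirac hu huc
  have hp := S.pot_smooth u hu
  have hpc : HasCompactSupp fun y ↦ S.pot y (u y) := by
    obtain ⟨K, hK, hKu⟩ := huc
    exact ⟨K, hK, fun y hy ↦ by simp [hKu y hy]⟩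
  have i1 := hpc.continuous_norm_sq_integrable (μ := μ) hp
  have i2 := hDc.continuous_norm_sq_integrable (μ := μ) hD
  have i3 := integrable_inner_of_hasCompactSupp (μ := μ) hu
    (S.isSmoothSection_tangentialDirac hp) huc
  have i4 := integrable_inner_of_hasCompactSupp (μ := μ) hu (S.pot_smooth _ hD) huc
  have i5 := integrable_inner_of_hasCompactSupp (μ := μ) hD hp hDc
  -- `Θ` comes as a mere family of fibre maps; integrability is read off from the anticommutator
  -- formula.
  have i6 : Integrable (fun y ↦ (⟪u y, Θ y (u y)⟫_ℂ).re) μ := by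
    refine (i3.add i4).re.congr (.of_forall fun y ↦ ?_)
    simp only [← hΘ u hu y, inner_add_right]
    rfl
  refine ⟨i1.add i6, ?_⟩
  -- Since `D` and `Ψ` are symmetric, the anticommutator integrates to the cross term in the
  -- expansion of `‖Du + Ψu‖²`.
  have h1 : ∫ y, (⟪u y, Θ y (u y)⟫_ℂ).re ∂μ =
      ∫ y, 2 * (⟪S.tangentialDirac u y, S.pot y (u y)⟫_ℂ).re ∂μ := by
    have h2 : ∫ y, (⟪u y, Θ y (u y)⟫_ℂ).re ∂μ =
        (∫ y, (⟪u y, S.tangentialDirac (fun x ↦ S.pot x (u x)) y⟫_ℂ +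
          ⟪u y, S.pot y (S.tangentialDirac u y)⟫_ℂ) ∂μ).re := by
      refine Eq.trans ?_ (integral_re (𝕜 := ℂ) (i3.add i4))
      refine integral_congr_ae (.of_forall fun y ↦ ?_)
      simp only [← hΘ u hu y, inner_add_right]
      rfl
    have h3 : ∫ y, 2 * (⟪S.tangentialDirac u y, S.pot y (u y)⟫_ℂ).re ∂μ =
        2 * (∫ y, ⟪S.tangentialDirac u y, S.pot y (u y)⟫_ℂ ∂μ).re := by
      rw [integral_const_mul]
      exact congrArg _ (integral_re (𝕜 := ℂ) i5)
    have h4 : ∫ y, ⟪u y, S.pot y (S.tangentialDirac u y)⟫_ℂ ∂μ =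
        (starRingEnd ℂ) (∫ y, ⟪S.tangentialDirac u y, S.pot y (u y)⟫_ℂ ∂μ) := by
      rw [← integral_conj]
      refine integral_congr_ae (.of_forall fun y ↦ ?_)
      simp only [inner_conj_symm]
      exact (S.pot_symm _ _ _).symm
    rw [h2, h3, integral_add i3 i4, ← S.integral_inner_tangentialDirac hμ hu hp huc, h4,
      Complex.add_re, Complex.conj_re]
    ring
  have i7 : Integrable (fun y ↦ 2 * (⟪S.tangentialDirac u y, S.pot y (u y)⟫_ℂ).re) μ :=
    i5.re.const_mul 2
  rw [integral_add i1 i6, h1, ← integral_add i1 i7, TestSection.norm_sq_eq]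
  refine integral_mono (i1.add i7) (S.boundaryTest μ φ).integrable_norm_sq fun y ↦ ?_
  have h5 : ‖(S.boundaryTest μ φ).toFun y‖ ^ 2 =
      ‖S.tangentialDirac u y + S.pot y (u y)‖ ^ 2 := by
    rw [toFun_boundaryTest, boundaryOp, norm_neg, S.norm_cτ]
  have h6 := norm_add_sq (𝕜 := ℂ) (S.tangentialDirac u y) (S.pot y (u y))
  simp only [RCLike.re_to_complex] at h6
  rw [h5, h6]
  linarith [sq_nonneg ‖S.tangentialDirac u y‖]

/-- The Callias estimate is coercive outside a compact set `K`. On `K` it may lose a bounded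
multiple of `‖φ‖²`, which finitely many relatively compact cut-off norms make up for. -/
lemma finiteDimensional_kernel [SigmaCompactSpace N] (hμ : IsRiemannianVolume (n := n) μ)
    (hS : S.IsStronglyCallias) :
    FiniteDimensional ℂ (eigenspace (testGraph n F E μ S.boundaryOp) 0) := by
  obtain ⟨Θ, hΘ, hcal⟩ := hS.callias
  -- `R = 1` is a normalization: outside `K` the integrand of the Callias estimate is at least
  -- `‖φ‖²`.
  obtain ⟨K, hK, hKΘ⟩ := hcal 1 one_pos
  have hΘs : ∀ u : Π y, E y, IsSmoothSection n F u → IsSmoothSection n F fun y ↦ Θ y (u y) := by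
    intro u hu
    have h := (S.isSmoothSection_tangentialDirac (S.pot_smooth u hu)).add
      (S.pot_smooth _ (S.isSmoothSection_tangentialDirac hu))
    convert h using 1
    funext y
    exact (hΘ u hu y).symm
  choose χ hχ hχ1 hχc using fun x ↦ S.exists_isRelCompactForm hμ x
  choose B hB hBΘ using fun x ↦ eventually_norm_apply_le hΘs x
  obtain ⟨t, -, ht⟩ := hK.elim_nhds_subcover _ fun x _ ↦ (hχ1 x).and (hBΘ x)
  -- `b` bounds `Θ` on `K`. The weight `b + 1` on the cut-off norms compensates a loss of at most
  -- `b‖e‖²` and still leaves `‖e‖²`.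
  let b : ℝ := ∑ x ∈ t, B x
  have hb : 0 ≤ b := Finset.sum_nonneg fun x _ ↦ hB x
  refine finiteDimensional_eigenspace_zero (A := S.boundaryTest μ)
    (fun p hp ↦ S.mem_testGraph_iff.1 hp) (IsRelCompactForm.sum t hχc) (C := b + 1)
    (by positivity) fun φ ↦ ?_
  obtain ⟨i1, h1⟩ := S.integral_callias_le hμ hΘ φ
  have i2 : Integrable (fun y ↦ (b + 1) * ∑ x ∈ t, ‖(TestSection.mulFun (hχ x) φ).toFun y‖ ^ 2) μ :=
    (integrable_finsetSum _ fun x _ ↦ (TestSection.mulFun (hχ x) φ).integrable_norm_sq).const_mul _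
  have h2 : ‖φ‖ ^ 2 ≤ ∫ y, ((‖S.pot y (φ.toFun y)‖ ^ 2 + (⟪φ.toFun y, Θ y (φ.toFun y)⟫_ℂ).re) +
      (b + 1) * ∑ x ∈ t, ‖(TestSection.mulFun (hχ x) φ).toFun y‖ ^ 2) ∂μ := by
    rw [TestSection.norm_sq_eq]
    refine integral_mono φ.integrable_norm_sq (i1.add i2) fun y ↦ ?_
    change ‖φ.toFun y‖ ^ 2 ≤ (‖S.pot y (φ.toFun y)‖ ^ 2 + (⟪φ.toFun y, Θ y (φ.toFun y)⟫_ℂ).re) +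
      (b + 1) * ∑ x ∈ t, ‖(TestSection.mulFun (hχ x) φ).toFun y‖ ^ 2
    set e := φ.toFun y
    have hre : -(‖Θ y e‖ * ‖e‖) ≤ (⟪e, Θ y e⟫_ℂ).re := by
      have h3 := (Complex.abs_re_le_norm ⟪e, Θ y e⟫_ℂ).trans (norm_inner_le_norm _ _)
      linarith [neg_le_of_abs_le h3, mul_comm ‖e‖ ‖Θ y e‖]
    by_cases hy : y ∈ K
    · obtain ⟨x, hxt, hyx, hyB⟩ := Set.mem_iUnion₂.1 (ht hy)
      have h3 : ‖e‖ ^ 2 ≤ ∑ x ∈ t, ‖(TestSection.mulFun (hχ x) φ).toFun y‖ ^ 2 := by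
        refine le_trans (le_of_eq ?_) (Finset.single_le_sum
          (f := fun x ↦ ‖(TestSection.mulFun (hχ x) φ).toFun y‖ ^ 2) (fun _ _ ↦ sq_nonneg _) hxt)
        simp only [TestSection.toFun_mulFun, hyx, one_smul, e]
      have h4 : B x ≤ b := Finset.single_le_sum (fun x _ ↦ hB x) hxt
      have h5 : ‖Θ y e‖ * ‖e‖ ≤ b * ‖e‖ ^ 2 := by
        rw [sq, ← mul_assoc]
        exact mul_le_mul_of_nonneg_right
          ((hyB e).trans (mul_le_mul_of_nonneg_right h4 (norm_nonneg _))) (norm_nonneg _)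
      have h6 := mul_le_mul_of_nonneg_left h3 (by positivity : 0 ≤ b + 1)
      linarith [sq_nonneg ‖S.pot y e‖]
    · have h3 := hKΘ y hy e
      have h4 : ‖Θ y e‖ * ‖e‖ ≤ ‖Θ y‖ * ‖e‖ ^ 2 := by
        rw [sq, ← mul_assoc]
        exact mul_le_mul_of_nonneg_right ((Θ y).le_opNorm e) (norm_nonneg _)
      have h5 : 0 ≤ (b + 1) * ∑ x ∈ t, ‖(TestSection.mulFun (hχ x) φ).toFun y‖ ^ 2 := by
        positivity
      linarith
  rw [integral_add i1 i2, integral_const_mul,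
    integral_finsetSum _ fun x _ ↦ (TestSection.mulFun (hχ x) φ).integrable_norm_sq] at h2
  simp only [← TestSection.norm_sq_eq] at h2
  have h3 : ‖S.boundaryTest μ φ‖ ^ 2 ≤ (b + 1) * ‖S.boundaryTest μ φ‖ ^ 2 :=
    le_mul_of_one_le_left (sq_nonneg _) (by linarith)
  rw [mul_add]
  linarith

end CollarDiracBundle

end CalliasEstimate

end CalliasBoundary

end

/-! ### The proposition. -/

open CalliasBoundary in
theorem proposition4p1
    {n : ℕ} {N : Type*} [EMetricSpace N] [CompleteSpace N] [SigmaCompactSpace N]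
    [ChartedSpace (EuclideanSpace ℝ (Fin n)) N] [IsManifold (𝓡 n) ∞ N]
    [RiemannianBundle (fun y : N ↦ TangentSpace (𝓡 n) y)]
    [IsContMDiffRiemannianBundle (𝓡 n) ∞ (EuclideanSpace ℝ (Fin n))
      (fun y : N ↦ TangentSpace (𝓡 n) y)]
    [IsRiemannianManifold (𝓡 n) N]
    [MeasurableSpace N] [BorelSpace N] (μ : Measure N) [IsLocallyFiniteMeasure μ]
    (hμ : IsRiemannianVolume (n := n) μ)
    {F : Type*} [NormedAddCommGroup F] [NormedSpace ℂ F] [FiniteDimensional ℂ F]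
    {E : N → Type*} [TopologicalSpace (TotalSpace F E)] [∀ y, NormedAddCommGroup (E y)]
    [∀ y, InnerProductSpace ℂ (E y)] [FiberBundle F E] [VectorBundle ℂ F E] [VectorBundle ℝ F E]
    [ContMDiffVectorBundle ∞ F E (𝓡 n)] [IsHermitianBundle n F E]
    (S : CollarDiracBundle n N F E) (hS : S.IsStronglyCallias)
    (G : OddGrading n F S.boundaryOp) :
    let T := testGraph n F E μ S.boundaryOp
    let X := sobolevInterval T (1 / 2) (Set.Ici 0)
    let Lplus := L2Sub n F E μ G.plus
    let Lminus := L2Sub n F E μ G.minus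
    (FiniteDimensional ℂ (kerOn T Lplus) ∧
      IsFredholmPair X (sobolevSub T (1 / 2) Lplus) ∧
      fredholmPairIndex X (sobolevSub T (1 / 2) Lplus) =
        Module.finrank ℂ (kerOn T Lplus)) ∧
    (FiniteDimensional ℂ (kerOn T Lminus) ∧
      IsFredholmPair X (sobolevSub T (1 / 2) Lminus) ∧
      fredholmPairIndex X (sobolevSub T (1 / 2) Lminus) =
        Module.finrank ℂ (kerOn T Lminus)) := by
  have hT := S.isSymmetricGraph_testGraph hμ hS
  -- The kernels of `𝒜⁺` and `𝒜⁻` are subspaces of this one, so their finite-dimensionality is found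
  -- by instance search.
  have := S.finiteDimensional_kernel hμ hS
  exact ⟨⟨inferInstance, isFredholmPair_of_symmetric_of_odd hT (S.isOddGraph_testGraph G)
      (by norm_num)⟩,
    ⟨inferInstance, isFredholmPair_of_symmetric_of_odd hT (S.isOddGraph_testGraph G.swap)
      (by norm_num)⟩⟩
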